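/- Let $\mathsf{RCA}_0^\omega$ be Kohlenbach's base theory of higher-order Reverse Mathematics in all finite types (ordered semiring axioms for $\mathbb N$, the combinators $\Pi,\Sigma$, the recursor $R_0$, extensionality, induction for quantifier-free formulas, and $\mathsf{QF\text{-}AC}^{1,0}$), and let $\mathsf{ACA}_0^\omega=\mathsf{RCA}_0^\omega+(\exists^2)$, where $(\exists^2)$ states that there is $E:\mathbb N^{\mathbb N}\to\mathbb N$ with $E(f)=0\leftrightarrow(\exists n)(f(n)=0)$ for all $f$. Let $\mathsf{BOOT}$ be the principle: for every $Y:\mathbb N^{\mathbb N}\times\mathbb N\to\mathbb N$ there is $X\subset\mathbb N$ such that $n\in X\leftrightarrow(\exists f\in\mathbb N^{\mathbb N})(Y(f,n)=0)$ for all $n\in\mathbb N$. Let $D$ be $\mathbb R$ or $[0,1]$, and let topological notions for subsets of $D$ refer to the relative topology. Subsets of $D$ and of $\mathbb R$ are given by characteristic functions, while interiors, closures and boundaries are understood as formulas. For $f:D\to\mathbb R$ and $p,q\in\mathbb Q\cap D$, the integral $\int_p^q f$ equals $I\in\mathbb R$ if the Riemann sums of $f$ over tagged partitions from $p$ to $q$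 converge to $I$ as the mesh tends to $0$ (in the $\varepsilon$-$\delta$ sense, with $\int_p^q=-\int_q^p$ for $q<p$); it equals $+\infty$ (resp. $-\infty$) if these sums diverge to $+\infty$ (resp. $-\infty$) as the mesh tends to $0$; and it equals $\uparrow$ (undefined) otherwise. The evaluation principle for a class $\Gamma$ of functions on $D$ states that for every $f\in\Gamma$ there is a double sequence in $\mathbb R\cup\{+\infty,-\infty,\uparrow\}$, indexed by the rationals $p,q\in D$, whose entries are the values $\int_p^q f$. A function $f:D\to\mathbb R$ - is graph continuous if there is a continuous $g:D\to\mathbb R$ whose graph is contained in the closure of the graph of $f$; - has the Young condition if for every $x\in D$ there are sequences $x_n\to x$ from the left and $y_n\to x$ from the right in $D$ with $f(x_n)\to f(x)$ and $f(y_n)\to f(x)$ (only the sequence from inside $D$ if $x$ is an end-point of $D$); - is almost continuous (Husain) if for every $x\in D$ and open $G\subset\mathbb R$ with $f(x)\in G$, the closure of $f^{-1}(G)$ is a neighbourhood of $x$; - is of Cesàro type if there are non-empty open $U\subset D$, $V\subset\mathbb R$ with $U\subset\overline{f^{-1}(y)}$ for all $y\in V$; - is peripherally continuous if for every $x\in D$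 and open intervals $U\ni x$, $V\ni f(x)$ there is an open $W\subset U\cap D$ with $x\in W$ and $f(\partial W)\subset V$; - is pre-continuous if $f^{-1}(G)\subset\mathrm{int}(\overline{f^{-1}(G)})$ for every open $G\subset\mathbb R$; - is $\mathcal C$-continuous if for every open $G\subset\mathbb R$ there are an open $O\subset D$ and a set $A\subset D$ with $A\subset\mathrm{int}(\overline A)$ and $f^{-1}(G)=O\cap A$. **Theorem.** Over $\mathsf{ACA}_0^\omega$ (that is, in every model of $\mathsf{ACA}_0^\omega$, or equivalently, provably in $\mathsf{ACA}_0^\omega$), the following are equivalent: 1. $\mathsf{BOOT}$; 2. the evaluation principle for graph continuous functions $\mathbb R\to\mathbb R$; 3. the evaluation principle for graph continuous functions $[0,1]\to[0,1]$; 4. the evaluation principle for $\Gamma$ on $D$, for each choice of $D\in\{\mathbb R,[0,1]\}$ and for $\Gamma$ equal to any one of: the functions with the Young condition, almost continuous (Husain), graph continuous, not of Cesàro type, peripherally continuous, pre-continuous, or $\mathcal C$-continuous functions. -/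

import Mathlib

/-!
# Higher-order arithmetic: structures, base theory, real numbers, weak continuity, integration

"`A` and `B` are equivalent over the theory `T`" is read as: `A ↔ B` holds in every (Henkin) model
of `T`, standard or not. All the definitions below quantify only over the objects of the model, so
each of them spells out a formula of the language of all finite types. In particular the natural
numbers, rationals, reals, real functions, sets of reals, sequences and partitions are those of the
model.
-/

universe u

/-- The finite types: `0` and `σ → τ`. -/
inductive FinType where
  | zero : FinType
  | arrow : FinType → FinType → FinType

infixr:60 " ⇾ " => FinType.arrow

namespace FinType

/-- The type `1 = 0 → 0` of number-theoretic functions. -/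
abbrev one : FinType := zero ⇾ zero

end FinType

/-- A structure for the language of arithmetic in all finite types: a domain for every finite type,
application, the constants `0, 1, +, ×`, the combinators `Π` (`K`) and `Σ` (`S`), and the recursor
`R₀`. Equality is primitive at type `0` only and extensional at the other types; extensionally equal
objects are identified, i.e. the axiom of extensionality holds for identity. -/
structure FinTypeStructure where
  Obj : FinType → Type u
  app : ∀ {σ τ : FinType}, Obj (σ ⇾ τ) → Obj σ → Obj τ
  ext : ∀ {σ τ : FinType} (f g : Obj (σ ⇾ τ)), (∀ x, app f x = app g x) → f = g
  zero : Obj FinType.zero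
  one : Obj FinType.zero
  plus : Obj (FinType.zero ⇾ FinType.zero ⇾ FinType.zero)
  times : Obj (FinType.zero ⇾ FinType.zero ⇾ FinType.zero)
  K : ∀ σ τ : FinType, Obj (σ ⇾ τ ⇾ σ)
  S : ∀ σ τ ρ : FinType, Obj ((σ ⇾ τ ⇾ ρ) ⇾ (σ ⇾ τ) ⇾ σ ⇾ ρ)
  R : Obj ((FinType.zero ⇾ FinType.zero ⇾ FinType.zero) ⇾ FinType.zero ⇾ FinType.zero ⇾ FinType.zero)

namespace FinTypeStructure

/-- Application with the structure implicit. -/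
abbrev ap {M : FinTypeStructure.{u}} {σ τ : FinType} (f : M.Obj (σ ⇾ τ)) (x : M.Obj σ) : M.Obj τ :=
  M.app f x

end FinTypeStructure

infixl:100 " ⬝ " => FinTypeStructure.ap

namespace FinTypeStructure

variable (M : FinTypeStructure.{u})

/-- The natural numbers of the structure. -/
abbrev N : Type u := M.Obj FinType.zero

/-- The number-theoretic functions of the structure. -/
abbrev Fn : Type u := M.Obj FinType.one

instance : Zero M.N := ⟨M.zero⟩
instance : One M.N := ⟨M.one⟩
instance : Add M.N := ⟨fun a b => M.plus ⬝ a ⬝ b⟩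
instance : Mul M.N := ⟨fun a b => M.times ⬝ a ⬝ b⟩
instance : LE M.N := ⟨fun a b => ∃ c : M.N, a + c = b⟩
instance : LT M.N := ⟨fun a b => ∃ c : M.N, a + (c + 1) = b⟩

/-! ### The base theory -/

/-- Quantifier-free formulas `A(x, y)` with parameters from `M`: Boolean combinations of equations
of type `0` between terms (every term `t(x, y)` is of the form `s x y` by combinatory
completeness). -/
inductive QF {σ τ : FinType} : (M.Obj σ → M.Obj τ → Prop) → Prop where
  | eq (s t : M.Obj (σ ⇾ τ ⇾ FinType.zero)) : QF fun x y => s ⬝ x ⬝ y = t ⬝ x ⬝ y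
  | not {A : M.Obj σ → M.Obj τ → Prop} : QF A → QF fun x y => ¬ A x y
  | and {A B : M.Obj σ → M.Obj τ → Prop} : QF A → QF B → QF fun x y => A x y ∧ B x y

/-- `M` is a model of Kohlenbach's base theory `RCA₀^ω`. -/
structure IsModelRCA : Prop where
  -- the natural numbers form a (discretely) ordered semiring
  add_assoc : ∀ a b c : M.N, (a + b) + c = a + (b + c)
  add_comm : ∀ a b : M.N, a + b = b + a
  add_zero : ∀ a : M.N, a + 0 = a
  add_cancel : ∀ a b c : M.N, a + c = b + c → a = b
  mul_assoc : ∀ a b c : M.N, (a * b) * c = a * (b * c)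
  mul_comm : ∀ a b : M.N, a * b = b * a
  mul_zero : ∀ a : M.N, a * 0 = 0
  mul_one : ∀ a : M.N, a * 1 = a
  mul_add : ∀ a b c : M.N, a * (b + c) = a * b + a * c
  succ_ne_zero : ∀ a : M.N, a + 1 ≠ 0
  eq_zero_or_succ : ∀ a : M.N, a = 0 ∨ ∃ b : M.N, a = b + 1
  trichotomy : ∀ a b : M.N, a < b ∨ a = b ∨ b < a
  -- the defining axioms of the combinators and of the recursor
  K_eq : ∀ {σ τ : FinType} (x : M.Obj σ) (y : M.Obj τ), M.K σ τ ⬝ x ⬝ y = x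
  S_eq : ∀ {σ τ ρ : FinType} (x : M.Obj (σ ⇾ τ ⇾ ρ)) (y : M.Obj (σ ⇾ τ)) (z : M.Obj σ),
    M.S σ τ ρ ⬝ x ⬝ y ⬝ z = x ⬝ z ⬝ (y ⬝ z)
  R_zero : ∀ (f : M.Obj (FinType.zero ⇾ FinType.zero ⇾ FinType.zero)) (m : M.N),
    M.R ⬝ f ⬝ m ⬝ (0 : M.N) = m
  R_succ : ∀ (f : M.Obj (FinType.zero ⇾ FinType.zero ⇾ FinType.zero)) (m n : M.N),
    M.R ⬝ f ⬝ m ⬝ (n + 1) = f ⬝ n ⬝ (M.R ⬝ f ⬝ m ⬝ n)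
  -- induction for quantifier-free formulas, with a parameter of any type
  qf_induction : ∀ {σ : FinType} {A : M.Obj σ → M.N → Prop}, M.QF A →
    ∀ x : M.Obj σ, A x 0 → (∀ n : M.N, A x n → A x (n + 1)) → ∀ n : M.N, A x n
  -- the quantifier-free axiom of choice QF-AC^{1,0}
  qf_choice : ∀ {A : M.Fn → M.N → Prop}, M.QF A → (∀ f : M.Fn, ∃ n : M.N, A f n) →
    ∃ Y : M.Obj (FinType.one ⇾ FinType.zero), ∀ f : M.Fn, A f (Y ⬝ f)

/-- Kleene's quantifier `(∃²)`. -/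
def Exists2 : Prop :=
  ∃ E : M.Obj (FinType.one ⇾ FinType.zero),
    ∀ f : M.Fn, E ⬝ f = (0 : M.N) ↔ ∃ n : M.N, f ⬝ n = (0 : M.N)

/-- `M` is a model of `ACA₀^ω`, which is `RCA₀^ω + (∃²)`. -/
def IsModelACA : Prop := M.IsModelRCA ∧ M.Exists2

/-- The principle `BOOT`: for `Y : ℕ^ℕ × ℕ → ℕ` there is `X ⊆ ℕ` (a characteristic function) with
`n ∈ X ↔ ∃ f, Y(f, n) = 0`. -/
def BOOT : Prop :=
  ∀ Y : M.Obj (FinType.one ⇾ FinType.zero ⇾ FinType.zero),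
    ∃ X : M.Fn, (∀ n : M.N, X ⬝ n = (0 : M.N) ∨ X ⬝ n = (1 : M.N)) ∧
      ∀ n : M.N, X ⬝ n = (1 : M.N) ↔ ∃ f : M.Fn, Y ⬝ f ⬝ n = (0 : M.N)

/-! ### Rational numbers -/

/-- The function `n ↦ 2ⁿ` of the structure: `R₀` applied to `λ n r. r + r` and `1`. -/
def pow2 : M.Fn :=
  M.R ⬝ (M.K FinType.one FinType.zero ⬝
    (M.S FinType.zero FinType.zero FinType.zero ⬝ M.plus ⬝
      (M.S FinType.zero FinType.one FinType.zero ⬝ M.K FinType.zero FinType.one ⬝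
        M.K FinType.zero FinType.zero))) ⬝ M.one

/-- Fractions `(pos - neg) / den` of the structure, meaningful for `den ≠ 0`. -/
@[ext] structure Frac where
  pos : M.N
  neg : M.N
  den : M.N

/-- The pairing function `(a + b)² + a`. -/
def pair (a b : M.N) : M.N := (a + b) * (a + b) + a

variable {M}

namespace Frac

instance : Zero M.Frac := ⟨⟨0, 0, 1⟩⟩
instance : One M.Frac := ⟨⟨1, 0, 1⟩⟩
instance : Add M.Frac :=
  ⟨fun r s => ⟨r.pos * s.den + s.pos * r.den, r.neg * s.den + s.neg * r.den, r.den * s.den⟩⟩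
instance : Neg M.Frac := ⟨fun r => ⟨r.neg, r.pos, r.den⟩⟩
instance : Sub M.Frac := ⟨fun r s => r + -s⟩
instance : Mul M.Frac :=
  ⟨fun r s => ⟨r.pos * s.pos + r.neg * s.neg, r.pos * s.neg + r.neg * s.pos, r.den * s.den⟩⟩
instance : LT M.Frac :=
  ⟨fun r s => r.pos * s.den + s.neg * r.den < s.pos * r.den + r.neg * s.den⟩
instance : LE M.Frac :=
  ⟨fun r s => r.pos * s.den + s.neg * r.den ≤ s.pos * r.den + r.neg * s.den⟩

/-- `|r| ≤ s`. -/
def AbsLe (r s : M.Frac) : Prop := r ≤ s ∧ -r ≤ s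

/-- `|r| < s`. -/
def AbsLt (r s : M.Frac) : Prop := r < s ∧ -r < s

/-- The number coding a fraction. -/
def code (r : M.Frac) : M.N := M.pair (M.pair r.pos r.neg) r.den

/-- The integer `n` as a fraction. -/
def ofN (n : M.N) : M.Frac := ⟨n, 0, 1⟩

/-- The fraction `2⁻ⁿ`. -/
def invPow2 (n : M.N) : M.Frac := ⟨1, 0, M.pow2 ⬝ n⟩

end Frac

/-- The number `c` codes the rational number represented by `r`. -/
def IsRatCode (c : M.N) (r : M.Frac) : Prop := r.den ≠ 0 ∧ c = r.code

/-! ### Real numbers -/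

open Classical in
/-- The `n`-th rational approximation of the real number given by `x` (codes are unique). -/
noncomputable def approx (x : M.Fn) (n : M.N) : M.Frac :=
  if h : ∃ r : M.Frac, IsRatCode (x ⬝ n) r then h.choose else 0

/-- Real numbers are fast converging sequences of rationals: `|x_n - x_{n+i}| ≤ 2⁻ⁿ`. -/
def IsReal (x : M.Fn) : Prop :=
  (∀ n : M.N, ∃ r : M.Frac, IsRatCode (x ⬝ n) r) ∧
    ∀ n i : M.N, (approx x n - approx x (n + i)).AbsLe (Frac.invPow2 n)

/-- `x =_ℝ y`, i.e. `|x_n - y_n| ≤ 2 · 2⁻ⁿ` for all `n`. -/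
def REq (x y : M.Fn) : Prop :=
  ∀ n : M.N, (approx x n - approx y n).AbsLe (Frac.invPow2 n + Frac.invPow2 n)

/-- `x ≤_ℝ y`. -/
def RLe (x y : M.Fn) : Prop :=
  ∀ n : M.N, approx x n ≤ approx y n + (Frac.invPow2 n + Frac.invPow2 n)

/-- `x <_ℝ y`. -/
def RLt (x y : M.Fn) : Prop := ¬ RLe y x

/-- `|x - y| < 2⁻ᵏ` for reals `x, y`. -/
def Near (k : M.N) (x y : M.Fn) : Prop :=
  ∃ n : M.N, (approx x n - approx y n).AbsLt
    (Frac.invPow2 k - (Frac.invPow2 n + Frac.invPow2 n))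

/-- The real `z` is the limit of the given sequence of rationals. For example, `z = x · y` says
that `z` is the limit of `x_n · y_n`. -/
def IsLimit (s : M.N → M.Frac) (z : M.Fn) : Prop :=
  ∀ k : M.N, ∃ j : M.N, ∀ n : M.N, j ≤ n → (approx z n - s n).AbsLe (Frac.invPow2 k)

/-- A rational number as a real number (a constant sequence). -/
def Frac.toReal (r : M.Frac) : M.Fn := M.K FinType.zero FinType.zero ⬝ r.code

/-- The sequence of reals `u` converges to the real `x`. -/
def SeqTendsto (u : M.Obj (FinType.zero ⇾ FinType.one)) (x : M.Fn) : Prop :=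
  ∀ k : M.N, ∃ j : M.N, ∀ n : M.N, j ≤ n → Near k (u ⬝ n) x

/-- The two domains of functions that are considered: the real line and the unit interval. -/
inductive Dom where
  | line : Dom
  | unit : Dom

/-- Membership in the domain. -/
def Dom.Mem : Dom → M.Fn → Prop
  | .line, x => IsReal x
  | .unit, x => IsReal x ∧ RLe (0 : M.Frac).toReal x ∧ RLe x (1 : M.Frac).toReal

/-- `f` represents a function from `D` to `ℝ`: it maps (codes of) elements of `D` to reals and
respects equality of reals. -/
def IsFun (D : Dom) (f : M.Obj (FinType.one ⇾ FinType.one)) : Prop :=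
  (∀ x : M.Fn, D.Mem x → IsReal (f ⬝ x)) ∧
    ∀ x y : M.Fn, D.Mem x → D.Mem y → REq x y → REq (f ⬝ x) (f ⬝ y)

/-- `F` is the characteristic function of a subset of `D`. -/
def IsSet (D : Dom) (F : M.Obj (FinType.one ⇾ FinType.zero)) : Prop :=
  (∀ x : M.Fn, D.Mem x → F ⬝ x = (0 : M.N) ∨ F ⬝ x = (1 : M.N)) ∧
    ∀ x y : M.Fn, D.Mem x → D.Mem y → REq x y → F ⬝ x = F ⬝ y

/-! ### Topology of the domain

Subsets of `D` given by formulas ("virtual" sets) are predicates; sets that are quantified over are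
characteristic functions in the structure. The topology is the relative topology of `D`. -/

/-- The subset of `D` with characteristic function `F`. -/
def carrier (D : Dom) (F : M.Obj (FinType.one ⇾ FinType.zero)) (x : M.Fn) : Prop :=
  D.Mem x ∧ F ⬝ x = (1 : M.N)

/-- `x` is in the interior of `A` in `D`. -/
def interior (D : Dom) (A : M.Fn → Prop) (x : M.Fn) : Prop :=
  D.Mem x ∧ ∃ k : M.N, ∀ y : M.Fn, D.Mem y → Near k x y → A y

/-- `x` is in the closure of `A` in `D`. -/
def closure (D : Dom) (A : M.Fn → Prop) (x : M.Fn) : Prop :=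
  D.Mem x ∧ ∀ k : M.N, ∃ y : M.Fn, D.Mem y ∧ A y ∧ Near k x y

/-- `x` is in the boundary of `A` in `D`. -/
def boundary (D : Dom) (A : M.Fn → Prop) (x : M.Fn) : Prop :=
  closure D A x ∧ ¬ interior D A x

/-- `F` is (the characteristic function of) an open subset of `D`. -/
def IsOpenSet (D : Dom) (F : M.Obj (FinType.one ⇾ FinType.zero)) : Prop :=
  IsSet D F ∧ ∀ x : M.Fn, carrier D F x → interior D (carrier D F) x

/-- The subset `A` of `D` is pre-open: it is contained in the interior of its closure. -/
def IsPreOpen (D : Dom) (A : M.Fn → Prop) : Prop :=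
  ∀ x : M.Fn, A x → interior D (closure D A) x

/-- The inverse image `f⁻¹(G)` as a subset of `D`, for `G ⊆ ℝ`. -/
def preimage (D : Dom) (f : M.Obj (FinType.one ⇾ FinType.one))
    (G : M.Obj (FinType.one ⇾ FinType.zero)) (x : M.Fn) : Prop :=
  D.Mem x ∧ carrier Dom.line G (f ⬝ x)

/-- The inverse image `f⁻¹(y)` as a subset of `D`, for `y ∈ ℝ`. -/
def fiber (D : Dom) (f : M.Obj (FinType.one ⇾ FinType.one)) (y x : M.Fn) : Prop :=
  D.Mem x ∧ REq (f ⬝ x) y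

/-! ### Weak continuity -/

/-- (Epsilon-delta) continuity on `D`. -/
def ContinuousFun (D : Dom) (g : M.Obj (FinType.one ⇾ FinType.one)) : Prop :=
  ∀ x : M.Fn, D.Mem x → ∀ k : M.N, ∃ m : M.N, ∀ y : M.Fn, D.Mem y → Near m x y →
    Near k (g ⬝ x) (g ⬝ y)

/-- The point `(x, y)` is in the closure of the graph of `f : D → ℝ`. -/
def InGraphClosure (D : Dom) (f : M.Obj (FinType.one ⇾ FinType.one)) (x y : M.Fn) : Prop :=
  ∀ k : M.N, ∃ z : M.Fn, D.Mem z ∧ Near k x z ∧ Near k y (f ⬝ z)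

/-- Graph continuity: the closure of the graph of `f` contains the graph of a continuous
`g : D → ℝ`. -/
def GraphContinuous (D : Dom) (f : M.Obj (FinType.one ⇾ FinType.one)) : Prop :=
  ∃ g : M.Obj (FinType.one ⇾ FinType.one), IsFun D g ∧ ContinuousFun D g ∧
    ∀ x : M.Fn, D.Mem x → InGraphClosure D f x (g ⬝ x)

/-- The Young condition. At an end-point of `D`, only the sequence on the other side is required. -/
def YoungCondition (D : Dom) (f : M.Obj (FinType.one ⇾ FinType.one)) : Prop :=
  ∀ x : M.Fn, D.Mem x →
    ((∃ y : M.Fn, D.Mem y ∧ RLt y x) →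
      ∃ u v : M.Obj (FinType.zero ⇾ FinType.one),
        (∀ n : M.N, D.Mem (u ⬝ n) ∧ RLt (u ⬝ n) x ∧ v ⬝ n = f ⬝ (u ⬝ n)) ∧
          SeqTendsto u x ∧ SeqTendsto v (f ⬝ x)) ∧
    ((∃ y : M.Fn, D.Mem y ∧ RLt x y) →
      ∃ u v : M.Obj (FinType.zero ⇾ FinType.one),
        (∀ n : M.N, D.Mem (u ⬝ n) ∧ RLt x (u ⬝ n) ∧ v ⬝ n = f ⬝ (u ⬝ n)) ∧
          SeqTendsto u x ∧ SeqTendsto v (f ⬝ x))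

/-- Almost continuity in the sense of Husain. -/
def AlmostContinuousHusain (D : Dom) (f : M.Obj (FinType.one ⇾ FinType.one)) : Prop :=
  ∀ x : M.Fn, D.Mem x → ∀ G : M.Obj (FinType.one ⇾ FinType.zero), IsOpenSet Dom.line G →
    carrier Dom.line G (f ⬝ x) → interior D (closure D (preimage D f G)) x

/-- Being of Cesàro type. -/
def CesaroType (D : Dom) (f : M.Obj (FinType.one ⇾ FinType.one)) : Prop :=
  ∃ U V : M.Obj (FinType.one ⇾ FinType.zero), IsOpenSet D U ∧ IsOpenSet Dom.line V ∧
    (∃ x : M.Fn, carrier D U x) ∧ (∃ y : M.Fn, carrier Dom.line V y) ∧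
      ∀ y : M.Fn, carrier Dom.line V y → ∀ x : M.Fn, carrier D U x → closure D (fiber D f y) x

/-- Peripheral continuity; the open intervals are `U = (a, b)` and `V = (c, d)`. -/
def PeripherallyContinuous (D : Dom) (f : M.Obj (FinType.one ⇾ FinType.one)) : Prop :=
  ∀ x : M.Fn, D.Mem x → ∀ a b c d : M.Fn, IsReal a → IsReal b → IsReal c → IsReal d →
    RLt a x → RLt x b → RLt c (f ⬝ x) → RLt (f ⬝ x) d →
      ∃ W : M.Obj (FinType.one ⇾ FinType.zero), IsOpenSet D W ∧ carrier D W x ∧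
        (∀ y : M.Fn, carrier D W y → RLt a y ∧ RLt y b) ∧
          ∀ y : M.Fn, boundary D (carrier D W) y → RLt c (f ⬝ y) ∧ RLt (f ⬝ y) d

/-- Pre-continuity: inverse images of open sets are pre-open. -/
def PreContinuous (D : Dom) (f : M.Obj (FinType.one ⇾ FinType.one)) : Prop :=
  ∀ G : M.Obj (FinType.one ⇾ FinType.zero), IsOpenSet Dom.line G → IsPreOpen D (preimage D f G)

/-- `𝒞`-continuity: inverse images of open sets are `𝒞`-sets, i.e. of the form `O ∩ A` where `O` is
open and `A` is contained in the interior of its closure. -/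
def CContinuous (D : Dom) (f : M.Obj (FinType.one ⇾ FinType.one)) : Prop :=
  ∀ G : M.Obj (FinType.one ⇾ FinType.zero), IsOpenSet Dom.line G →
    ∃ O A : M.Obj (FinType.one ⇾ FinType.zero), IsOpenSet D O ∧ IsSet D A ∧
      IsPreOpen D (carrier D A) ∧
        ∀ x : M.Fn, preimage D f G x ↔ carrier D O x ∧ carrier D A x

/-- The seven weak continuity notions. -/
inductive WeakNotion where
  | young | husain | graph | notCesaro | peripheral | pre | cCont

/-- `f : D → ℝ` is weakly continuous in the given sense. -/
def WeakNotion.Holds (D : Dom) (f : M.Obj (FinType.one ⇾ FinType.one)) : WeakNotion → Prop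
  | .young => YoungCondition D f
  | .husain => AlmostContinuousHusain D f
  | .graph => GraphContinuous D f
  | .notCesaro => ¬ CesaroType D f
  | .peripheral => PeripherallyContinuous D f
  | .pre => PreContinuous D f
  | .cCont => CContinuous D f

/-- The values of `f` on `[0,1]` lie in `[0,1]`. -/
def MapsToUnit (f : M.Obj (FinType.one ⇾ FinType.one)) : Prop :=
  ∀ x : M.Fn, Dom.unit.Mem x → Dom.unit.Mem (f ⬝ x)

/-! ### The Riemann integral -/

/-- `x_0 = p, x_1, …, x_n = q` is a tagged partition with tags `t_i` between `x_i` and `x_{i+1}`.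
The partition runs from `p` to `q`, so for `q < p` it is decreasing. -/
def IsPartition (p q : M.Fn) (n : M.N) (x t : M.Obj (FinType.zero ⇾ FinType.one)) : Prop :=
  (∀ i : M.N, i ≤ n → IsReal (x ⬝ i)) ∧ (∀ i : M.N, i < n → IsReal (t ⬝ i)) ∧
    REq (x ⬝ (0 : M.N)) p ∧ REq (x ⬝ n) q ∧
      ((∀ i : M.N, i < n → RLe (x ⬝ i) (t ⬝ i) ∧ RLe (t ⬝ i) (x ⬝ (i + 1))) ∨
        (∀ i : M.N, i < n → RLe (x ⬝ (i + 1)) (t ⬝ i) ∧ RLe (t ⬝ i) (x ⬝ i)))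

/-- The mesh of the partition is less than `2⁻ᵐ`. -/
def MeshLt (m n : M.N) (x : M.Obj (FinType.zero ⇾ FinType.one)) : Prop :=
  ∀ i : M.N, i < n → Near m (x ⬝ i) (x ⬝ (i + 1))

/-- The real `v` is the Riemann sum `∑_{i < n} f(t_i) (x_{i+1} - x_i)`, where `s` lists the partial
sums. -/
def IsRiemannSum (f : M.Obj (FinType.one ⇾ FinType.one)) (n : M.N)
    (x t : M.Obj (FinType.zero ⇾ FinType.one)) (v : M.Fn) : Prop :=
  ∃ s : M.Obj (FinType.zero ⇾ FinType.one),
    (∀ i : M.N, i ≤ n → IsReal (s ⬝ i)) ∧ REq (s ⬝ (0 : M.N)) (0 : M.Frac).toReal ∧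
      (∀ i : M.N, i < n → IsLimit (fun m => approx (s ⬝ i) m +
        approx (f ⬝ (t ⬝ i)) m * (approx (x ⬝ (i + 1)) m - approx (x ⬝ i) m)) (s ⬝ (i + 1))) ∧
      IsReal v ∧ REq v (s ⬝ n)

/-- The Riemann sums of `f` from `p` to `q` for partitions of mesh less than `2⁻ᵐ` satisfy `C`. -/
def SumsSatisfy (f : M.Obj (FinType.one ⇾ FinType.one)) (p q : M.Fn) (m : M.N)
    (C : M.Fn → Prop) : Prop :=
  ∀ (n : M.N) (x t : M.Obj (FinType.zero ⇾ FinType.one)) (v : M.Fn),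
    IsPartition p q n x t → MeshLt m n x → IsRiemannSum f n x t v → C v

/-- `∫_p^q f = I` for a real `I`. -/
def IntegralEqReal (f : M.Obj (FinType.one ⇾ FinType.one)) (p q I : M.Fn) : Prop :=
  IsReal I ∧ ∀ k : M.N, ∃ m : M.N, SumsSatisfy f p q m fun v => Near k v I

/-- `∫_p^q f = +∞`. -/
def IntegralEqTop (f : M.Obj (FinType.one ⇾ FinType.one)) (p q : M.Fn) : Prop :=
  ∀ k : M.N, ∃ m : M.N, SumsSatisfy f p q m fun v => RLt (Frac.ofN k).toReal v

/-- `∫_p^q f = -∞`. -/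
def IntegralEqBot (f : M.Obj (FinType.one ⇾ FinType.one)) (p q : M.Fn) : Prop :=
  ∀ k : M.N, ∃ m : M.N, SumsSatisfy f p q m fun v => RLt v (-Frac.ofN k).toReal

/-- `∫_p^q f` is undefined. -/
def IntegralUndefined (f : M.Obj (FinType.one ⇾ FinType.one)) (p q : M.Fn) : Prop :=
  (¬ ∃ I : M.Fn, IntegralEqReal f p q I) ∧ ¬ IntegralEqTop f p q ∧ ¬ IntegralEqBot f p q

/-- `∫_p^q f` is the element of `ℝ ∪ {+∞, -∞, ↑}` given by the tag `e` and the real `I`: the tag `0`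
stands for the real `I`, the tags `1, 2, 3` stand for `+∞, -∞, ↑`. -/
def IntegralEq (f : M.Obj (FinType.one ⇾ FinType.one)) (p q : M.Fn) (e : M.N) (I : M.Fn) : Prop :=
  (e = 0 ∧ IntegralEqReal f p q I) ∨ (e = 1 ∧ IntegralEqTop f p q) ∨
    (e = 1 + 1 ∧ IntegralEqBot f p q) ∨ (e = 1 + 1 + 1 ∧ IntegralUndefined f p q)

/-- The evaluation principle for a class `Γ` of functions on `D`: for `f : D → ℝ` in `Γ` there is a
(double) sequence in `ℝ ∪ {+∞, -∞, ↑}`, indexed by (codes of) the rationals `p, q` in `D`, that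
consists of the values of `∫_p^q f`. -/
def EvaluationPrinciple (D : Dom) (Γ : M.Obj (FinType.one ⇾ FinType.one) → Prop) : Prop :=
  ∀ f : M.Obj (FinType.one ⇾ FinType.one), IsFun D f → Γ f →
    ∃ (e : M.Obj (FinType.zero ⇾ FinType.zero ⇾ FinType.zero))
      (I : M.Obj (FinType.zero ⇾ FinType.zero ⇾ FinType.one)),
      ∀ p q : M.Frac, p.den ≠ 0 → q.den ≠ 0 → D.Mem p.toReal → D.Mem q.toReal →
        IntegralEq f p.toReal q.toReal (e ⬝ p.code ⬝ q.code) (I ⬝ p.code ⬝ q.code)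

end FinTypeStructure

/-! From `BOOT` to evaluation: with `(∃²)`, arithmetical formulas with parameters have
characteristic functions in the model (`Dec`), and a partition with its tags, partial sums and value
can be packed into one number-theoretic function. "All Riemann sums of mesh below `2⁻ᵐ` satisfy a
bound" then asserts that no function codes a counterexample, which `BOOT` decides uniformly in the
numerical parameters (`BOOT.dec_sumsSatisfy`). Divergence to `±∞` and the Cauchy property of the
Riemann sums become decidable, and a search operator reads off the value of the integral
(`BOOT.exists_integrals`). This works for arbitrary `f`, so it covers all the classes at once.

From evaluation to `BOOT`: given `Y`, one function `codeFun Y`, with values `0` and `1`, lies in all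
the classes. It is `1` at those `x` in an interval `(2⁻ⁿ⁻¹, 2⁻ⁿ)` for which some dyadic translate `x
+ d` has binary digits coding the graph of some `g` with `Y(g, n) = 0`. Three facts carry the
argument. Dyadic rationals code nothing, because their digits are eventually `0` while a graph has
digits `1` arbitrarily far out; so the zeros are dense. If some `g` has `Y(g, n) = 0`, the dyadic
translates of `graphReal g` make the value `1` dense in `(2⁻ⁿ⁻¹, 2⁻ⁿ)`; otherwise the function
vanishes there. Near each point, the function is invariant under small dyadic translations.

The weak continuity notions follow from density of the fibres (Husain, pre-, `𝒞`- and graph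
continuity), from local dyadic invariance (Young, peripheral), and from there being only two values
(not of Cesàro type). For integrals over `[2⁻ⁿ⁻¹, 2⁻ⁿ]`, dyadic tags give arbitrarily fine Riemann
sums equal to `0`; if `Y(g, n) = 0`, translated tags give arbitrarily fine sums equal to `2⁻ⁿ⁻¹`. So
the integral is real exactly when no such `g` exists, and the tags of the evaluation sequence yield
the set required by `BOOT`.

Inequalities between reals of the model are handled externally: `val` sends them to a linearly
ordered ring `RealM`, so that ordinary algebra applies. Inductions and searches stay inside the
model, on `Dec` predicates. -/

set_option linter.unusedSectionVars false

namespace FinTypeStructure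

/-! ### The numbers of the structure as an ordered semiring. -/

section Arithmetic

variable {M : FinTypeStructure.{u}} [hM : Fact M.IsModelACA]

instance : CommSemiring M.N where
  add_assoc := hM.out.1.add_assoc
  zero_add a := by rw [hM.out.1.add_comm, hM.out.1.add_zero]
  add_zero := hM.out.1.add_zero
  nsmul := nsmulRec
  add_comm := hM.out.1.add_comm
  left_distrib := hM.out.1.mul_add
  right_distrib a b c := by
    rw [hM.out.1.mul_comm, hM.out.1.mul_add, hM.out.1.mul_comm c a, hM.out.1.mul_comm c b]
  zero_mul a := by rw [hM.out.1.mul_comm, hM.out.1.mul_zero]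
  mul_zero := hM.out.1.mul_zero
  mul_assoc := hM.out.1.mul_assoc
  one_mul a := by rw [hM.out.1.mul_comm, hM.out.1.mul_one]
  mul_one := hM.out.1.mul_one
  mul_comm := hM.out.1.mul_comm

theorem add_one_ne_zero' (a : M.N) : a + 1 ≠ 0 := hM.out.1.succ_ne_zero a

theorem eq_zero_or_add_one (a : M.N) : a = 0 ∨ ∃ b : M.N, a = b + 1 := hM.out.1.eq_zero_or_succ a

instance : IsRightCancelAdd M.N := ⟨fun c a b h => hM.out.1.add_cancel a b c h⟩

instance : IsCancelAdd M.N := AddCommMagma.IsRightCancelAdd.toIsCancelAdd M.N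

theorem eq_zero_of_add_eq_zero {a b : M.N} (h : a + b = 0) : a = 0 ∧ b = 0 := by
  have key : ∀ {a b : M.N}, a + b = 0 → b = 0 := by
    intro a b h
    rcases eq_zero_or_add_one b with hb | ⟨c, rfl⟩
    · exact hb
    · exact absurd (by rw [← h, add_assoc]) (add_one_ne_zero' (a + c))
  exact ⟨key (by rwa [add_comm] at h), key h⟩

theorem le_def {a b : M.N} : a ≤ b ↔ ∃ c, a + c = b := Iff.rfl

theorem lt_def {a b : M.N} : a < b ↔ ∃ c, a + (c + 1) = b := Iff.rfl

noncomputable instance : LinearOrder M.N where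
  le_refl a := ⟨0, add_zero a⟩
  le_trans := by
    rintro a _ _ ⟨c, rfl⟩ ⟨d, rfl⟩
    exact ⟨c + d, (add_assoc _ _ _).symm⟩
  le_antisymm := by
    rintro a b ⟨c, rfl⟩ ⟨d, h⟩
    have h0 : c + d = 0 := by
      rw [add_assoc] at h
      exact left_eq_add.1 h.symm
    rw [(eq_zero_of_add_eq_zero h0).1, add_zero]
  lt_iff_le_not_ge := by
    intro a b
    constructor
    · rintro ⟨c, rfl⟩
      refine ⟨⟨c + 1, rfl⟩, ?_⟩
      rintro ⟨d, h⟩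
      rw [add_assoc] at h
      exact add_one_ne_zero' c (eq_zero_of_add_eq_zero (left_eq_add.1 h.symm)).1
    · rintro ⟨⟨c, rfl⟩, h⟩
      rcases eq_zero_or_add_one c with rfl | ⟨d, rfl⟩
      · exact absurd ⟨0, by simp⟩ h
      · exact ⟨d, rfl⟩
  le_total a b := by
    rcases hM.out.1.trichotomy a b with ⟨c, h⟩ | rfl | ⟨c, h⟩
    · exact Or.inl ⟨c + 1, h⟩
    · exact Or.inl ⟨0, add_zero a⟩
    · exact Or.inr ⟨c + 1, h⟩
  toDecidableLE := Classical.decRel _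

theorem zero_le' (a : M.N) : 0 ≤ a := ⟨a, zero_add a⟩

instance : IsOrderedAddMonoid M.N where
  add_le_add_left := by
    rintro a _ ⟨d, rfl⟩ c
    exact ⟨d, by ring⟩

instance : IsOrderedCancelAddMonoid M.N where
  le_of_add_le_add_left := by
    rintro a b c ⟨d, h⟩
    exact ⟨d, add_left_cancel (a := a) (by rw [← h, add_assoc])⟩

instance : Nontrivial M.N := ⟨⟨0, 1, fun h => add_one_ne_zero' (0 : M.N) (by rw [zero_add, ← h])⟩⟩

theorem mul_pos' {a b : M.N} (ha : 0 < a) (hb : 0 < b) : 0 < a * b := by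
  obtain ⟨c, rfl⟩ := ha
  obtain ⟨d, rfl⟩ := hb
  exact ⟨c * d + c + d, by ring⟩

instance : IsStrictOrderedRing M.N where
  zero_le_one := zero_le' 1
  mul_lt_mul_of_pos_left := by
    rintro a ha b c ⟨d, rfl⟩
    have := mul_pos' ha (⟨d, by rw [zero_add]⟩ : 0 < d + 1)
    show a * b < a * (b + (d + 1))
    rw [mul_add]
    exact lt_add_of_pos_right _ this
  mul_lt_mul_of_pos_right := by
    rintro a ha b c ⟨d, rfl⟩
    have := mul_pos' (⟨d, by rw [zero_add]⟩ : 0 < d + 1) ha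
    show b * a < (b + (d + 1)) * a
    rw [add_mul]
    exact lt_add_of_pos_right _ this

instance : CanonicallyOrderedAdd M.N where
  exists_add_of_le := by
    rintro a _ ⟨c, rfl⟩
    exact ⟨c, rfl⟩
  le_self_add a b := ⟨b, rfl⟩
  le_add_self a b := ⟨b, add_comm _ _⟩

instance : NoZeroDivisors M.N := inferInstance

instance : IsCancelMulZero M.N := inferInstance

theorem lt_iff_add_one_le' {a b : M.N} : a < b ↔ a + 1 ≤ b := by
  constructor
  · rintro ⟨c, rfl⟩
    exact ⟨c, by ring⟩
  · rintro ⟨c, rfl⟩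
    exact ⟨c, by ring⟩

theorem lt_add_one_iff' {a b : M.N} : a < b + 1 ↔ a ≤ b := by
  rw [lt_iff_add_one_le', add_le_add_iff_right]

theorem exists_eq_add_of_le' {a b : M.N} (h : a ≤ b) : ∃ c, b = a + c := by
  obtain ⟨c, rfl⟩ := h
  exact ⟨c, rfl⟩

/-! ### The ordered field of rationals -/

variable (M) in
/-- Fractions with nonzero denominator. -/
abbrev ProperFrac : Type u := {r : M.Frac // r.den ≠ 0}

/-- Cross-multiplication with the negative parts moved to the other side, since the numbers of the
structure have no subtraction. -/
instance fracSetoid : Setoid M.ProperFrac where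
  r r s := r.1.pos * s.1.den + s.1.neg * r.1.den = s.1.pos * r.1.den + r.1.neg * s.1.den
  iseqv :=
    { refl := fun _ => rfl
      symm := fun h => h.symm
      trans := by
        intro r s t h1 h2
        apply mul_right_cancel₀ s.2
        grind }

variable (M) in
/-- The rationals of the structure. -/
def RatM : Type u := Quotient (fracSetoid (M := M))

theorem fracSetoid_r {r s : M.ProperFrac} : r ≈ s ↔
    r.1.pos * s.1.den + s.1.neg * r.1.den = s.1.pos * r.1.den + r.1.neg * s.1.den := Iff.rfl

theorem frac_add_def (r s : M.Frac) : r + s =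
  ⟨r.pos * s.den + s.pos * r.den, r.neg * s.den + s.neg * r.den, r.den * s.den⟩ := rfl

theorem frac_mul_def (r s : M.Frac) : r * s =
  ⟨r.pos * s.pos + r.neg * s.neg, r.pos * s.neg + r.neg * s.pos, r.den * s.den⟩ := rfl

theorem frac_neg_def (r : M.Frac) : -r = ⟨r.neg, r.pos, r.den⟩ := rfl

theorem frac_sub_def (r s : M.Frac) : r - s = r + -s := rfl

theorem frac_zero_def : (0 : M.Frac) = ⟨0, 0, 1⟩ := rfl

theorem frac_one_def : (1 : M.Frac) = ⟨1, 0, 1⟩ := rfl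

theorem frac_le_def {r s : M.Frac} :
  r ≤ s ↔ r.pos * s.den + s.neg * r.den ≤ s.pos * r.den + r.neg * s.den := Iff.rfl

theorem frac_lt_def {r s : M.Frac} :
  r < s ↔ r.pos * s.den + s.neg * r.den < s.pos * r.den + r.neg * s.den := Iff.rfl

theorem den_add {r s : M.Frac} (hr : r.den ≠ 0) (hs : s.den ≠ 0) : (r + s).den ≠ 0 :=
  mul_ne_zero hr hs

theorem den_mul {r s : M.Frac} (hr : r.den ≠ 0) (hs : s.den ≠ 0) : (r * s).den ≠ 0 :=
  mul_ne_zero hr hs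

theorem den_neg {r : M.Frac} (hr : r.den ≠ 0) : (-r).den ≠ 0 := hr

theorem den_sub {r s : M.Frac} (hr : r.den ≠ 0) (hs : s.den ≠ 0) : (r - s).den ≠ 0 :=
  mul_ne_zero hr hs

theorem den_zero : (0 : M.Frac).den ≠ 0 := one_ne_zero (α := M.N)

theorem den_one : (1 : M.Frac).den ≠ 0 := one_ne_zero (α := M.N)

theorem frac_le_trans {r s t : M.Frac} (hs : s.den ≠ 0)
    (h1 : r ≤ s) (h2 : s ≤ t) : r ≤ t := by
  rw [frac_le_def] at *
  have hs' := pos_iff_ne_zero.2 hs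
  refine le_of_mul_le_mul_right ?_ hs'
  obtain ⟨a, ha⟩ := h1
  obtain ⟨b, hb⟩ := h2
  exact ⟨a * t.den + b * r.den, by grind⟩

namespace RatM

instance : Zero M.RatM := ⟨Quotient.mk _ ⟨0, den_zero⟩⟩

instance : One M.RatM := ⟨Quotient.mk _ ⟨1, den_one⟩⟩

instance : Add M.RatM := ⟨Quotient.map₂ (fun r s => ⟨r.1 + s.1, den_add r.2 s.2⟩) (by
  intro a b h c d h'
  simp only [fracSetoid_r, frac_add_def] at *
  grind)⟩

instance : Mul M.RatM := ⟨Quotient.map₂ (fun r s => ⟨r.1 * s.1, den_mul r.2 s.2⟩) (by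
  intro a b h c d h'
  simp only [fracSetoid_r, frac_mul_def] at *
  have h1 : (a.1.pos * b.1.den + b.1.neg * a.1.den) * (c.1.pos * d.1.den) =
    (b.1.pos * a.1.den + a.1.neg * b.1.den) * (c.1.pos * d.1.den) := by rw [h]
  have h2 : (a.1.pos * b.1.den + b.1.neg * a.1.den) * (c.1.neg * d.1.den) =
    (b.1.pos * a.1.den + a.1.neg * b.1.den) * (c.1.neg * d.1.den) := by rw [h]
  have h3 : (c.1.pos * d.1.den + d.1.neg * c.1.den) * (b.1.pos * a.1.den) =
    (d.1.pos * c.1.den + c.1.neg * d.1.den) * (b.1.pos * a.1.den) := by rw [h']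
  have h4 : (c.1.pos * d.1.den + d.1.neg * c.1.den) * (b.1.neg * a.1.den) =
    (d.1.pos * c.1.den + c.1.neg * d.1.den) * (b.1.neg * a.1.den) := by rw [h']
  clear h h'
  grind)⟩

instance : Neg M.RatM := ⟨Quotient.map (fun r => ⟨-r.1, den_neg r.2⟩) (by
  intro a b h
  simp only [fracSetoid_r, frac_neg_def] at *
  grind)⟩

instance : CommRing M.RatM where
  add_assoc := by
    rintro ⟨a⟩ ⟨b⟩ ⟨c⟩
    refine Quotient.sound ?_
    simp only [fracSetoid_r, frac_add_def]
    ring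
  zero_add := by
    rintro ⟨a⟩
    refine Quotient.sound ?_
    simp only [fracSetoid_r, frac_add_def, frac_zero_def]
    ring
  add_zero := by
    rintro ⟨a⟩
    refine Quotient.sound ?_
    simp only [fracSetoid_r, frac_add_def, frac_zero_def]
    ring
  nsmul := nsmulRec
  zsmul := zsmulRec
  add_comm := by
    rintro ⟨a⟩ ⟨b⟩
    refine Quotient.sound ?_
    simp only [fracSetoid_r, frac_add_def]
    ring
  left_distrib := by
    rintro ⟨a⟩ ⟨b⟩ ⟨c⟩
    refine Quotient.sound ?_
    simp only [fracSetoid_r, frac_add_def, frac_mul_def]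
    ring
  right_distrib := by
    rintro ⟨a⟩ ⟨b⟩ ⟨c⟩
    refine Quotient.sound ?_
    simp only [fracSetoid_r, frac_add_def, frac_mul_def]
    ring
  zero_mul := by
    rintro ⟨a⟩
    refine Quotient.sound ?_
    simp only [fracSetoid_r, frac_mul_def, frac_zero_def]
    ring
  mul_zero := by
    rintro ⟨a⟩
    refine Quotient.sound ?_
    simp only [fracSetoid_r, frac_mul_def, frac_zero_def]
    ring
  mul_assoc := by
    rintro ⟨a⟩ ⟨b⟩ ⟨c⟩
    refine Quotient.sound ?_
    simp only [fracSetoid_r, frac_mul_def]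
    ring
  one_mul := by
    rintro ⟨a⟩
    refine Quotient.sound ?_
    simp only [fracSetoid_r, frac_mul_def, frac_one_def]
    ring
  mul_one := by
    rintro ⟨a⟩
    refine Quotient.sound ?_
    simp only [fracSetoid_r, frac_mul_def, frac_one_def]
    ring
  mul_comm := by
    rintro ⟨a⟩ ⟨b⟩
    refine Quotient.sound ?_
    simp only [fracSetoid_r, frac_mul_def]
    ring
  neg_add_cancel := by
    rintro ⟨a⟩
    refine Quotient.sound ?_
    simp only [fracSetoid_r, frac_add_def, frac_neg_def, frac_zero_def]
    ring

instance : LE M.RatM := ⟨Quotient.lift₂ (fun r s => r.1 ≤ s.1) (by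
  intro a b c d h h'
  rw [fracSetoid_r] at h h'
  have key : ∀ {a c : M.ProperFrac}, a ≈ c → a.1 ≤ c.1 := fun h => by
    rw [frac_le_def, fracSetoid_r.1 h]
  exact propext ⟨fun H => frac_le_trans b.2 (frac_le_trans a.2 (key h.symm) H)
      (key h'), fun H => frac_le_trans d.2 (frac_le_trans c.2 (key h) H)
      (key h'.symm)⟩)⟩

noncomputable instance : LinearOrder M.RatM where
  le_refl := by
    rintro ⟨a⟩
    exact le_refl (a.1.pos * a.1.den + a.1.neg * a.1.den)
  le_trans := by
    rintro ⟨a⟩ ⟨b⟩ ⟨c⟩ h1 h2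
    exact frac_le_trans b.2 h1 h2
  le_antisymm := by
    rintro ⟨a⟩ ⟨b⟩ h1 h2
    refine Quotient.sound (fracSetoid_r.2 ?_)
    have h1 : a.1 ≤ b.1 := h1
    have h2 : b.1 ≤ a.1 := h2
    rw [frac_le_def] at h1 h2
    exact le_antisymm h1 h2
  le_total := by
    rintro ⟨a⟩ ⟨b⟩
    exact le_total (a.1.pos * b.1.den + b.1.neg * a.1.den) (b.1.pos * a.1.den + a.1.neg * b.1.den)
  toDecidableLE := Classical.decRel _

/-- The value of a fraction with nonzero denominator. -/
def mk (r : M.Frac) (h : r.den ≠ 0) : M.RatM := Quotient.mk _ ⟨r, h⟩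

theorem mk_le {r s : M.Frac} {hr : r.den ≠ 0} {hs : s.den ≠ 0} : mk r hr ≤ mk s hs ↔ r ≤ s :=
  Iff.rfl

theorem mk_lt {r s : M.Frac} {hr : r.den ≠ 0} {hs : s.den ≠ 0} : mk r hr < mk s hs ↔ r < s := by
  rw [lt_iff_not_ge, mk_le, frac_le_def, frac_lt_def, lt_iff_not_ge]

theorem mk_eq {r s : M.Frac} {hr : r.den ≠ 0} {hs : s.den ≠ 0} : mk r hr = mk s hs ↔
    r.pos * s.den + s.neg * r.den = s.pos * r.den + r.neg * s.den := by
  exact Quotient.eq.trans fracSetoid_r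

theorem mk_add {r s : M.Frac} (hr : r.den ≠ 0) (hs : s.den ≠ 0) :
    mk (r + s) (den_add hr hs) = mk r hr + mk s hs := rfl

theorem mk_mul {r s : M.Frac} (hr : r.den ≠ 0) (hs : s.den ≠ 0) :
    mk (r * s) (den_mul hr hs) = mk r hr * mk s hs := rfl

theorem mk_neg {r : M.Frac} (hr : r.den ≠ 0) : mk (-r) (den_neg hr) = - mk r hr := rfl

theorem mk_sub {r s : M.Frac} (hr : r.den ≠ 0) (hs : s.den ≠ 0) :
    mk (r - s) (den_sub hr hs) = mk r hr - mk s hs := by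
  rw [sub_eq_add_neg]
  rfl

theorem mk_zero : mk (0 : M.Frac) den_zero = 0 := rfl

theorem mk_one : mk (1 : M.Frac) den_one = 1 := rfl

theorem exists_mk (q : M.RatM) : ∃ r h, q = mk r h := by
  obtain ⟨r, h⟩ := q
  exact ⟨r, h, rfl⟩

instance : IsOrderedAddMonoid M.RatM where
  add_le_add_left := by
    intro a b h c
    obtain ⟨a, ha, rfl⟩ := exists_mk a
    obtain ⟨b, hb, rfl⟩ := exists_mk b
    obtain ⟨c, hc, rfl⟩ := exists_mk c
    rw [← mk_add, ← mk_add, mk_le]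
    rw [mk_le] at h
    simp only [frac_le_def, frac_add_def] at *
    obtain ⟨d, hd⟩ := h
    exact ⟨d * (c.den * c.den), by grind⟩

instance : Nontrivial M.RatM := ⟨⟨0, 1, fun h => by
  rw [← mk_zero, ← mk_one, mk_eq] at h
  simp [frac_zero_def, frac_one_def] at h⟩⟩

instance : ZeroLEOneClass M.RatM := ⟨by
  rw [← mk_zero, ← mk_one, mk_le]
  simp [frac_zero_def, frac_one_def, frac_le_def]⟩

theorem mul_pos' {a b : M.RatM} (ha : 0 < a) (hb : 0 < b) : 0 < a * b := by
  obtain ⟨a, ha', rfl⟩ := exists_mk a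
  obtain ⟨b, hb', rfl⟩ := exists_mk b
  rw [← mk_zero] at *
  rw [← mk_mul]
  rw [mk_lt] at *
  simp only [frac_lt_def, frac_zero_def, frac_mul_def, zero_mul, zero_add, mul_one, add_zero] at *
  obtain ⟨c, hc⟩ := ha
  obtain ⟨d, hd⟩ := hb
  rw [← hc, ← hd]
  exact ⟨c * d + c + d, by ring⟩

instance : IsStrictOrderedRing M.RatM := .of_mul_pos fun _ _ => mul_pos'

/-- The larger of the two numerator parts exceeds the smaller by a number `c`, so the inverse is `±
den / c`. -/
theorem exists_inv {a : M.RatM} (ha : a ≠ 0) : ∃ b, a * b = 1 := by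
  obtain ⟨r, hr, rfl⟩ := exists_mk a
  rw [← mk_zero, Ne, mk_eq] at ha
  simp only [frac_zero_def, zero_mul, add_zero, zero_add, mul_one] at ha
  rcases le_total r.pos r.neg with h | h
  · obtain ⟨c, hc⟩ := exists_eq_add_of_le' h
    refine ⟨mk ⟨0, r.den, c⟩ ?_, ?_⟩
    · rintro rfl
      exact ha (by simpa using hc.symm)
    · rw [← mk_mul, ← mk_one, mk_eq]
      simp only [frac_mul_def, frac_one_def, hc]
      ring
  · obtain ⟨c, hc⟩ := exists_eq_add_of_le' h
    refine ⟨mk ⟨r.den, 0, c⟩ ?_, ?_⟩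
    · rintro rfl
      exact ha (by simpa using hc)
    · rw [← mk_mul, ← mk_one, mk_eq]
      simp only [frac_mul_def, frac_one_def, hc]
      ring

open Classical in
noncomputable instance : Field M.RatM where
  inv a := if h : a ≠ 0 then (exists_inv h).choose else 0
  mul_inv_cancel a ha := by
    rw [dif_pos ha]
    exact (exists_inv ha).choose_spec
  inv_zero := by simp
  nnqsmul := _
  qsmul := _

/-- The embedding of the natural numbers of the structure. -/
def ofNat : M.N →+* M.RatM where
  toFun n := mk ⟨n, 0, 1⟩ one_ne_zero
  map_zero' := rfl
  map_one' := rfl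
  map_add' a b := by
    rw [← mk_add, mk_eq]
    simp only [frac_add_def]
    ring
  map_mul' a b := by
    rw [← mk_mul, mk_eq]
    simp only [frac_mul_def]
    ring

theorem ofNat_apply (n : M.N) : ofNat n = mk ⟨n, 0, 1⟩ one_ne_zero := rfl

theorem ofNat_le {a b : M.N} : ofNat a ≤ ofNat b ↔ a ≤ b := by
  rw [ofNat_apply, ofNat_apply, mk_le, frac_le_def]
  simp

theorem ofNat_lt {a b : M.N} : ofNat a < ofNat b ↔ a < b := by
  rw [lt_iff_not_ge, ofNat_le, lt_iff_not_ge]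

theorem ofNat_ne_zero {a : M.N} : ofNat a ≠ 0 ↔ a ≠ 0 := by
  rw [← map_zero ofNat, Ne, le_antisymm_iff, ofNat_le, ofNat_le, ← le_antisymm_iff]

theorem ofNat_nonneg (a : M.N) : 0 ≤ ofNat a := by
  rw [← map_zero ofNat, ofNat_le]
  exact zero_le' a

theorem mk_eq_div (r : M.Frac) (h : r.den ≠ 0) :
    mk r h = (ofNat r.pos - ofNat r.neg) / ofNat r.den := by
  rw [eq_div_iff (ofNat_ne_zero.2 h), ofNat_apply, ofNat_apply, ofNat_apply, ← mk_mul, ← mk_sub,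
    mk_eq]
  simp only [frac_mul_def, frac_sub_def, frac_neg_def, frac_add_def]
  ring

end RatM

/-- The rational number represented by a fraction. -/
noncomputable def Frac.toRat (r : M.Frac) : M.RatM :=
  (RatM.ofNat r.pos - RatM.ofNat r.neg) / RatM.ofNat r.den

theorem Frac.toRat_def (r : M.Frac) :
    r.toRat = (RatM.ofNat r.pos - RatM.ofNat r.neg) / RatM.ofNat r.den := rfl

theorem toRat_eq_mk {r : M.Frac} (h : r.den ≠ 0) : r.toRat = RatM.mk r h :=
  (RatM.mk_eq_div r h).symm

theorem toRat_le {r s : M.Frac} (hr : r.den ≠ 0) (hs : s.den ≠ 0) :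
    r ≤ s ↔ r.toRat ≤ s.toRat := by
  rw [toRat_eq_mk hr, toRat_eq_mk hs, RatM.mk_le]

theorem toRat_lt {r s : M.Frac} (hr : r.den ≠ 0) (hs : s.den ≠ 0) :
    r < s ↔ r.toRat < s.toRat := by
  rw [toRat_eq_mk hr, toRat_eq_mk hs, RatM.mk_lt]

theorem toRat_add {r s : M.Frac} (hr : r.den ≠ 0) (hs : s.den ≠ 0) :
    (r + s).toRat = r.toRat + s.toRat := by
  rw [toRat_eq_mk hr, toRat_eq_mk hs, toRat_eq_mk (den_add hr hs), RatM.mk_add]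

theorem toRat_sub {r s : M.Frac} (hr : r.den ≠ 0) (hs : s.den ≠ 0) :
    (r - s).toRat = r.toRat - s.toRat := by
  rw [toRat_eq_mk hr, toRat_eq_mk hs, toRat_eq_mk (den_sub hr hs), RatM.mk_sub]

theorem toRat_mul {r s : M.Frac} (hr : r.den ≠ 0) (hs : s.den ≠ 0) :
    (r * s).toRat = r.toRat * s.toRat := by
  rw [toRat_eq_mk hr, toRat_eq_mk hs, toRat_eq_mk (den_mul hr hs), RatM.mk_mul]

theorem toRat_neg {r : M.Frac} (hr : r.den ≠ 0) : (-r).toRat = -r.toRat := by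
  rw [toRat_eq_mk hr, toRat_eq_mk (den_neg hr), RatM.mk_neg]

theorem toRat_zero : (0 : M.Frac).toRat = 0 := by
  rw [toRat_eq_mk den_zero, RatM.mk_zero]

theorem toRat_one : (1 : M.Frac).toRat = 1 := by
  rw [toRat_eq_mk den_one, RatM.mk_one]

theorem absLe_iff {r s : M.Frac} (hr : r.den ≠ 0) (hs : s.den ≠ 0) :
    r.AbsLe s ↔ |r.toRat| ≤ s.toRat := by
  rw [Frac.AbsLe, toRat_le hr hs, toRat_le (den_neg hr) hs, toRat_neg hr, abs_le']

theorem absLt_iff {r s : M.Frac} (hr : r.den ≠ 0) (hs : s.den ≠ 0) :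
    r.AbsLt s ↔ |r.toRat| < s.toRat := by
  rw [Frac.AbsLt, toRat_lt hr hs, toRat_lt (den_neg hr) hs, toRat_neg hr, abs_lt, neg_lt]
  tauto

/-- Codes of pairs are unique. -/
theorem pair_inj {a b c d : M.N} (h : M.pair a b = M.pair c d) : a = c ∧ b = d := by
  -- Here `s² + a ≤ s² + s < (s + 1)² ≤ t²`; so the code determines `a + b`, and then `a`.
  have key : ∀ {s t a c : M.N}, a ≤ s → s < t → s * s + a < t * t + c := by
    intro s t a c ha hst
    obtain ⟨e, rfl⟩ := exists_eq_add_of_le' (lt_iff_add_one_le'.1 hst)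
    obtain ⟨f, rfl⟩ := exists_eq_add_of_le' ha
    rw [lt_iff_add_one_le']
    exact ⟨2 * (a + f) * e + e * e + 2 * e + f + c + (a + f), by ring⟩
  unfold pair at h
  rcases lt_trichotomy (a + b) (c + d) with h' | h' | h'
  · exact absurd h (key le_self_add h').ne
  · rw [h'] at h
    have h1 := add_left_cancel h
    exact ⟨h1, by rw [h1] at h'; exact add_left_cancel h'⟩
  · exact absurd h.symm (key le_self_add h').ne

end Arithmetic

end FinTypeStructure

namespace FinTypeStructure

/-! ### Definability by terms -/

section Terms

variable {M : FinTypeStructure.{u}}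

/-- A type of tuples of objects of the structure, with its coordinate functions. -/
class Ctx (C : Type u) (M : outParam FinTypeStructure.{u}) where
  coord : ∀ {τ : FinType}, (C → M.Obj τ) → Prop

/-- The only coordinate of a single object. -/
inductive ObjCoord {σ : FinType} : ∀ {τ : FinType}, (M.Obj σ → M.Obj τ) → Prop
  | id : ObjCoord fun x : M.Obj σ => x

/-- The coordinates of a pair. -/
inductive ProdCoord {C D : Type u} [Ctx C M] [Ctx D M] :
    ∀ {τ : FinType}, (C × D → M.Obj τ) → Prop
  | fst {τ : FinType} {f : C → M.Obj τ} : Ctx.coord f → ProdCoord fun p => f p.1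
  | snd {τ : FinType} {f : D → M.Obj τ} : Ctx.coord f → ProdCoord fun p => f p.2

instance {σ : FinType} : Ctx (M.Obj σ) M := ⟨ObjCoord⟩

instance {C D : Type u} [Ctx C M] [Ctx D M] : Ctx (C × D) M := ⟨ProdCoord⟩

/-- Functions given by terms with parameters from `M`. -/
inductive IsTerm {C : Type u} [Ctx C M] : ∀ {τ : FinType}, (C → M.Obj τ) → Prop
  | coord {τ : FinType} {f : C → M.Obj τ} : Ctx.coord f → IsTerm f
  | const {τ : FinType} (t : M.Obj τ) : IsTerm fun _ => t
  | app {σ τ : FinType} {f : C → M.Obj (σ ⇾ τ)} {g : C → M.Obj σ} :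
      IsTerm f → IsTerm g → IsTerm fun c => f c ⬝ g c

/-- A map between tuples all of whose coordinates are given by terms. -/
@[fun_prop]
structure Rep {C D : Type u} [Ctx C M] [Ctx D M] (f : C → D) : Prop where
  isTerm : ∀ {τ : FinType} {π : D → M.Obj τ}, Ctx.coord π → IsTerm fun c => π (f c)

variable {C D B : Type u} [Ctx C M] [Ctx D M] [Ctx B M] {σ τ : FinType}

theorem rep_iff {f : C → M.Obj τ} : Rep f ↔ IsTerm f :=
  ⟨fun h => h.isTerm ObjCoord.id, fun h => ⟨fun hπ => by cases hπ; exact h⟩⟩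

theorem IsTerm.subst {g : D → M.Obj τ} (hg : IsTerm g) {f : C → D} (hf : Rep f) :
    IsTerm fun c => g (f c) := by
  induction hg with
  | coord h => exact hf.isTerm h
  | const t => exact .const t
  | app _ _ h1 h2 => exact .app h1 h2

@[fun_prop]
theorem Rep.id : Rep fun c : C => c := ⟨.coord⟩

@[fun_prop]
theorem Rep.const (d : D) : Rep fun _ : C => d := ⟨fun _ => .const _⟩

@[fun_prop]
theorem Rep.comp {g : D → B} {f : C → D} (hg : Rep g) (hf : Rep f) : Rep fun c => g (f c) :=
  ⟨fun h => (hg.isTerm h).subst hf⟩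

@[fun_prop]
theorem Rep.prodMk {f : C → D} {g : C → B} (hf : Rep f) (hg : Rep g) :
    Rep fun c => (f c, g c) := by
  refine ⟨fun h => ?_⟩
  cases h with
  | fst h => exact hf.isTerm h
  | snd h => exact hg.isTerm h

@[fun_prop]
theorem Rep.fst {f : C → D × B} (hf : Rep f) : Rep fun c => (f c).1 := ⟨fun h => hf.isTerm (.fst h)⟩

@[fun_prop]
theorem Rep.snd {f : C → D × B} (hf : Rep f) : Rep fun c => (f c).2 := ⟨fun h => hf.isTerm (.snd h)⟩

@[fun_prop]
theorem Rep.app {f : C → M.Obj (σ ⇾ τ)} {g : C → M.Obj σ} (hf : Rep f) (hg : Rep g) :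
    Rep fun c => M.app (f c) (g c) :=
  rep_iff.2 (.app (rep_iff.1 hf) (rep_iff.1 hg))

end Terms

/-! ### Combinatory completeness, arithmetical predicates, induction and search. -/

section Definability

variable {M : FinTypeStructure.{u}} [hM : Fact M.IsModelACA]
variable {C D B : Type u} [Ctx C M] [Ctx D M] [Ctx B M] {σ τ : FinType}

theorem K_app (x : M.Obj σ) (y : M.Obj τ) : M.K σ τ ⬝ x ⬝ y = x := hM.out.1.K_eq x y

/-- Bracket abstraction: `K` for parts without the abstracted variable, `S K K` for the variable
itself, `S` for applications. The result is again a term in the remaining context, so abstractions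
can be nested. -/
theorem exists_abstraction {F : C × M.Obj σ → M.Obj τ} (hF : IsTerm F) :
    ∃ G : C → M.Obj (σ ⇾ τ), IsTerm G ∧ ∀ c x, G c ⬝ x = F (c, x) := by
  induction hF with
  | coord h =>
    cases h with
    | @fst f h =>
      exact ⟨fun c => M.K _ _ ⬝ f c, .app (.const _) (.coord h), fun c x => K_app _ _⟩
    | snd h =>
      cases h
      exact ⟨fun _ => M.S σ (σ ⇾ σ) σ ⬝ M.K _ _ ⬝ M.K _ _, .const _, fun c x => by
        rw [hM.out.1.S_eq, K_app]⟩
  | const t => exact ⟨fun _ => M.K _ _ ⬝ t, .const _, fun c x => K_app _ _⟩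
  | app _ _ h1 h2 =>
    obtain ⟨G, hG, hG'⟩ := h1
    obtain ⟨H, hH, hH'⟩ := h2
    refine ⟨fun c => M.S _ _ _ ⬝ G c ⬝ H c, .app (.app (.const _) hG) hH, fun c x => ?_⟩
    rw [hM.out.1.S_eq, hG', hH']

variable (M) in
theorem obj_nonempty : ∀ τ : FinType, Nonempty (M.Obj τ)
  | .zero => ⟨M.zero⟩
  | .arrow _ τ => (obj_nonempty τ).map fun t => M.K _ _ ⬝ t

open Classical in
/-- The object of the structure that represents the given function, if there is one. -/
noncomputable def lam (F : M.Obj σ → M.Obj τ) : M.Obj (σ ⇾ τ) :=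
  if h : ∃ t : M.Obj (σ ⇾ τ), ∀ x, t ⬝ x = F x then h.choose else (obj_nonempty M _).some

/-- By extensionality the representing object is unique, so the choice in `lam` is harmless. -/
theorem lam_eq {F : M.Obj σ → M.Obj τ} {t : M.Obj (σ ⇾ τ)} (h : ∀ x, t ⬝ x = F x) : lam F = t := by
  have h' : ∃ t : M.Obj (σ ⇾ τ), ∀ x, t ⬝ x = F x := ⟨t, h⟩
  rw [lam, dif_pos h']
  exact M.ext _ _ fun x => (h'.choose_spec x).trans (h x).symm

-- Uniformity is the point: abstraction gives one term in `c` that represents all the `F c`, and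
-- this lets `fun_prop` pass under binders.
@[fun_prop]
theorem Rep.lam {F : C → M.Obj σ → M.Obj τ} (hF : Rep fun p : C × M.Obj σ => F p.1 p.2) :
    Rep fun c => lam (F c) := by
  obtain ⟨G, hG, hG'⟩ := exists_abstraction (rep_iff.1 hF)
  have : (fun c => FinTypeStructure.lam (F c)) = G := funext fun c => lam_eq (hG' c)
  rw [this]
  exact rep_iff.2 hG

theorem lam_app {F : M.Obj σ → M.Obj τ} (hF : Rep F) (x : M.Obj σ) : lam F ⬝ x = F x := by
  -- Abstraction needs a context to the left of the variable; a dummy copy of `M.Obj σ` serves.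
  have h : Rep fun p : M.Obj σ × M.Obj σ => F p.2 := by fun_prop
  obtain ⟨G, -, hG⟩ := exists_abstraction (rep_iff.1 h)
  rw [lam_eq (hG x)]
  exact hG x x

@[fun_prop]
theorem Rep.add {f g : C → M.N} (hf : Rep f) (hg : Rep g) : Rep fun c => f c + g c := by
  change Rep fun c => M.plus ⬝ f c ⬝ g c
  fun_prop

@[fun_prop]
theorem Rep.mul {f g : C → M.N} (hf : Rep f) (hg : Rep g) : Rep fun c => f c * g c := by
  change Rep fun c => M.times ⬝ f c ⬝ g c
  fun_prop

/-- Predicates with a characteristic function in the structure. -/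
@[fun_prop]
def Dec (A : C → Prop) : Prop := ∃ χ : C → M.N, Rep χ ∧ ∀ c, χ c = 0 ↔ A c

theorem Dec.subst {A : D → Prop} {f : C → D} (hA : Dec A) (hf : Rep f) : Dec fun c => A (f c) := by
  obtain ⟨χ, hχ, h⟩ := hA
  exact ⟨fun c => χ (f c), by fun_prop, fun c => h _⟩

theorem Dec.congr {A B : C → Prop} (hA : Dec A) (h : ∀ c, A c ↔ B c) : Dec B := by
  obtain ⟨χ, hχ, h'⟩ := hA
  exact ⟨χ, hχ, fun c => (h' c).trans (h c)⟩

/-- Recursion with a numerical value. -/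
noncomputable def rec0 (a : M.N) (f : M.N → M.N → M.N) (n : M.N) : M.N :=
  M.R ⬝ (lam fun n => lam fun r => f n r) ⬝ a ⬝ n

theorem rec0_zero (a : M.N) (f : M.N → M.N → M.N) : rec0 a f 0 = a := hM.out.1.R_zero _ _

theorem rec0_succ (a : M.N) {f : M.N → M.N → M.N} (hf : Rep fun p : M.N × M.N => f p.1 p.2)
    (n : M.N) : rec0 a f (n + 1) = f n (rec0 a f n) := by
  rw [rec0, hM.out.1.R_succ, lam_app (by fun_prop), lam_app (by fun_prop)]
  rfl

@[fun_prop]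
theorem Rep.rec0 {a n : C → M.N} {f : C → M.N → M.N → M.N} (ha : Rep a) (hn : Rep n)
    (hf : Rep fun p : (C × M.N) × M.N => f p.1.1 p.1.2 p.2) :
    Rep fun c => rec0 (a c) (f c) (n c) := by
  exact (((Rep.const _).app hf.lam.lam).app ha).app hn

@[fun_prop]
theorem Dec.not {A : C → Prop} (hA : Dec A) : Dec fun c => ¬ A c := by
  obtain ⟨χ, hχ, h⟩ := hA
  refine ⟨fun c => rec0 1 (fun _ _ => 0) (χ c), by fun_prop, fun c => ?_⟩
  beta_reduce
  rw [← h]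
  rcases eq_zero_or_add_one (χ c) with h' | ⟨d, h'⟩
  · simp [h', rec0_zero]
  · rw [h', rec0_succ _ (by fun_prop)]
    simp

@[fun_prop]
theorem Dec.and {A B : C → Prop} (hA : Dec A) (hB : Dec B) : Dec fun c => A c ∧ B c := by
  obtain ⟨χ, hχ, h⟩ := hA
  obtain ⟨ψ, hψ, h'⟩ := hB
  refine ⟨fun c => χ c + ψ c, by fun_prop, fun c => ?_⟩
  beta_reduce
  rw [← h, ← h']
  exact ⟨eq_zero_of_add_eq_zero, fun h => by rw [h.1, h.2, add_zero]⟩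

@[fun_prop]
theorem Dec.or {A B : C → Prop} (hA : Dec A) (hB : Dec B) : Dec fun c => A c ∨ B c :=
  Dec.congr (A := fun c => ¬ (¬ A c ∧ ¬ B c)) (by fun_prop) fun c => by tauto

theorem Dec.imp {A B : C → Prop} (hA : Dec A) (hB : Dec B) : Dec fun c => A c → B c :=
  Dec.congr (A := fun c => ¬ (A c ∧ ¬ B c)) (by fun_prop) fun c => by tauto

-- The only place where `(∃²)` itself is invoked. Through it `Dec` is closed under number
-- quantifiers.
@[fun_prop]
theorem Dec.exists {A : C → M.N → Prop} (hA : Dec fun p : C × M.N => A p.1 p.2) :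
    Dec fun c => ∃ n, A c n := by
  obtain ⟨χ, hχ, h⟩ := hA
  obtain ⟨E, hE⟩ := hM.out.2
  refine ⟨fun c => E ⬝ lam fun n => χ (c, n), by fun_prop, fun c => ?_⟩
  rw [hE]
  refine exists_congr fun n => ?_
  rw [lam_app (by fun_prop)]
  exact h _

theorem Dec.forall {A : C → M.N → Prop} (hA : Dec fun p : C × M.N => A p.1 p.2) :
    Dec fun c => ∀ n, A c n :=
  Dec.congr (A := fun c => ¬ ∃ n, ¬ A c n) (by fun_prop) fun c => by push Not; rfl

-- `QF-AC^{1,0}` supplies a characteristic function of equality: choice is applied to "`n = 0` if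
-- `h(0) = h(1)`, and `n = 1` otherwise", where the function `h` carries the two numbers to be
-- compared.
@[fun_prop]
theorem Dec.eq {f g : C → M.N} (hf : Rep f) (hg : Rep g) : Dec fun c => f c = g c := by
  have h01 : (0 : M.N) ≠ 1 := zero_ne_one
  let s : M.Obj (FinType.one ⇾ FinType.zero ⇾ FinType.zero) :=
    lam fun h : M.Fn => lam fun _ : M.N => h ⬝ (0 : M.N)
  let t : M.Obj (FinType.one ⇾ FinType.zero ⇾ FinType.zero) :=
    lam fun h : M.Fn => lam fun _ : M.N => h ⬝ (1 : M.N)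
  let i : M.Obj (FinType.one ⇾ FinType.zero ⇾ FinType.zero) :=
    lam fun _ : M.Fn => lam fun n : M.N => n
  let z : M.Obj (FinType.one ⇾ FinType.zero ⇾ FinType.zero) :=
    lam fun _ : M.Fn => lam fun _ : M.N => (0 : M.N)
  let o : M.Obj (FinType.one ⇾ FinType.zero ⇾ FinType.zero) :=
    lam fun _ : M.Fn => lam fun _ : M.N => (1 : M.N)
  have hs : ∀ h n, s ⬝ h ⬝ n = h ⬝ (0 : M.N) := fun h n => by
    simp only [s]; rw [lam_app (by fun_prop), lam_app (by fun_prop)]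
  have ht : ∀ h n, t ⬝ h ⬝ n = h ⬝ (1 : M.N) := fun h n => by
    simp only [t]; rw [lam_app (by fun_prop), lam_app (by fun_prop)]
  have hi : ∀ h n, i ⬝ h ⬝ n = n := fun h n => by
    simp only [i]; rw [lam_app (by fun_prop), lam_app (by fun_prop)]
  have hz : ∀ h n, z ⬝ h ⬝ n = 0 := fun h n => by
    simp only [z]; rw [lam_app (by fun_prop), lam_app (by fun_prop)]
  have ho : ∀ h n, o ⬝ h ⬝ n = 1 := fun h n => by
    simp only [o]; rw [lam_app (by fun_prop), lam_app (by fun_prop)]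
  obtain ⟨Y, hY⟩ := hM.out.1.qf_choice
    (((QF.eq s t).and (QF.eq i z)).not.and ((QF.eq s t).not.and (QF.eq i o)).not).not (by
      intro h
      simp only [hs, ht, hi, hz, ho]
      by_cases h' : h ⬝ (0 : M.N) = h ⬝ (1 : M.N)
      · exact ⟨0, by simp [h']⟩
      · exact ⟨1, by simp [h']⟩)
  simp only [hs, ht, hi, hz, ho] at hY
  -- The argument of `Y` is the function with value `f c` at `0` and `g c` at every successor.
  refine ⟨fun c => Y ⬝ lam fun n => rec0 (f c) (fun _ _ => g c) n, by fun_prop, fun c => ?_⟩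
  have := hY (lam fun n => rec0 (f c) (fun _ _ => g c) n)
  have e1 : rec0 (f c) (fun _ _ => g c) 1 = g c := by
    conv_lhs => rw [← zero_add (1 : M.N)]
    rw [rec0_succ _ (by fun_prop)]
  rw [lam_app (by fun_prop), lam_app (by fun_prop), rec0_zero, e1] at this
  beta_reduce
  constructor
  · intro h
    rw [h] at this
    by_contra h'
    exact this ⟨fun h => h' h.1, fun h => h01 h.2⟩
  · intro h
    by_contra h'
    exact this ⟨fun h => h' h.2, fun h'' => h''.1 h⟩

@[fun_prop]
theorem Dec.le {f g : C → M.N} (hf : Rep f) (hg : Rep g) : Dec fun c => f c ≤ g c := by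
  simp only [le_def]
  fun_prop

@[fun_prop]
theorem Dec.lt {f g : C → M.N} (hf : Rep f) (hg : Rep g) : Dec fun c => f c < g c := by
  simp only [lt_def]
  fun_prop

-- By recursion on the type of the values: at type `0` by `R₀` applied to the characteristic
-- function, at function types pointwise by extensionality.
@[fun_prop]
theorem Rep.ite : ∀ {τ : FinType} {C : Type u} [Ctx C M] {A : C → Prop} [∀ c, Decidable (A c)]
    {f g : C → M.Obj τ}, Dec A → Rep f → Rep g → Rep fun c => if A c then f c else g c
  | .zero, C, _, A, _, f, g, hA, hf, hg => by
    obtain ⟨χ, hχ, h⟩ := hA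
    have : (fun c => if A c then f c else g c) =
        fun c => FinTypeStructure.rec0 (M := M) (f c) (fun _ _ => g c) (χ c) := by
      funext c
      rcases eq_zero_or_add_one (χ c) with h' | ⟨d, h'⟩
      · rw [if_pos ((h c).1 h'), h', rec0_zero]
      · rw [if_neg fun h'' => add_one_ne_zero' d (h' ▸ (h c).2 h''), h',
          rec0_succ _ (by fun_prop)]
    rw [this]
    fun_prop
  | .arrow σ τ, C, _, A, _, f, g, hA, hf, hg => by
    have ih : Rep fun p : C × M.Obj σ => if A p.1 then f p.1 ⬝ p.2 else g p.1 ⬝ p.2 := by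
      refine Rep.ite (hA.subst ?_) ?_ ?_ <;> fun_prop
    have : (fun c => if A c then f c else g c) =
        fun c => FinTypeStructure.lam fun x => if A c then f c ⬝ x else g c ⬝ x := by
      funext c
      refine (lam_eq fun x => ?_).symm
      split_ifs <;> rfl
    rw [this]
    exact ih.lam

/-- Quantifier-free induction for the equation `χ n = 0`, with a dummy parameter. As `Dec` is closed
under number quantifiers, this gives arithmetical induction. -/
theorem induction {A : M.N → Prop} (hA : Dec A) (h0 : A 0) (hs : ∀ n, A n → A (n + 1)) (n : M.N) :
    A n := by
  obtain ⟨χ, hχ, h⟩ := hA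
  have hQ := QF.eq (M := M) (lam fun _ : M.N => lam fun n => χ n)
    (lam fun _ : M.N => lam fun _ : M.N => (0 : M.N))
  have e : ∀ x n : M.N, (lam fun _ : M.N => lam fun n => χ n) ⬝ x ⬝ n = χ n := fun x n => by
    rw [lam_app (by fun_prop), lam_app (by fun_prop)]
  have e' : ∀ x n : M.N, (lam fun _ : M.N => lam fun _ : M.N => (0 : M.N)) ⬝ x ⬝ n = 0 := fun x n => by
    rw [lam_app (by fun_prop), lam_app (by fun_prop)]
  have := hM.out.1.qf_induction hQ 0
  simp only [e, e', h] at this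
  exact this h0 hs n

/-- The least number principle. -/
theorem exists_least {A : M.N → Prop} (hA : Dec A) (h : ∃ n, A n) :
    ∃ n, A n ∧ ∀ m < n, ¬ A m := by
  by_contra! hc
  obtain ⟨n, hn⟩ := h
  have hd : Dec fun n : M.N => ∀ m, m ≤ n → ¬ A m :=
    Dec.forall (Dec.imp (by fun_prop) (hA.subst (f := fun p : M.N × M.N => p.2) (by fun_prop)).not)
  have : ∀ n, ∀ m ≤ n, ¬ A m := by
    refine induction hd ?_ ?_
    · intro m hm hA
      obtain ⟨k, hk, -⟩ := hc m hA
      rw [le_antisymm hm (zero_le' m)] at hk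
      exact (zero_le' k).not_gt hk
    · intro n ih m hm hA
      obtain ⟨k, hk, hk'⟩ := hc m hA
      exact ih k (lt_add_one_iff'.1 (hk.trans_le hm)) hk'
  exact this n n le_rfl hn

-- The formula "if `f` has a zero, then `n` is one" has a witness `n` for every `f` and is decidable
-- by `(∃²)`, so `QF-AC^{1,0}` provides a selector.
variable (M) in
theorem exists_mu : ∃ μ : M.Obj (FinType.one ⇾ FinType.zero), ∀ f : M.Fn, ∀ n,
    f ⬝ n = (0 : M.N) → f ⬝ (μ ⬝ f) = (0 : M.N) := by
  obtain ⟨χ, hχ, h⟩ : Dec fun p : M.Fn × M.N => (∃ n, p.1 ⬝ n = (0 : M.N)) → p.1 ⬝ p.2 = (0 : M.N) :=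
    Dec.imp (by fun_prop) (by fun_prop)
  have hQ := QF.eq (M := M) (lam fun f : M.Fn => lam fun n => χ (f, n))
    (lam fun _ : M.Fn => lam fun _ : M.N => (0 : M.N))
  have e : ∀ (x : M.Fn) (n : M.N), (lam fun f : M.Fn => lam fun n => χ (f, n)) ⬝ x ⬝ n = χ (x, n) :=
    fun x n => by rw [lam_app (by fun_prop), lam_app (by fun_prop)]
  have e' : ∀ (x : M.Fn) (n : M.N), (lam fun _ : M.Fn => lam fun _ : M.N => (0 : M.N)) ⬝ x ⬝ n = 0 :=
    fun x n => by rw [lam_app (by fun_prop), lam_app (by fun_prop)]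
  have := hM.out.1.qf_choice hQ
  simp only [e, e', h] at this
  obtain ⟨Y, hY⟩ := this fun f => by
    by_cases hf : ∃ n, f ⬝ n = (0 : M.N)
    · obtain ⟨n, hn⟩ := hf
      exact ⟨n, fun _ => hn⟩
    · exact ⟨0, fun h => absurd h hf⟩
  exact ⟨Y, fun f n hn => hY f ⟨n, hn⟩⟩

open Classical in
/-- Feferman's search operator: a number with the property `A`, if there is one. -/
noncomputable def mu (A : M.N → Prop) : M.N :=
  (exists_mu M).choose ⬝ lam fun n => if A n then (0 : M.N) else 1

theorem mu_spec {A : M.N → Prop} (hA : Dec A) (h : ∃ n, A n) : A (mu A) := by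
  classical
  obtain ⟨n, hn⟩ := h
  have := (exists_mu M).choose_spec (lam fun n => if A n then (0 : M.N) else 1) n
  rw [lam_app (by fun_prop), lam_app (by fun_prop), if_pos hn] at this
  by_contra hc
  have h := this rfl
  exact one_ne_zero ((if_neg hc).symm.trans h)

@[fun_prop]
theorem Rep.mu {A : C → M.N → Prop} (hA : Dec fun p : C × M.N => A p.1 p.2) :
    Rep fun c => mu (A c) := by
  unfold FinTypeStructure.mu
  fun_prop

end Definability

end FinTypeStructure

namespace FinTypeStructure

section Rationals

variable {M : FinTypeStructure.{u}} [hM : Fact M.IsModelACA]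
variable {C D : Type u} [Ctx C M] [Ctx D M] {σ τ : FinType}

/-! ### Powers of two -/

/-- Evaluation of the combinators: `S K K` is the identity, so `S plus (S K K)` is doubling. -/
theorem pow2_eq : M.pow2 = lam fun n : M.N => rec0 1 (fun _ r => r + r) n := by
  symm
  refine lam_eq fun n => ?_
  unfold pow2 rec0
  congr 3
  symm
  refine lam_eq fun n => ?_
  rw [K_app]
  symm
  refine lam_eq fun r => ?_
  rw [hM.out.1.S_eq, hM.out.1.S_eq, K_app]
  rfl

theorem pow2_zero : M.pow2 ⬝ (0 : M.N) = (1 : M.N) := by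
  rw [pow2_eq, lam_app (by fun_prop), rec0_zero]

theorem pow2_succ (n : M.N) : M.pow2 ⬝ (n + 1) = M.pow2 ⬝ n + M.pow2 ⬝ n := by
  rw [pow2_eq, lam_app (by fun_prop), lam_app (by fun_prop), rec0_succ _ (by fun_prop)]

theorem lt_pow2 (n : M.N) : n < M.pow2 ⬝ n := by
  refine induction (A := fun n => n < M.pow2 ⬝ n) (by fun_prop) ?_ ?_ n
  · rw [pow2_zero]
    exact zero_lt_one
  · intro n ih
    rw [pow2_succ]
    have h1 := lt_iff_add_one_le'.1 ih
    have h2 := lt_iff_add_one_le'.1 ((zero_le' n).trans_lt ih)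
    rw [zero_add] at h2
    exact lt_iff_add_one_le'.2 (add_le_add h1 h2)

theorem pow2_pos (n : M.N) : 0 < M.pow2 ⬝ n := (zero_le' n).trans_lt (lt_pow2 n)

theorem pow2_ne_zero (n : M.N) : M.pow2 ⬝ n ≠ (0 : M.N) := (pow2_pos n).ne'

theorem pow2_add (m n : M.N) : M.pow2 ⬝ (m + n) = (M.pow2 ⬝ m) * (M.pow2 ⬝ n) := by
  refine induction (A := fun n => M.pow2 ⬝ (m + n) = (M.pow2 ⬝ m) * (M.pow2 ⬝ n))
    (by fun_prop) ?_ ?_ n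
  · rw [pow2_zero, add_zero, mul_one]
  · intro n ih
    rw [← add_assoc, pow2_succ, pow2_succ, ih, mul_add]

/-- The rational number `2⁻ⁿ`. -/
noncomputable def hp (n : M.N) : M.RatM := (RatM.ofNat (M.pow2 ⬝ n))⁻¹

theorem toRat_invPow2 (n : M.N) : (Frac.invPow2 n).toRat = hp n := by
  simp [Frac.toRat_def, Frac.invPow2, hp]

theorem ofNat_pow2_pos (n : M.N) : 0 < RatM.ofNat (M.pow2 ⬝ n) := by
  rw [← map_zero RatM.ofNat, RatM.ofNat_lt]
  exact pow2_pos n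

theorem hp_pos (n : M.N) : 0 < hp n := inv_pos.2 (ofNat_pow2_pos n)

theorem hp_zero : hp (0 : M.N) = 1 := by simp [hp, pow2_zero]

theorem hp_add (m n : M.N) : hp (m + n) = hp m * hp n := by
  rw [hp, pow2_add, map_mul, mul_inv, hp, hp]

theorem hp_succ_add (n : M.N) : hp (n + 1) + hp (n + 1) = hp n := by
  have : hp (1 : M.N) + hp 1 = 1 := by
    have h : M.pow2 ⬝ (1 : M.N) = (1 : M.N) + 1 := by
      conv_lhs => rw [← zero_add (1 : M.N), pow2_succ, pow2_zero]
    have h2 : (0 : M.RatM) < 1 + 1 := by positivity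
    rw [hp, h, map_add, map_one]
    field_simp
  rw [hp_add, ← mul_add, this, mul_one]

theorem hp_le_one (n : M.N) : hp n ≤ 1 := by
  refine inv_le_one_of_one_le₀ ?_
  rw [← map_one RatM.ofNat, RatM.ofNat_le]
  have := lt_iff_add_one_le'.1 (pow2_pos n)
  rwa [zero_add] at this

theorem hp_anti {m n : M.N} (h : m ≤ n) : hp n ≤ hp m := by
  obtain ⟨k, rfl⟩ := h
  rw [hp_add]
  have := hp_le_one k
  have := hp_pos m
  nlinarith

theorem hp_lt {m n : M.N} (h : m < n) : hp n < hp m := by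
  have h1 := hp_anti (lt_iff_add_one_le'.1 h)
  have h2 := hp_succ_add m
  have h3 := hp_pos (m + 1)
  linarith

/-- A positive fraction with denominator `d` is at least `1 / d > 2⁻ᵈ`. The Archimedean property is
thus relative to the possibly nonstandard numbers of the structure. -/
theorem exists_hp_lt {q : M.RatM} (hq : 0 < q) : ∃ n, hp n < q := by
  obtain ⟨r, hr, rfl⟩ := RatM.exists_mk q
  refine ⟨r.den, ?_⟩
  have hd : 0 < RatM.ofNat r.den := by
    rw [← map_zero RatM.ofNat, RatM.ofNat_lt]
    exact pos_iff_ne_zero.2 hr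
  rw [RatM.mk_eq_div] at hq ⊢
  have h1 : 0 < RatM.ofNat r.pos - RatM.ofNat r.neg := (div_pos_iff_of_pos_right hd).1 hq
  have h2 : 1 ≤ RatM.ofNat r.pos - RatM.ofNat r.neg := by
    have : r.neg < r.pos := RatM.ofNat_lt.1 (by linarith)
    have := RatM.ofNat_le.2 (lt_iff_add_one_le'.1 this)
    rw [map_add, map_one] at this
    linarith
  calc hp r.den < (RatM.ofNat r.den)⁻¹ :=
        (inv_lt_inv₀ (ofNat_pow2_pos _) hd).2 (RatM.ofNat_lt.2 (lt_pow2 _))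
    _ ≤ _ := by
        rw [inv_eq_one_div]
        exact div_le_div_of_nonneg_right h2 hd.le

theorem exists_ofNat_gt (q : M.RatM) : ∃ n : M.N, q < RatM.ofNat n := by
  have hq : (0 : M.RatM) < |q| + 1 := by positivity
  obtain ⟨n, hn⟩ := exists_hp_lt (inv_pos.2 hq)
  refine ⟨M.pow2 ⬝ n, ?_⟩
  have := (inv_lt_inv₀ (ofNat_pow2_pos n) hq).1 hn
  have := le_abs_self q
  linarith

/-- Division with remainder. -/
theorem exists_quotient (a : M.N) {d : M.N} (hd : d ≠ 0) : ∃ q, q * d ≤ a ∧ a < (q + 1) * d := by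
  have hd' : 0 < d := pos_iff_ne_zero.2 hd
  refine induction (A := fun a => ∃ q, q * d ≤ a ∧ a < (q + 1) * d) (by fun_prop) ?_ ?_ a
  · exact ⟨0, by simp, by simpa using hd'⟩
  · rintro a ⟨q, h1, h2⟩
    rcases (lt_iff_add_one_le'.1 h2).lt_or_eq with h | h
    · exact ⟨q, h1.trans le_self_add, h⟩
    · refine ⟨q + 1, h.ge, ?_⟩
      rw [h, add_mul (q + 1)]
      exact lt_add_of_pos_right _ (by simpa using hd')

/-! ### Definability of operations on fractions -/

/-- The coordinates of a fraction. -/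
inductive FracCoord : ∀ {τ : FinType}, (M.Frac → M.Obj τ) → Prop
  | pos : FracCoord Frac.pos
  | neg : FracCoord Frac.neg
  | den : FracCoord Frac.den

instance : Ctx M.Frac M := ⟨FracCoord⟩

@[fun_prop]
theorem Rep.fracPos {f : C → M.Frac} (hf : Rep f) : Rep fun c => (f c).pos :=
  rep_iff.2 (hf.isTerm .pos)

@[fun_prop]
theorem Rep.fracNeg {f : C → M.Frac} (hf : Rep f) : Rep fun c => (f c).neg :=
  rep_iff.2 (hf.isTerm .neg)

@[fun_prop]
theorem Rep.fracDen {f : C → M.Frac} (hf : Rep f) : Rep fun c => (f c).den :=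
  rep_iff.2 (hf.isTerm .den)

@[fun_prop]
theorem Rep.fracMk {f g h : C → M.N} (hf : Rep f) (hg : Rep g) (hh : Rep h) :
    Rep fun c => (⟨f c, g c, h c⟩ : M.Frac) := by
  refine ⟨fun hπ => ?_⟩
  cases hπ
  · exact rep_iff.1 hf
  · exact rep_iff.1 hg
  · exact rep_iff.1 hh

@[fun_prop]
theorem Rep.fracAdd {f g : C → M.Frac} (hf : Rep f) (hg : Rep g) : Rep fun c => f c + g c := by
  simp only [frac_add_def]
  fun_prop

@[fun_prop]
theorem Rep.fracNegate {f : C → M.Frac} (hf : Rep f) : Rep fun c => -f c := by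
  simp only [frac_neg_def]
  fun_prop

@[fun_prop]
theorem Rep.fracSub {f g : C → M.Frac} (hf : Rep f) (hg : Rep g) : Rep fun c => f c - g c := by
  simp only [frac_sub_def]
  fun_prop

@[fun_prop]
theorem Rep.fracMul {f g : C → M.Frac} (hf : Rep f) (hg : Rep g) : Rep fun c => f c * g c := by
  simp only [frac_mul_def]
  fun_prop

@[fun_prop]
theorem Rep.invPow2 {f : C → M.N} (hf : Rep f) : Rep fun c => Frac.invPow2 (f c) := by
  unfold Frac.invPow2
  fun_prop

@[fun_prop]
theorem Rep.fracOfN {f : C → M.N} (hf : Rep f) : Rep fun c => Frac.ofN (f c) := by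
  unfold Frac.ofN
  fun_prop

@[fun_prop]
theorem Rep.pair {f g : C → M.N} (hf : Rep f) (hg : Rep g) : Rep fun c => M.pair (f c) (g c) := by
  unfold FinTypeStructure.pair
  fun_prop

@[fun_prop]
theorem Rep.code {f : C → M.Frac} (hf : Rep f) : Rep fun c => (f c).code := by
  unfold Frac.code
  fun_prop

@[fun_prop]
theorem Rep.toReal {f : C → M.Frac} (hf : Rep f) : Rep fun c => (f c).toReal := by
  unfold Frac.toReal
  fun_prop

@[fun_prop]
theorem Dec.fracLe {f g : C → M.Frac} (hf : Rep f) (hg : Rep g) : Dec fun c => f c ≤ g c := by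
  simp only [frac_le_def]
  fun_prop

@[fun_prop]
theorem Dec.fracLt {f g : C → M.Frac} (hf : Rep f) (hg : Rep g) : Dec fun c => f c < g c := by
  simp only [frac_lt_def]
  fun_prop

@[fun_prop]
theorem Dec.absLe {f g : C → M.Frac} (hf : Rep f) (hg : Rep g) :
    Dec fun c => (f c).AbsLe (g c) := by
  unfold Frac.AbsLe
  fun_prop

@[fun_prop]
theorem Dec.absLt {f g : C → M.Frac} (hf : Rep f) (hg : Rep g) :
    Dec fun c => (f c).AbsLt (g c) := by
  unfold Frac.AbsLt
  fun_prop

@[fun_prop]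
theorem Dec.isRatCode {f : C → M.N} {g : C → M.Frac} (hf : Rep f) (hg : Rep g) :
    Dec fun c => IsRatCode (f c) (g c) := by
  unfold IsRatCode
  fun_prop

theorem exists_frac {p : M.Frac → Prop} : (∃ r, p r) ↔ ∃ a b d, p ⟨a, b, d⟩ :=
  ⟨fun ⟨r, h⟩ => ⟨r.pos, r.neg, r.den, h⟩, fun ⟨_, _, _, h⟩ => ⟨_, h⟩⟩

@[fun_prop]
theorem Dec.existsFrac {A : C → M.Frac → Prop} (hA : Dec fun p : C × M.Frac => A p.1 p.2) :
    Dec fun c => ∃ r, A c r := by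
  simp only [exists_frac]
  exact Dec.exists (Dec.exists (Dec.exists (hA.subst
    (f := fun p : ((C × M.N) × M.N) × M.N => (p.1.1.1, (⟨p.1.1.2, p.1.2, p.2⟩ : M.Frac)))
    (by fun_prop))))

theorem code_inj {r s : M.Frac} (h : r.code = s.code) : r = s := by
  obtain ⟨h1, h2⟩ := pair_inj h
  obtain ⟨h3, h4⟩ := pair_inj h1
  exact Frac.ext h3 h4 h2

theorem IsRatCode.unique {c : M.N} {r s : M.Frac} (hr : IsRatCode c r) (hs : IsRatCode c s) :
    r = s := code_inj (hr.2.symm.trans hs.2)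

theorem approx_eq {x : M.Fn} {n : M.N} {r : M.Frac} (h : IsRatCode (x ⬝ n) r) : approx x n = r := by
  have h' : ∃ r : M.Frac, IsRatCode (x ⬝ n) r := ⟨r, h⟩
  rw [approx, dif_pos h']
  exact h'.choose_spec.unique h

theorem den_approx (x : M.Fn) (n : M.N) : (approx x n).den ≠ 0 := by
  by_cases h : ∃ r : M.Frac, IsRatCode (x ⬝ n) r
  · rw [approx, dif_pos h]
    exact h.choose_spec.1
  · rw [approx, dif_neg h]
    exact den_zero

-- The definition of `approx` uses choice, but a number codes at most one fraction, so searching for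
-- each coordinate finds the chosen one. Without a code, the default is `0`, that is `⟨0, 0, 1⟩`.
@[fun_prop]
theorem Rep.approx {x : C → M.Fn} {n : C → M.N} (hx : Rep x) (hn : Rep n) :
    Rep fun c => approx (x c) (n c) := by
  classical
  have hA : Dec fun c => ∃ r : M.Frac, IsRatCode (x c ⬝ n c) r := by fun_prop
  have : ∀ c, FinTypeStructure.approx (x c) (n c) = ⟨
      if ∃ r : M.Frac, IsRatCode (x c ⬝ n c) r then
        FinTypeStructure.mu fun a => ∃ b d, IsRatCode (x c ⬝ n c) ⟨a, b, d⟩ else 0,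
      if ∃ r : M.Frac, IsRatCode (x c ⬝ n c) r then
        FinTypeStructure.mu fun b => ∃ a d, IsRatCode (x c ⬝ n c) ⟨a, b, d⟩ else 0,
      if ∃ r : M.Frac, IsRatCode (x c ⬝ n c) r then
        FinTypeStructure.mu fun d => ∃ a b, IsRatCode (x c ⬝ n c) ⟨a, b, d⟩ else 1⟩ := by
    intro c
    by_cases h : ∃ r : M.Frac, IsRatCode (x c ⬝ n c) r
    · simp only [if_pos h]
      obtain ⟨r, hr⟩ := h
      rw [approx_eq hr]
      ext
      · obtain ⟨b, d, h⟩ := mu_spec (A := fun a => ∃ b d, IsRatCode (x c ⬝ n c) ⟨a, b, d⟩)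
          (by fun_prop) ⟨r.pos, r.neg, r.den, hr⟩
        rw [hr.unique h]
      · obtain ⟨b, d, h⟩ := mu_spec (A := fun b => ∃ a d, IsRatCode (x c ⬝ n c) ⟨a, b, d⟩)
          (by fun_prop) ⟨r.neg, r.pos, r.den, hr⟩
        rw [hr.unique h]
      · obtain ⟨b, d, h⟩ := mu_spec (A := fun d => ∃ a b, IsRatCode (x c ⬝ n c) ⟨a, b, d⟩)
          (by fun_prop) ⟨r.den, r.pos, r.neg, hr⟩
        rw [hr.unique h]
    · simp only [if_neg h]
      rw [FinTypeStructure.approx, dif_neg h]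
      rfl
  simp only [this]
  fun_prop

@[fun_prop]
theorem Dec.isReal {x : C → M.Fn} (hx : Rep x) : Dec fun c => IsReal (x c) := by
  unfold IsReal
  exact (Dec.forall (by fun_prop)).and (Dec.forall (Dec.forall (by fun_prop)))

@[fun_prop]
theorem Dec.rEq {x y : C → M.Fn} (hx : Rep x) (hy : Rep y) : Dec fun c => REq (x c) (y c) := by
  unfold REq
  exact Dec.forall (by fun_prop)

@[fun_prop]
theorem Dec.rLe {x y : C → M.Fn} (hx : Rep x) (hy : Rep y) : Dec fun c => RLe (x c) (y c) := by
  unfold RLe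
  exact Dec.forall (by fun_prop)

@[fun_prop]
theorem Dec.rLt {x y : C → M.Fn} (hx : Rep x) (hy : Rep y) : Dec fun c => RLt (x c) (y c) := by
  unfold RLt
  fun_prop

@[fun_prop]
theorem Dec.near {k : C → M.N} {x y : C → M.Fn} (hk : Rep k) (hx : Rep x) (hy : Rep y) :
    Dec fun c => Near (k c) (x c) (y c) := by
  unfold Near
  fun_prop

theorem Dec.isLimit {s : C → M.N → M.Frac} {z : C → M.Fn}
    (hs : Rep fun p : C × M.N => s p.1 p.2) (hz : Rep z) : Dec fun c => IsLimit (s c) (z c) := by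
  unfold IsLimit
  refine Dec.forall (Dec.exists (Dec.forall (Dec.imp (by fun_prop) ?_)))
  have : Rep fun p : ((C × M.N) × M.N) × M.N => s p.1.1.1 p.2 :=
    hs.comp (f := fun p : ((C × M.N) × M.N) × M.N => (p.1.1.1, p.2)) (by fun_prop)
  fun_prop

end Rationals

end FinTypeStructure

namespace FinTypeStructure

noncomputable section Reals

variable {M : FinTypeStructure.{u}} [hM : Fact M.IsModelACA]

/-! ### An ordered ring that contains the reals of the structure

The ring consists of the bounded elements of an ultrapower of the rationals of the structure, modulo
the elements that are smaller than all `2⁻ᵏ`. -/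

variable (M) in
/-- An ultrafilter on the numbers of the structure that contains all final segments. -/
def endFilter : Ultrafilter M.N := Ultrafilter.of Filter.atTop

theorem eventually_ge (j : M.N) : ∀ᶠ n in (endFilter M : Filter M.N), j ≤ n :=
  Ultrafilter.of_le Filter.atTop (Filter.eventually_ge_atTop j)

variable (M) in
/-- The ultrapower of the rationals. -/
abbrev Ultra : Type u := Filter.Germ (endFilter M : Filter M.N) M.RatM

variable (M) in
/-- The constants of the ultrapower. -/
def constHom : M.RatM →+* M.Ultra where
  toFun q := (q : M.Ultra)
  map_zero' := rfl
  map_one' := rfl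
  map_add' _ _ := rfl
  map_mul' _ _ := rfl

theorem constHom_le {a b : M.RatM} : constHom M a ≤ constHom M b ↔ a ≤ b :=
  Filter.Germ.const_le_iff

theorem constHom_lt {a b : M.RatM} : constHom M a < constHom M b ↔ a < b :=
  Filter.Germ.const_lt_iff

theorem constHom_hp_pos (k : M.N) : 0 < constHom M (hp k) := by
  rw [← map_zero (constHom M), constHom_lt]
  exact hp_pos k

variable (M) in
/-- The bounded elements of the ultrapower. -/
def boundedSubring : Subring M.Ultra where
  carrier := {g | ∃ n : M.N, |g| ≤ constHom M (RatM.ofNat n)}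
  mul_mem' := by
    rintro a b ⟨m, hm⟩ ⟨n, hn⟩
    refine ⟨m * n, ?_⟩
    rw [abs_mul, map_mul, map_mul]
    exact mul_le_mul hm hn (abs_nonneg b) ((abs_nonneg a).trans hm)
  one_mem' := ⟨1, by simp⟩
  add_mem' := by
    rintro a b ⟨m, hm⟩ ⟨n, hn⟩
    refine ⟨m + n, ?_⟩
    rw [map_add, map_add]
    exact (abs_add_le a b).trans (add_le_add hm hn)
  zero_mem' := ⟨0, by simp⟩
  neg_mem' := by
    rintro a ⟨m, hm⟩
    exact ⟨m, by rwa [abs_neg]⟩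

/-- Since `n · 2⁻ⁿ ≤ 1`, the choice `j = n + k` works. This is why bounded multiples of
infinitesimals are infinitesimal. -/
theorem exists_hp_mul_lt (n k : M.N) : ∃ j, RatM.ofNat n * hp j ≤ hp k := by
  refine ⟨n + k, ?_⟩
  rw [hp_add, ← mul_assoc]
  have h1 : RatM.ofNat n * hp n ≤ 1 := by
    rw [hp, mul_inv_le_iff₀ (ofNat_pow2_pos n), one_mul, RatM.ofNat_le]
    exact (lt_pow2 n).le
  have := hp_pos k
  nlinarith

variable (M) in
/-- The ideal of infinitesimal elements. -/
def infinitesimals : Ideal (boundedSubring M) where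
  carrier := {g | ∀ k : M.N, |(g : M.Ultra)| ≤ constHom M (hp k)}
  add_mem' := by
    intro a b ha hb k
    rw [← hp_succ_add, map_add]
    exact (abs_add_le _ _).trans (add_le_add (ha _) (hb _))
  zero_mem' k := by simpa using (constHom_hp_pos k).le
  smul_mem' := by
    rintro ⟨c, n, hn⟩ ⟨a, _⟩ ha k
    obtain ⟨j, hj⟩ := exists_hp_mul_lt n k
    refine le_trans ?_ (constHom_le.2 hj)
    rw [map_mul, smul_eq_mul, Subring.coe_mul, abs_mul]
    exact mul_le_mul hn (ha j) (abs_nonneg _) ((abs_nonneg _).trans hn)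

variable (M) in
/-- An ordered ring that contains the reals of the structure. -/
def RealM : Type u := boundedSubring M ⧸ infinitesimals M

namespace RealM

instance : CommRing M.RealM := inferInstanceAs (CommRing (boundedSubring M ⧸ infinitesimals M))

variable (M) in
/-- The class of a bounded element of the ultrapower. -/
def mk : boundedSubring M →+* M.RealM := Ideal.Quotient.mk (infinitesimals M)

theorem mk_surjective : Function.Surjective (mk M) := Ideal.Quotient.mk_surjective

theorem mk_eq_zero {a : boundedSubring M} :
    mk M a = 0 ↔ ∀ k, |(a : M.Ultra)| ≤ constHom M (hp k) :=
  Ideal.Quotient.eq_zero_iff_mem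

/-- Nonnegative elements. -/
def Nonneg (x : M.RealM) : Prop :=
  ∃ a, mk M a = x ∧ ∀ k, -constHom M (hp k) ≤ (a : M.Ultra)

/-- Independence of the representative: two representatives differ by an infinitesimal, and the
tolerance `2⁻ᵏ` is split into halves. -/
theorem nonneg_mk {a : boundedSubring M} :
    Nonneg (mk M a) ↔ ∀ k, -constHom M (hp k) ≤ (a : M.Ultra) := by
  refine ⟨?_, fun h => ⟨a, rfl, h⟩⟩
  rintro ⟨b, hb, h⟩ k
  have h1 : mk M (b - a) = 0 := by rw [map_sub, hb, sub_self]
  have h2 := abs_le.1 (mk_eq_zero.1 h1 (k + 1))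
  have h3 := h (k + 1)
  rw [AddSubgroupClass.coe_sub] at h2
  have h4 := congrArg (constHom M) (hp_succ_add k)
  rw [map_add] at h4
  linarith [h2.2]

theorem Nonneg.add {x y : M.RealM} (hx : Nonneg x) (hy : Nonneg y) : Nonneg (x + y) := by
  obtain ⟨a, rfl, ha⟩ := hx
  obtain ⟨b, rfl, hb⟩ := hy
  rw [← map_add, nonneg_mk]
  intro k
  have h4 := congrArg (constHom M) (hp_succ_add k)
  rw [map_add] at h4
  rw [Subring.coe_add]
  linarith [ha (k + 1), hb (k + 1)]

theorem nonneg_total (x : M.RealM) : Nonneg x ∨ Nonneg (-x) := by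
  obtain ⟨a, rfl⟩ := mk_surjective x
  rw [← map_neg, nonneg_mk, nonneg_mk]
  -- The ultrapower is linearly ordered because the filter is an ultrafilter.
  rcases le_total 0 (a : M.Ultra) with h | h
  · exact Or.inl fun k => by linarith [constHom_hp_pos (M := M) k]
  · exact Or.inr fun k => by rw [Subring.coe_neg]; linarith [constHom_hp_pos (M := M) k]

instance : LE M.RealM := ⟨fun x y => Nonneg (y - x)⟩

theorem le_iff {x y : M.RealM} : x ≤ y ↔ Nonneg (y - x) := Iff.rfl

instance : LinearOrder M.RealM where
  le_refl x := by
    rw [le_iff, sub_self, ← map_zero (mk M), nonneg_mk]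
    intro k
    simpa using (constHom_hp_pos k).le
  le_trans x y z h1 h2 := by
    rw [le_iff] at *
    simpa using h2.add h1
  le_antisymm x y h1 h2 := by
    obtain ⟨a, rfl⟩ := mk_surjective x
    obtain ⟨b, rfl⟩ := mk_surjective y
    rw [← sub_eq_zero, ← map_sub, mk_eq_zero]
    rw [le_iff, ← map_sub, nonneg_mk] at h1 h2
    intro k
    have := h1 k
    rw [← neg_sub, Subring.coe_neg, neg_le_neg_iff] at this
    exact abs_le.2 ⟨h2 k, this⟩
  le_total x y := by
    have := nonneg_total (y - x)
    rwa [neg_sub] at this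
  toDecidableLE := Classical.decRel _

theorem mk_le {a b : boundedSubring M} :
    mk M a ≤ mk M b ↔ ∀ k, (a : M.Ultra) ≤ b + constHom M (hp k) := by
  rw [le_iff, ← map_sub, nonneg_mk]
  refine forall_congr' fun k => ?_
  rw [AddSubgroupClass.coe_sub]
  constructor <;> intro h <;> linarith

theorem mk_lt {a b : boundedSubring M} :
    mk M a < mk M b ↔ ∃ k, (a : M.Ultra) + constHom M (hp k) < b := by
  rw [lt_iff_not_ge, mk_le]
  push Not
  rfl

instance : IsOrderedAddMonoid M.RealM where
  add_le_add_left x y h z := by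
    rw [le_iff] at *
    simpa using h

instance : Nontrivial M.RealM := ⟨⟨0, 1, by
  refine ne_of_lt ?_
  rw [← map_zero (mk M), ← map_one (mk M), mk_lt]
  refine ⟨1, ?_⟩
  have : hp (1 : M.N) < 1 := by
    rw [← hp_zero]
    exact hp_lt one_pos
  simpa using constHom_lt.2 this⟩⟩

instance : ZeroLEOneClass M.RealM := ⟨by
  rw [← map_zero (mk M), ← map_one (mk M), mk_le]
  intro k
  have := constHom_hp_pos (M := M) k
  simp only [Subring.coe_zero, Subring.coe_one]
  linarith⟩

/-- Positive elements exceed some `2⁻ᵏ` and `2⁻ˡ`, so their product exceeds `2⁻ᵏ⁻ˡ` and is not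
infinitesimal. -/
instance : IsStrictOrderedRing M.RealM := .of_mul_pos fun x y hx hy => by
  obtain ⟨a, rfl⟩ := mk_surjective x
  obtain ⟨b, rfl⟩ := mk_surjective y
  rw [← map_zero (mk M)] at *
  rw [← map_mul]
  rw [mk_lt] at *
  obtain ⟨k, hk⟩ := hx
  obtain ⟨l, hl⟩ := hy
  refine ⟨k + l, ?_⟩
  simp only [Subring.coe_zero, zero_add, hp_add, Subring.coe_mul, map_mul] at *
  exact mul_lt_mul'' hk hl (constHom_hp_pos k).le (constHom_hp_pos l).le

theorem constHom_mem (q : M.RatM) : constHom M q ∈ boundedSubring M := by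
  obtain ⟨n, hn⟩ := exists_ofNat_gt |q|
  refine ⟨n, ?_⟩
  have h1 := neg_abs_le q
  have h2 := le_abs_self q
  rw [abs_le, ← map_neg, constHom_le, constHom_le]
  constructor <;> linarith

variable (M) in
/-- The rationals in the ordered ring. -/
def ofRat : M.RatM →+* M.RealM := (mk M).comp ((constHom M).codRestrict _ constHom_mem)

theorem ofRat_apply (q : M.RatM) : ofRat M q = mk M ⟨constHom M q, constHom_mem q⟩ := rfl

theorem ofRat_le {p q : M.RatM} : ofRat M p ≤ ofRat M q ↔ p ≤ q := by
  rw [ofRat_apply, ofRat_apply, mk_le]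
  simp only [← map_add, constHom_le]
  refine ⟨fun h => le_of_forall_pos_lt_add fun ε hε => ?_, fun h k => ?_⟩
  · obtain ⟨n, hn⟩ := exists_hp_lt hε
    exact (h n).trans_lt (by linarith)
  · linarith [hp_pos k]

theorem ofRat_lt {p q : M.RatM} : ofRat M p < ofRat M q ↔ p < q := by
  rw [lt_iff_not_ge, ofRat_le, lt_iff_not_ge]

theorem ofRat_inj {p q : M.RatM} : ofRat M p = ofRat M q ↔ p = q := by
  rw [le_antisymm_iff, ofRat_le, ofRat_le, ← le_antisymm_iff]

/-- The element `2⁻ᵏ`. -/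
def tiny (k : M.N) : M.RealM := ofRat M (hp k)

theorem tiny_pos (k : M.N) : 0 < tiny k := by
  rw [tiny, ← map_zero (ofRat M), ofRat_lt]
  exact hp_pos k

theorem tiny_succ_add (k : M.N) : tiny (k + 1) + tiny (k + 1) = tiny k := by
  rw [tiny, ← map_add, hp_succ_add, tiny]

theorem tiny_anti {m n : M.N} (h : m ≤ n) : tiny n ≤ tiny m := ofRat_le.2 (hp_anti h)

theorem tiny_lt {m n : M.N} (h : m < n) : tiny n < tiny m := ofRat_lt.2 (hp_lt h)

theorem tiny_zero : tiny (0 : M.N) = 1 := by rw [tiny, hp_zero, map_one]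

/-- Strict inequality in the quotient means a gap of some `2⁻ᵏ` between representatives: half of it
is added to `x`, the other half keeps the inequality strict. -/
theorem exists_add_tiny_lt {x y : M.RealM} (h : x < y) : ∃ k, x + tiny k < y := by
  obtain ⟨a, rfl⟩ := mk_surjective x
  obtain ⟨b, rfl⟩ := mk_surjective y
  obtain ⟨k, hk⟩ := mk_lt.1 h
  refine ⟨k + 1, ?_⟩
  rw [tiny, ofRat_apply, ← map_add, mk_lt]
  refine ⟨k + 1, ?_⟩
  have h4 := congrArg (constHom M) (hp_succ_add k)
  rw [map_add] at h4
  rw [Subring.coe_add]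
  linarith

theorem exists_tiny_lt {x : M.RealM} (h : 0 < x) : ∃ k, tiny k < x := by
  obtain ⟨k, hk⟩ := exists_add_tiny_lt h
  exact ⟨k, by simpa using hk⟩

theorem le_of_forall_tiny {x y : M.RealM} (h : ∀ k, x ≤ y + tiny k) : x ≤ y := by
  by_contra hc
  obtain ⟨k, hk⟩ := exists_add_tiny_lt (not_le.1 hc)
  exact (h k).not_gt hk

end RealM

open RealM

/-- Cauchy sequences of rationals. -/
def IsCauchySeqM (u : M.N → M.RatM) : Prop := ∀ k, ∃ j, ∀ n, j ≤ n → |u n - u j| ≤ hp k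

theorem IsCauchySeqM.mem {u : M.N → M.RatM} (hu : IsCauchySeqM u) :
    ((u : M.N → M.RatM) : M.Ultra) ∈ boundedSubring M := by
  obtain ⟨j, hj⟩ := hu 0
  obtain ⟨n, hn⟩ := exists_ofNat_gt (|u j| + 1)
  refine ⟨n, ?_⟩
  rw [Filter.Germ.abs_def]
  refine Filter.Germ.coe_le.2 ((eventually_ge j).mono fun m hm => ?_)
  have h1 := hj m hm
  have h2 := abs_sub_abs_le_abs_sub (u m) (u j)
  rw [hp_zero] at h1
  change |u m| ≤ RatM.ofNat n
  linarith

open Classical in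
/-- The limit of a Cauchy sequence. -/
def lim (u : M.N → M.RatM) : M.RealM :=
  if h : IsCauchySeqM u then RealM.mk M ⟨(u : M.Ultra), h.mem⟩ else 0

/-- The order of the ring controls the sequences only on a set in the ultrafilter. That set meets
every final segment, and the Cauchy property carries the inequality from one late index to all
others. So comparisons of limits do not depend on the ultrafilter. -/
theorem lim_le {u v : M.N → M.RatM} (hu : IsCauchySeqM u) (hv : IsCauchySeqM v) :
    lim u ≤ lim v ↔ ∀ k, ∃ j, ∀ n, j ≤ n → u n ≤ v n + hp k := by
  rw [lim, dif_pos hu, lim, dif_pos hv, RealM.mk_le]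
  have key : ∀ k, (u : M.Ultra) ≤ (v : M.Ultra) + constHom M (hp k) ↔
      ∀ᶠ n in (endFilter M : Filter M.N), u n ≤ v n + hp k := fun k => Filter.Germ.coe_le
  simp only [key]
  constructor
  · intro h k
    obtain ⟨i, hi⟩ := hu (k + 1 + 1 + 1)
    obtain ⟨j, hj⟩ := hv (k + 1 + 1 + 1)
    refine ⟨max i j, fun n hn => ?_⟩
    obtain ⟨m, hm, hm'⟩ := ((h (k + 1 + 1 + 1)).and (eventually_ge (max i j))).exists
    have h1 := abs_le.1 (hi n (le_trans (le_max_left _ _) hn))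
    have h2 := abs_le.1 (hi m (le_trans (le_max_left _ _) hm'))
    have h3 := abs_le.1 (hj n (le_trans (le_max_right _ _) hn))
    have h4 := abs_le.1 (hj m (le_trans (le_max_right _ _) hm'))
    have e1 := hp_succ_add k
    have e2 := hp_succ_add (k + 1)
    have e3 := hp_succ_add (k + 1 + 1)
    have e4 := hp_pos (k + 1 + 1 + 1)
    linarith [h1.1, h1.2, h2.1, h2.2, h3.1, h3.2, h4.1, h4.2]
  · intro h k
    obtain ⟨j, hj⟩ := h k
    exact (eventually_ge j).mono hj

theorem isCauchySeqM_const (q : M.RatM) : IsCauchySeqM fun _ => q :=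
  fun k => ⟨0, fun _ _ => by simpa using (hp_pos k).le⟩

theorem lim_const (q : M.RatM) : lim (fun _ => q) = ofRat M q := by
  rw [lim, dif_pos (isCauchySeqM_const q), ofRat_apply]
  rfl

theorem IsCauchySeqM.add {u v : M.N → M.RatM} (hu : IsCauchySeqM u) (hv : IsCauchySeqM v) :
    IsCauchySeqM fun n => u n + v n := by
  intro k
  obtain ⟨i, hi⟩ := hu (k + 1 + 1)
  obtain ⟨j, hj⟩ := hv (k + 1 + 1)
  refine ⟨max i j, fun n hn => ?_⟩
  have h1 := abs_le.1 (hi n (le_trans (le_max_left _ _) hn))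
  have h2 := abs_le.1 (hi (max i j) (le_max_left _ _))
  have h3 := abs_le.1 (hj n (le_trans (le_max_right _ _) hn))
  have h4 := abs_le.1 (hj (max i j) (le_max_right _ _))
  have e1 := hp_succ_add k
  have e2 := hp_succ_add (k + 1)
  rw [abs_le]
  constructor <;> linarith [h1.1, h1.2, h2.1, h2.2, h3.1, h3.2, h4.1, h4.2]

theorem IsCauchySeqM.neg {u : M.N → M.RatM} (hu : IsCauchySeqM u) :
    IsCauchySeqM fun n => -u n := by
  intro k
  obtain ⟨i, hi⟩ := hu k
  refine ⟨i, fun n hn => ?_⟩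
  have := hi n hn
  rwa [← abs_neg, neg_sub_neg, neg_sub]

theorem lim_add {u v : M.N → M.RatM} (hu : IsCauchySeqM u) (hv : IsCauchySeqM v) :
    lim (fun n => u n + v n) = lim u + lim v := by
  rw [lim, dif_pos (hu.add hv), lim, dif_pos hu, lim, dif_pos hv, ← map_add]
  rfl

theorem lim_neg {u : M.N → M.RatM} (hu : IsCauchySeqM u) :
    lim (fun n => -u n) = -lim u := by
  rw [lim, dif_pos hu.neg, lim, dif_pos hu, ← map_neg]
  rfl

/-! ### The value of a real -/

/-- The element of the ordered ring given by a real of the structure. -/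
def val (x : M.Fn) : M.RealM := lim fun n => (approx x n).toRat

theorem isReal_iff {x : M.Fn} : IsReal x ↔ (∀ n : M.N, ∃ r : M.Frac, IsRatCode (x ⬝ n) r) ∧
    ∀ n i, |(approx x n).toRat - (approx x (n + i)).toRat| ≤ hp n := by
  refine and_congr_right fun _ => forall_congr' fun n => forall_congr' fun i => ?_
  rw [absLe_iff (den_sub (den_approx _ _) (den_approx _ _)) (pow2_ne_zero n),
    toRat_sub (den_approx _ _) (den_approx _ _), toRat_invPow2]

theorem IsReal.isCauchy {x : M.Fn} (hx : IsReal x) : IsCauchySeqM fun n => (approx x n).toRat := by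
  intro k
  refine ⟨k, fun n hn => ?_⟩
  obtain ⟨i, rfl⟩ := hn
  rw [abs_sub_comm]
  exact (isReal_iff.1 hx).2 k i

theorem IsReal.abs_val_sub {x : M.Fn} (hx : IsReal x) (n : M.N) :
    |val x - ofRat M (approx x n).toRat| ≤ tiny n := by
  have key : ∀ m, n ≤ m → |(approx x n).toRat - (approx x m).toRat| ≤ hp n := by
    rintro _ ⟨i, rfl⟩
    exact (isReal_iff.1 hx).2 n i
  have h1 : val x ≤ ofRat M ((approx x n).toRat + hp n) := by
    rw [val, ← lim_const, lim_le hx.isCauchy (isCauchySeqM_const _)]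
    refine fun k => ⟨n, fun m hm => ?_⟩
    linarith [(abs_le.1 (key m hm)).1, hp_pos k]
  have h2 : ofRat M ((approx x n).toRat - hp n) ≤ val x := by
    rw [val, ← lim_const, lim_le (isCauchySeqM_const _) hx.isCauchy]
    refine fun k => ⟨n, fun m hm => ?_⟩
    linarith [(abs_le.1 (key m hm)).2, hp_pos k]
  rw [map_add] at h1
  rw [map_sub] at h2
  rw [abs_le, tiny]
  constructor <;> linarith

/-- At `n = k + 2` the two approximation errors and the tolerance `2 · 2⁻ⁿ` add up to `4 · 2⁻ⁿ =
2⁻ᵏ`. With the next lemmas, this reduces statements about reals to inequalities in an ordered ring.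
-/
theorem rLe_iff {x y : M.Fn} (hx : IsReal x) (hy : IsReal y) : RLe x y ↔ val x ≤ val y := by
  have key : ∀ n : M.N, approx x n ≤ approx y n + (Frac.invPow2 n + Frac.invPow2 n) ↔
      ofRat M (approx x n).toRat ≤ ofRat M (approx y n).toRat + (tiny n + tiny n) := by
    intro n
    have h := pow2_ne_zero (M := M) n
    have h' := den_add (r := Frac.invPow2 n) (s := Frac.invPow2 n) h h
    rw [toRat_le (den_approx _ _) (den_add (den_approx _ _) h'), toRat_add (den_approx _ _) h',
      toRat_add h h, toRat_invPow2, tiny, ← map_add, ← map_add, ofRat_le]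
  unfold RLe
  simp only [key]
  constructor
  · intro h
    refine le_of_forall_tiny fun k => ?_
    have := h (k + 1 + 1)
    have h1 := abs_le.1 (hx.abs_val_sub (k + 1 + 1))
    have h2 := abs_le.1 (hy.abs_val_sub (k + 1 + 1))
    have e1 := tiny_succ_add k
    have e2 := tiny_succ_add (k + 1)
    linarith [h1.2, h2.1]
  · intro h n
    have h1 := abs_le.1 (hx.abs_val_sub n)
    have h2 := abs_le.1 (hy.abs_val_sub n)
    linarith [h1.1, h2.2]

theorem rLt_iff {x y : M.Fn} (hx : IsReal x) (hy : IsReal y) : RLt x y ↔ val x < val y := by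
  rw [RLt, rLe_iff hy hx, not_le]

theorem rEq_iff {x y : M.Fn} (hx : IsReal x) (hy : IsReal y) : REq x y ↔ val x = val y := by
  have key : REq x y ↔ RLe x y ∧ RLe y x := by
    unfold REq RLe
    rw [← forall_and]
    refine forall_congr' fun n => ?_
    have h := pow2_ne_zero (M := M) n
    have h' := den_add (r := Frac.invPow2 n) (s := Frac.invPow2 n) h h
    have dx := den_approx x n
    have dy := den_approx y n
    rw [absLe_iff (den_sub dx dy) h', toRat_le dx (den_add dy h'), toRat_le dy (den_add dx h'),
      toRat_add dx h', toRat_add dy h', toRat_sub dx dy, abs_le]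
    constructor
    · rintro ⟨h1, h2⟩
      constructor <;> linarith
    · rintro ⟨h1, h2⟩
      constructor <;> linarith
  rw [key, rLe_iff hx hy, rLe_iff hy hx, le_antisymm_iff]

theorem near_iff {k : M.N} {x y : M.Fn} (hx : IsReal x) (hy : IsReal y) :
    Near k x y ↔ |val x - val y| < tiny k := by
  have key : ∀ n : M.N, (approx x n - approx y n).AbsLt
      (Frac.invPow2 k - (Frac.invPow2 n + Frac.invPow2 n)) ↔
      |ofRat M (approx x n).toRat - ofRat M (approx y n).toRat| < tiny k - (tiny n + tiny n) := by
    intro n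
    have h := pow2_ne_zero (M := M) n
    have h' := den_add (r := Frac.invPow2 n) (s := Frac.invPow2 n) h h
    have hk := pow2_ne_zero (M := M) k
    have dx := den_approx x n
    have dy := den_approx y n
    rw [absLt_iff (den_sub dx dy) (den_sub (r := Frac.invPow2 k) hk h'), toRat_sub dx dy,
      toRat_sub (r := Frac.invPow2 k) hk h', toRat_add h h, toRat_invPow2, toRat_invPow2, tiny,
      tiny, ← map_add, ← map_sub, ← map_sub, abs_lt, abs_lt, ← map_neg, ofRat_lt, ofRat_lt]
  unfold Near
  simp only [key]
  constructor
  · rintro ⟨n, hn⟩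
    have h1 := abs_le.1 (hx.abs_val_sub n)
    have h2 := abs_le.1 (hy.abs_val_sub n)
    have h3 := abs_lt.1 hn
    rw [abs_lt]
    constructor <;> linarith [h1.1, h1.2, h2.1, h2.2, h3.1, h3.2]
  · intro h
    obtain ⟨m, hm⟩ := exists_add_tiny_lt h
    -- Two approximation errors and the tolerance `2 · 2⁻ⁿ` use up the slack `2⁻ᵐ = 4 · 2⁻ⁿ`.
    refine ⟨m + 1 + 1, ?_⟩
    have h1 := abs_le.1 (hx.abs_val_sub (m + 1 + 1))
    have h2 := abs_le.1 (hy.abs_val_sub (m + 1 + 1))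
    have h3 := abs_lt.1 (lt_sub_iff_add_lt.2 hm)
    have e1 := tiny_succ_add m
    have e2 := tiny_succ_add (m + 1)
    rw [abs_lt]
    constructor <;> linarith [h1.1, h1.2, h2.1, h2.2, h3.1, h3.2]

theorem isLimit_iff {s : M.N → M.Frac} {z : M.Fn} (hz : IsReal z) (hd : ∀ n, (s n).den ≠ 0)
    (hs : IsCauchySeqM fun n => (s n).toRat) :
    IsLimit s z ↔ val z = lim fun n => (s n).toRat := by
  have key : ∀ n k : M.N, (approx z n - s n).AbsLe (Frac.invPow2 k) ↔
      |(approx z n).toRat - (s n).toRat| ≤ hp k := by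
    intro n k
    rw [absLe_iff (den_sub (den_approx _ _) (hd n)) (pow2_ne_zero k),
      toRat_sub (den_approx _ _) (hd n), toRat_invPow2]
  unfold IsLimit
  simp only [key]
  rw [le_antisymm_iff, val, lim_le hz.isCauchy hs, lim_le hs hz.isCauchy, ← forall_and]
  refine forall_congr' fun k => ?_
  constructor
  · rintro ⟨j, hj⟩
    refine ⟨⟨j, fun n hn => ?_⟩, ⟨j, fun n hn => ?_⟩⟩
    · linarith [(abs_le.1 (hj n hn)).2]
    · linarith [(abs_le.1 (hj n hn)).1]
  · rintro ⟨⟨i, hi⟩, ⟨j, hj⟩⟩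
    refine ⟨max i j, fun n hn => ?_⟩
    have h1 := hi n ((le_max_left _ _).trans hn)
    have h2 := hj n ((le_max_right _ _).trans hn)
    rw [abs_le]
    constructor <;> linarith

theorem isRatCode_toReal {r : M.Frac} (hr : r.den ≠ 0) (n : M.N) : IsRatCode (r.toReal ⬝ n) r :=
  ⟨hr, K_app _ _⟩

theorem approx_toReal {r : M.Frac} (hr : r.den ≠ 0) (n : M.N) : approx r.toReal n = r :=
  approx_eq (isRatCode_toReal hr n)

theorem isReal_toReal {r : M.Frac} (hr : r.den ≠ 0) : IsReal r.toReal := by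
  refine isReal_iff.2 ⟨fun n => ⟨r, isRatCode_toReal hr n⟩, fun n i => ?_⟩
  rw [approx_toReal hr, approx_toReal hr, sub_self, abs_zero]
  exact (hp_pos n).le

theorem val_toReal {r : M.Frac} (hr : r.den ≠ 0) : val r.toReal = ofRat M r.toRat := by
  simp only [val, approx_toReal hr, lim_const]

/-- A sequence of codes of fractions that converges fast is a real. -/
theorem isReal_of_codes {x : M.Fn} {r : M.N → M.Frac} (h : ∀ n, x ⬝ n = (r n).code)
    (hd : ∀ n, (r n).den ≠ 0)
    (hc : ∀ n i, |(r n).toRat - (r (n + i)).toRat| ≤ hp n) :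
    IsReal x ∧ ∀ n, approx x n = r n := by
  have key : ∀ n, IsRatCode (x ⬝ n) (r n) := fun n => ⟨hd n, h n⟩
  have h' : ∀ n, approx x n = r n := fun n => approx_eq (key n)
  exact ⟨isReal_iff.2 ⟨fun n => ⟨_, key n⟩, fun n i => by rw [h', h']; exact hc n i⟩, h'⟩

/-- The real `x + r` for a real `x` and a rational `r`. -/
def shift (x : M.Fn) (r : M.Frac) : M.Fn := lam fun n => (approx x n + r).code

@[fun_prop]
theorem Rep.shift {C : Type u} [Ctx C M] {x : C → M.Fn} {r : C → M.Frac} (hx : Rep x) (hr : Rep r) :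
    Rep fun c => shift (x c) (r c) := by
  unfold FinTypeStructure.shift
  fun_prop

theorem isReal_shift_and {x : M.Fn} (hx : IsReal x) {r : M.Frac} (hr : r.den ≠ 0) :
    IsReal (shift x r) ∧ ∀ n, approx (shift x r) n = approx x n + r := by
  refine isReal_of_codes (r := fun n => approx x n + r) (fun n => lam_app (by fun_prop) n)
    (fun n => den_add (den_approx _ _) hr) fun n i => ?_
  rw [toRat_add (den_approx _ _) hr, toRat_add (den_approx _ _) hr, add_sub_add_right_eq_sub]
  exact (isReal_iff.1 hx).2 n i

theorem isReal_shift {x : M.Fn} (hx : IsReal x) {r : M.Frac} (hr : r.den ≠ 0) :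
    IsReal (shift x r) := (isReal_shift_and hx hr).1

theorem val_shift {x : M.Fn} (hx : IsReal x) {r : M.Frac} (hr : r.den ≠ 0) :
    val (shift x r) = val x + ofRat M r.toRat := by
  simp only [val, (isReal_shift_and hx hr).2, toRat_add (den_approx _ _) hr]
  rw [lim_add hx.isCauchy (isCauchySeqM_const _), lim_const]

theorem mem_unit_iff {x : M.Fn} : Dom.unit.Mem x ↔ IsReal x ∧ 0 ≤ val x ∧ val x ≤ 1 := by
  refine and_congr_right fun hx => ?_
  rw [rLe_iff (isReal_toReal den_zero) hx, rLe_iff hx (isReal_toReal den_one),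
    val_toReal den_zero, val_toReal den_one, toRat_zero, toRat_one, map_zero, map_one]

theorem Dom.Mem.isReal {D : Dom} {x : M.Fn} (h : D.Mem x) : IsReal x := by
  cases D
  · exact h
  · exact h.1

end Reals

end FinTypeStructure

namespace FinTypeStructure

/-! ### `BOOT` evaluates Riemann integrals. -/

noncomputable section Evaluation

variable {M : FinTypeStructure.{u}} [hM : Fact M.IsModelACA]
variable {C D : Type u} [Ctx C M] [Ctx D M] {σ τ : FinType}

open RealM

/-! ### Coding tuples -/

/-- The first component of a coded pair. -/
def projL (c : M.N) : M.N := mu fun a => ∃ b, c = M.pair a b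

/-- The second component of a coded pair. -/
def projR (c : M.N) : M.N := mu fun b => ∃ a, c = M.pair a b

@[fun_prop]
theorem Rep.projL {f : C → M.N} (hf : Rep f) : Rep fun c => projL (f c) := by
  unfold FinTypeStructure.projL
  fun_prop

@[fun_prop]
theorem Rep.projR {f : C → M.N} (hf : Rep f) : Rep fun c => projR (f c) := by
  unfold FinTypeStructure.projR
  fun_prop

theorem projL_pair (a b : M.N) : projL (M.pair a b) = a := by
  obtain ⟨b', h⟩ := mu_spec (A := fun a' => ∃ b', M.pair a b = M.pair a' b') (by fun_prop)
    ⟨a, b, rfl⟩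
  exact (pair_inj h).1.symm

theorem projR_pair (a b : M.N) : projR (M.pair a b) = b := by
  obtain ⟨b', h⟩ := mu_spec (A := fun b' => ∃ a', M.pair a b = M.pair a' b') (by fun_prop)
    ⟨b, a, rfl⟩
  exact (pair_inj h).2.symm

/-- The one direct application of `BOOT`: an existential function quantifier in front of a decidable
matrix is decidable in a number parameter. -/
theorem BOOT.dec {A : M.N × M.Fn → Prop} (hB : M.BOOT) (hA : Dec A) :
    Dec fun n : M.N => ∃ h, A (n, h) := by
  obtain ⟨χ, hχ, hA⟩ := hA
  obtain ⟨X, -, hX⟩ := hB (lam fun h : M.Fn => lam fun n : M.N => χ (n, h))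
  refine Dec.congr (A := fun n => X ⬝ n = (1 : M.N)) (by fun_prop) fun n => ?_
  rw [hX]
  refine exists_congr fun h => ?_
  rw [lam_app (by fun_prop), lam_app (by fun_prop)]
  exact hA _

theorem BOOT.dec₄ {A : (((M.N × M.N) × M.N) × M.N) × M.Fn → Prop} (hB : M.BOOT) (hA : Dec A) :
    Dec fun c : ((M.N × M.N) × M.N) × M.N => ∃ h, A (c, h) := by
  have h1 : Dec fun p : M.N × M.Fn => A ((((projL (projL (projL p.1)), projR (projL (projL p.1))),
      projR (projL p.1)), projR p.1), p.2) := hA.subst (by fun_prop)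
  have h2 := (hB.dec h1).subst
    (f := fun c : ((M.N × M.N) × M.N) × M.N => M.pair (M.pair (M.pair c.1.1.1 c.1.1.2) c.1.2) c.2)
    (by fun_prop)
  refine h2.congr fun c => ?_
  simp only [projL_pair, projR_pair, Prod.mk.eta]

/-- The sequence of reals number `a` that is coded by `h`. -/
def slice (h : M.Fn) (a : M.N) : M.Obj (FinType.zero ⇾ FinType.one) :=
  lam fun i : M.N => lam fun j : M.N => h ⬝ M.pair a (M.pair i j)

@[fun_prop]
theorem Rep.slice {h : C → M.Fn} {a : C → M.N} (hh : Rep h) (ha : Rep a) :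
    Rep fun c => slice (h c) (a c) := by
  unfold FinTypeStructure.slice
  fun_prop

-- The data of a Riemann sum are packed into one function by cases on the first component of a coded
-- argument. Quantifying over Riemann sums thus becomes a single function quantifier.
open Classical in
theorem exists_slices (n : M.N) (x t s : M.Obj (FinType.zero ⇾ FinType.one)) (v : M.Fn) :
    ∃ h : M.Fn, slice h 0 ⬝ (0 : M.N) ⬝ (0 : M.N) = n ∧ slice h 1 = x ∧ slice h 2 = t ∧
      slice h 3 = s ∧ slice h 4 ⬝ (0 : M.N) = v := by
  let F : M.N → M.N := fun c => if projL c = 0 then n else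
    if projL c = 1 then x ⬝ projL (projR c) ⬝ projR (projR c) else
    if projL c = 2 then t ⬝ projL (projR c) ⬝ projR (projR c) else
    if projL c = 3 then s ⬝ projL (projR c) ⬝ projR (projR c) else v ⬝ projR (projR c)
  have hF : Rep F := by
    simp only [F]
    fun_prop
  have key : ∀ a i j, slice (lam F) a ⬝ i ⬝ j = F (M.pair a (M.pair i j)) := by
    intro a i j
    rw [slice, lam_app (by fun_prop), lam_app (by fun_prop), lam_app hF]
  refine ⟨lam F, ?_, ?_, ?_, ?_, ?_⟩
  · simp [key, F, projL_pair]
  · exact M.ext _ _ fun i => M.ext _ _ fun j => (key _ _ _).trans (by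
      simp [F, projL_pair, projR_pair])
  · exact M.ext _ _ fun i => M.ext _ _ fun j => (key _ _ _).trans (by
      simp [F, projL_pair, projR_pair])
  · exact M.ext _ _ fun i => M.ext _ _ fun j => (key _ _ _).trans (by
      simp [F, projL_pair, projR_pair])
  · exact M.ext _ _ fun j => (key _ _ _).trans (by
      simp [F, projL_pair, projR_pair])

/-! ### Deciding properties of all Riemann sums -/

@[fun_prop]
theorem Dec.isPartition {p q : C → M.Fn} {n : C → M.N}
    {x t : C → M.Obj (FinType.zero ⇾ FinType.one)} (hp : Rep p) (hq : Rep q) (hn : Rep n)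
    (hx : Rep x) (ht : Rep t) : Dec fun c => IsPartition (p c) (q c) (n c) (x c) (t c) := by
  unfold IsPartition
  exact .and (.forall (.imp (by fun_prop) (by fun_prop)))
    (.and (.forall (.imp (by fun_prop) (by fun_prop)))
    (.and (by fun_prop) (.and (by fun_prop) (.or (.forall (.imp (by fun_prop) (by fun_prop)))
      (.forall (.imp (by fun_prop) (by fun_prop)))))))

@[fun_prop]
theorem Dec.meshLt {m n : C → M.N} {x : C → M.Obj (FinType.zero ⇾ FinType.one)} (hm : Rep m)
    (hn : Rep n) (hx : Rep x) : Dec fun c => MeshLt (m c) (n c) (x c) := by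
  unfold MeshLt
  exact .forall (.imp (by fun_prop) (by fun_prop))

/-- The sequence `s` consists of the partial sums of a Riemann sum with value `v`. -/
def IsSumList (f : M.Obj (FinType.one ⇾ FinType.one)) (n : M.N)
    (x t s : M.Obj (FinType.zero ⇾ FinType.one)) (v : M.Fn) : Prop :=
  (∀ i : M.N, i ≤ n → IsReal (s ⬝ i)) ∧ REq (s ⬝ (0 : M.N)) (0 : M.Frac).toReal ∧
    (∀ i : M.N, i < n → IsLimit (fun m => approx (s ⬝ i) m +
      approx (f ⬝ (t ⬝ i)) m * (approx (x ⬝ (i + 1)) m - approx (x ⬝ i) m)) (s ⬝ (i + 1))) ∧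
    IsReal v ∧ REq v (s ⬝ n)

theorem isRiemannSum_iff {f : M.Obj (FinType.one ⇾ FinType.one)} {n : M.N}
    {x t : M.Obj (FinType.zero ⇾ FinType.one)} {v : M.Fn} :
    IsRiemannSum f n x t v ↔ ∃ s, IsSumList f n x t s v := Iff.rfl

@[fun_prop]
theorem Dec.isSumList (f : M.Obj (FinType.one ⇾ FinType.one)) {n : C → M.N}
    {x t s : C → M.Obj (FinType.zero ⇾ FinType.one)} {v : C → M.Fn} (hn : Rep n) (hx : Rep x)
    (ht : Rep t) (hs : Rep s) (hv : Rep v) :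
    Dec fun c => IsSumList f (n c) (x c) (t c) (s c) (v c) := by
  unfold IsSumList
  exact .and (.forall (.imp (by fun_prop) (by fun_prop)))
    (.and (by fun_prop) (.and (.forall (.imp (by fun_prop) (.isLimit (by fun_prop) (by fun_prop))))
      (by fun_prop)))

/-- A counterexample is a Riemann sum, hence one function, and checking it is arithmetical. The
end-points enter through their codes because `BOOT` is uniform in numbers only; `M.K _ _ ⬝ p.code`
is `p.toReal`. -/
theorem BOOT.dec_sumsSatisfy (hB : M.BOOT) (f : M.Obj (FinType.one ⇾ FinType.one))
    {P : M.N → M.Fn → Prop} (hP : Dec fun c : M.N × M.Fn => P c.1 c.2) :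
    Dec fun c : ((M.N × M.N) × M.N) × M.N =>
      SumsSatisfy f (M.K FinType.zero FinType.zero ⬝ c.1.1.1)
        (M.K FinType.zero FinType.zero ⬝ c.1.1.2) c.1.2 (P c.2) := by
  let A : (((M.N × M.N) × M.N) × M.N) × M.Fn → Prop := fun c =>
    IsPartition (M.K FinType.zero FinType.zero ⬝ c.1.1.1.1)
      (M.K FinType.zero FinType.zero ⬝ c.1.1.1.2) (slice c.2 0 ⬝ (0 : M.N) ⬝ (0 : M.N))
      (slice c.2 1) (slice c.2 2) ∧
    MeshLt c.1.1.2 (slice c.2 0 ⬝ (0 : M.N) ⬝ (0 : M.N)) (slice c.2 1) ∧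
    IsSumList f (slice c.2 0 ⬝ (0 : M.N) ⬝ (0 : M.N)) (slice c.2 1) (slice c.2 2) (slice c.2 3)
      (slice c.2 4 ⬝ (0 : M.N)) ∧ ¬ P c.1.2 (slice c.2 4 ⬝ (0 : M.N))
  have hA : Dec A := by
    refine .and (by fun_prop) (.and (by fun_prop) (.and (by fun_prop) (.not ?_)))
    exact hP.subst (f := fun c : (((M.N × M.N) × M.N) × M.N) × M.Fn =>
      (c.1.2, slice c.2 4 ⬝ (0 : M.N))) (by fun_prop)
  refine (hB.dec₄ hA).not.congr fun c => ?_
  constructor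
  · intro h n x t v h1 h2 h3
    by_contra h4
    obtain ⟨s, hs⟩ := h3
    obtain ⟨h', e1, e2, e3, e4, e5⟩ := exists_slices n x t s v
    refine h ⟨h', ?_⟩
    simp only [A, e1, e2, e3, e4, e5]
    exact ⟨h1, h2, hs, h4⟩
  · rintro h ⟨h', h1, h2, h3, h4⟩
    exact h4 (h _ _ _ _ h1 h2 ⟨_, h3⟩)

theorem SumsSatisfy.mono {f : M.Obj (FinType.one ⇾ FinType.one)} {p q : M.Fn} {m m' : M.N}
    {A B : M.Fn → Prop} (h : SumsSatisfy f p q m A) (hm : m ≤ m')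
    (hAB : ∀ v, IsReal v → A v → B v) : SumsSatisfy f p q m' B := by
  intro n x t v h1 h2 h3
  obtain ⟨s, hs⟩ := isRiemannSum_iff.1 h3
  refine hAB v hs.2.2.2.1 (h n x t v h1 (fun i hi => ?_) h3)
  have r1 := h1.1 i hi.le
  have r2 := h1.1 (i + 1) (lt_iff_add_one_le'.1 hi)
  have := h2 i hi
  rw [near_iff r1 r2] at this ⊢
  exact this.trans_le (tiny_anti hm)

theorem toRat_ofN (n : M.N) : (Frac.ofN n).toRat = RatM.ofNat n := by
  simp [Frac.toRat_def, Frac.ofN]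

theorem den_ofN (n : M.N) : (Frac.ofN n).den ≠ 0 := one_ne_zero (α := M.N)

theorem den_invPow2 (n : M.N) : (Frac.invPow2 n).den ≠ 0 := pow2_ne_zero n

section

variable (f : M.Obj (FinType.one ⇾ FinType.one))

/-- All Riemann sums for partitions of mesh less than `2⁻ᵐ` are at least `r`. -/
def SumsGe (p q m r : M.N) : Prop :=
  SumsSatisfy f (M.K FinType.zero FinType.zero ⬝ p) (M.K FinType.zero FinType.zero ⬝ q) m
    fun v => RLe (M.K FinType.zero FinType.zero ⬝ r) v

/-- All Riemann sums for partitions of mesh less than `2⁻ᵐ` are at most `r`. -/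
def SumsLe (p q m r : M.N) : Prop :=
  SumsSatisfy f (M.K FinType.zero FinType.zero ⬝ p) (M.K FinType.zero FinType.zero ⬝ q) m
    fun v => RLe v (M.K FinType.zero FinType.zero ⬝ r)

/-- All Riemann sums for sufficiently fine partitions are in `[r - 2⁻ᵏ⁻¹, r + 2⁻ᵏ⁻¹]`, where `c`
codes `r`. -/
def SumsNear (p q k c : M.N) : Prop :=
  ∃ r : M.Frac, IsRatCode c r ∧ ∃ m, SumsGe f p q m (r - Frac.invPow2 (k + 1)).code ∧
    SumsLe f p q m (r + Frac.invPow2 (k + 1)).code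

/-- Weak and strict bounds agree once `k` is arbitrary: being at least `k + 1` implies being greater
than `k`. -/
theorem integralEqTop_iff (p q : M.Frac) : IntegralEqTop f p.toReal q.toReal ↔
    ∀ k, ∃ m, SumsGe f p.code q.code m (Frac.ofN k).code := by
  constructor
  · intro h k
    obtain ⟨m, hm⟩ := h k
    refine ⟨m, hm.mono le_rfl fun v hv h => ?_⟩
    exact (rLe_iff (isReal_toReal (den_ofN k)) hv).2 ((rLt_iff (isReal_toReal (den_ofN k)) hv).1 h).le
  · intro h k
    obtain ⟨m, hm⟩ := h (k + 1)
    refine ⟨m, hm.mono le_rfl fun v hv h => ?_⟩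
    have h' := (rLe_iff (isReal_toReal (den_ofN (k + 1))) hv).1 h
    rw [val_toReal (den_ofN _), toRat_ofN, map_add, map_one, map_add, map_one] at h'
    rw [rLt_iff (isReal_toReal (den_ofN k)) hv, val_toReal (den_ofN _), toRat_ofN]
    linarith

theorem integralEqBot_iff (p q : M.Frac) : IntegralEqBot f p.toReal q.toReal ↔
    ∀ k, ∃ m, SumsLe f p.code q.code m (-Frac.ofN k).code := by
  constructor
  · intro h k
    obtain ⟨m, hm⟩ := h k
    refine ⟨m, hm.mono le_rfl fun v hv h => ?_⟩
    have hr := isReal_toReal (den_neg (den_ofN k))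
    exact (rLe_iff hv hr).2 ((rLt_iff hv hr).1 h).le
  · intro h k
    obtain ⟨m, hm⟩ := h (k + 1)
    refine ⟨m, hm.mono le_rfl fun v hv h => ?_⟩
    have h' := (rLe_iff hv (isReal_toReal (den_neg (den_ofN (k + 1))))).1 h
    rw [val_toReal (den_neg (den_ofN _)), toRat_neg (den_ofN _), toRat_ofN, map_neg, map_add,
      map_one, map_add, map_one] at h'
    rw [rLt_iff hv (isReal_toReal (den_neg (den_ofN k))), val_toReal (den_neg (den_ofN _)),
      toRat_neg (den_ofN _), toRat_ofN, map_neg]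
    linarith

variable {f}

theorem SumsNear.exists_bounds {p q k c : M.N} (h : SumsNear f p q k c) :
    ∃ r : M.Frac, IsRatCode c r ∧ ∃ m, SumsSatisfy f (M.K FinType.zero FinType.zero ⬝ p)
      (M.K FinType.zero FinType.zero ⬝ q) m fun v =>
        IsReal v ∧ |val v - ofRat M r.toRat| ≤ tiny (k + 1) := by
  obtain ⟨r, hr, m, h1, h2⟩ := h
  refine ⟨r, hr, m, fun n x t v a1 a2 a3 => ?_⟩
  have hv : IsReal v := by
    obtain ⟨s, hs⟩ := isRiemannSum_iff.1 a3
    exact hs.2.2.2.1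
  have b1 := h1 n x t v a1 a2 a3
  have b2 := h2 n x t v a1 a2 a3
  have d1 := den_sub hr.1 (den_invPow2 (k + 1))
  have d2 := den_add hr.1 (den_invPow2 (k + 1))
  have b1 := (rLe_iff (isReal_toReal d1) hv).1 b1
  have b2 := (rLe_iff hv (isReal_toReal d2)).1 b2
  rw [val_toReal d1, toRat_sub hr.1 (den_invPow2 _), toRat_invPow2, map_sub] at b1
  rw [val_toReal d2, toRat_add hr.1 (den_invPow2 _), toRat_invPow2, map_add] at b2
  refine ⟨hv, abs_le.2 ?_⟩
  unfold tiny
  constructor <;> linarith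

theorem IntegralEqReal.sumsNear {p q : M.Frac} {I : M.Fn}
    (h : IntegralEqReal f p.toReal q.toReal I) (k : M.N) : ∃ c, SumsNear f p.code q.code k c := by
  obtain ⟨hI, h⟩ := h
  -- The distance of the sums to `I` and that of `I` to its approximation are each at most `2⁻ᵏ⁻²`,
  -- together `2⁻ᵏ⁻¹`.
  obtain ⟨m, hm⟩ := h (k + 1 + 1)
  have hr := den_approx I (k + 1 + 1)
  have hI' := abs_le.1 (hI.abs_val_sub (k + 1 + 1))
  have e1 := tiny_succ_add (k + 1)
  refine ⟨_, approx I (k + 1 + 1), ⟨hr, rfl⟩, m, hm.mono le_rfl fun v hv h => ?_,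
    hm.mono le_rfl fun v hv h => ?_⟩
  · have d1 := den_sub hr (den_invPow2 (k + 1))
    refine (rLe_iff (isReal_toReal d1) hv).2 ?_
    rw [val_toReal d1, toRat_sub hr (den_invPow2 _), toRat_invPow2, map_sub]
    have := abs_lt.1 ((near_iff hv hI).1 h)
    change _ - tiny (k + 1) ≤ _
    linarith [this.1]
  · have d1 := den_add hr (den_invPow2 (k + 1))
    refine (rLe_iff hv (isReal_toReal d1)).2 ?_
    rw [val_toReal d1, toRat_add hr (den_invPow2 _), toRat_invPow2, map_add]
    have := abs_lt.1 ((near_iff hv hI).1 h)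
    change _ ≤ _ + tiny (k + 1)
    linarith [this.2]

/-- If the Riemann sums have the Cauchy property, then they converge. -/
theorem integralEqReal_of_sumsNear {p q : M.Frac} {I : M.Fn}
    (h : ∀ k, SumsNear f p.code q.code k (I ⬝ k)) (hT : ¬ IntegralEqTop f p.toReal q.toReal) :
    IntegralEqReal f p.toReal q.toReal I := by
  choose r hr m hm using fun k => (h k).exists_bounds
  have key : ∀ n i, |(r n).toRat - (r (n + i)).toRat| ≤ hp n := by
    intro n i
    by_contra hc
    -- A Riemann sum of this mesh would be within `2⁻ⁿ⁻¹` of both rationals and force the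
    -- inequality. If there is none, every bound holds vacuously and the integral would count as
    -- `+∞`. Excluding `+∞` thus replaces a construction of Riemann sums for arbitrary `f`.
    refine hT fun k => ⟨max (m n) (m (n + i)), ?_⟩
    intro l x t v a1 a2 a3
    exfalso
    have b1 := ((hm n).mono (le_max_left _ (m (n + i))) fun _ _ h => h) l x t v a1 a2 a3
    have b2 := ((hm (n + i)).mono (le_max_right (m n) _) fun _ _ h => h) l x t v a1 a2 a3
    have c1 := abs_le.1 b1.2
    have c2 := abs_le.1 b2.2
    have e1 := tiny_succ_add n
    have e2 : tiny (n + i + 1) ≤ tiny (n + 1) := tiny_anti ⟨i, by ring⟩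
    refine hc (abs_le.2 ⟨?_, ?_⟩)
    · rw [← ofRat_le, map_neg, map_sub]
      change - tiny n ≤ _
      linarith [c1.1, c1.2, c2.1, c2.2]
    · rw [← ofRat_le, map_sub]
      change _ ≤ tiny n
      linarith [c1.1, c1.2, c2.1, c2.2]
  obtain ⟨hI, hI'⟩ := isReal_of_codes (x := I) (r := r) (fun n => (hr n).2) (fun n => (hr n).1) key
  refine ⟨hI, fun k => ⟨m (k + 1), (hm (k + 1)).mono le_rfl fun v hv h => ?_⟩⟩
  rw [near_iff hv hI]
  have c1 := abs_le.1 h.2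
  have c2 := abs_le.1 (hI.abs_val_sub (k + 1))
  rw [hI'] at c2
  have e1 := tiny_succ_add k
  have e2 := tiny_succ_add (k + 1)
  have e3 := tiny_pos (k + 1 + 1)
  refine abs_lt.2 ⟨?_, ?_⟩ <;> linarith [c1.1, c1.2, c2.1, c2.2]

end

theorem BOOT.dec_sumsGe (hB : M.BOOT) (f : M.Obj (FinType.one ⇾ FinType.one))
    {p q m r : C → M.N} (hp : Rep p) (hq : Rep q) (hm : Rep m) (hr : Rep r) :
    Dec fun c => SumsGe f (p c) (q c) (m c) (r c) :=
  (hB.dec_sumsSatisfy f (P := fun r v => RLe (M.K FinType.zero FinType.zero ⬝ r) v)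
    (by fun_prop)).subst (f := fun c => (((p c, q c), m c), r c)) (by fun_prop)

theorem BOOT.dec_sumsLe (hB : M.BOOT) (f : M.Obj (FinType.one ⇾ FinType.one))
    {p q m r : C → M.N} (hp : Rep p) (hq : Rep q) (hm : Rep m) (hr : Rep r) :
    Dec fun c => SumsLe f (p c) (q c) (m c) (r c) :=
  (hB.dec_sumsSatisfy f (P := fun r v => RLe v (M.K FinType.zero FinType.zero ⬝ r))
    (by fun_prop)).subst (f := fun c => (((p c, q c), m c), r c)) (by fun_prop)

open Classical in
/-- `BOOT` evaluates the Riemann integrals of arbitrary functions. -/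
theorem BOOT.exists_integrals (hB : M.BOOT) (f : M.Obj (FinType.one ⇾ FinType.one)) :
    ∃ (e : M.Obj (FinType.zero ⇾ FinType.zero ⇾ FinType.zero))
      (I : M.Obj (FinType.zero ⇾ FinType.zero ⇾ FinType.one)), ∀ p q : M.Frac,
        IntegralEq f p.toReal q.toReal (e ⬝ p.code ⬝ q.code) (I ⬝ p.code ⬝ q.code) := by
  have hTop : Dec fun c : M.N × M.N => ∀ k, ∃ m, SumsGe f c.1 c.2 m (Frac.ofN k).code :=
    .forall (.exists (hB.dec_sumsGe f (by fun_prop) (by fun_prop) (by fun_prop) (by fun_prop)))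
  have hBot : Dec fun c : M.N × M.N => ∀ k, ∃ m, SumsLe f c.1 c.2 m (-Frac.ofN k).code :=
    .forall (.exists (hB.dec_sumsLe f (by fun_prop) (by fun_prop) (by fun_prop) (by fun_prop)))
  have hNear : Dec fun c : ((M.N × M.N) × M.N) × M.N => SumsNear f c.1.1.1 c.1.1.2 c.1.2 c.2 := by
    unfold SumsNear
    exact .existsFrac (.and (by fun_prop) (.exists (.and
      (hB.dec_sumsGe f (by fun_prop) (by fun_prop) (by fun_prop) (by fun_prop))
      (hB.dec_sumsLe f (by fun_prop) (by fun_prop) (by fun_prop) (by fun_prop)))))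
  have hCau : Dec fun c : M.N × M.N => ∀ k, ∃ r, SumsNear f c.1 c.2 k r :=
    .forall (.exists hNear)
  -- The order of the tests matters: a real value is assigned only after `+∞` has been excluded, as
  -- `integralEqReal_of_sumsNear` requires.
  let e : M.N × M.N → M.N := fun c =>
    if ∀ k, ∃ m, SumsGe f c.1 c.2 m (Frac.ofN k).code then 1 else
    if ∀ k, ∃ m, SumsLe f c.1 c.2 m (-Frac.ofN k).code then 1 + 1 else
    if ∀ k, ∃ r, SumsNear f c.1 c.2 k r then 0 else 1 + 1 + 1
  have he : Rep e :=
    .ite hTop (.const _) (.ite hBot (.const _) (.ite hCau (.const _) (.const _)))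
  have hI : Rep fun c : (M.N × M.N) × M.N => mu fun r => SumsNear f c.1.1 c.1.2 c.2 r :=
    Rep.mu hNear
  refine ⟨lam fun p => lam fun q => e (p, q),
    lam fun p => lam fun q => lam fun k => mu fun r => SumsNear f p q k r, fun p q => ?_⟩
  have hI1 : Rep fun c : M.N × M.N => lam fun k => mu fun r => SumsNear f c.1 c.2 k r := hI.lam
  have hI2 : ∀ p : M.N, Rep fun q : M.N => lam fun k => mu fun r => SumsNear f p q k r :=
    fun p => hI1.comp (f := fun q : M.N => (p, q)) (by fun_prop)
  have hI3 : Rep fun p : M.N => lam fun q : M.N => lam fun k => mu fun r => SumsNear f p q k r :=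
    hI1.lam
  rw [lam_app (by fun_prop), lam_app (by fun_prop), lam_app hI3, lam_app (hI2 _)]
  by_cases h1 : ∀ k, ∃ m, SumsGe f p.code q.code m (Frac.ofN k).code
  · exact Or.inr (Or.inl ⟨if_pos h1, (integralEqTop_iff f p q).2 h1⟩)
  by_cases h2 : ∀ k, ∃ m, SumsLe f p.code q.code m (-Frac.ofN k).code
  · exact Or.inr (Or.inr (Or.inl ⟨(if_neg h1).trans (if_pos h2), (integralEqBot_iff f p q).2 h2⟩))
  by_cases h3 : ∀ k, ∃ r, SumsNear f p.code q.code k r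
  · refine Or.inl ⟨(if_neg h1).trans ((if_neg h2).trans (if_pos h3)), ?_⟩
    refine integralEqReal_of_sumsNear (fun k => ?_) fun h => h1 ((integralEqTop_iff f p q).1 h)
    rw [lam_app (hI.comp (f := fun k : M.N => ((p.code, q.code), k)) (by fun_prop))]
    exact mu_spec (hNear.subst (f := fun r : M.N => (((p.code, q.code), k), r)) (by fun_prop))
      (h3 k)
  · refine Or.inr (Or.inr (Or.inr ⟨(if_neg h1).trans ((if_neg h2).trans (if_neg h3)), ?_⟩))
    refine ⟨?_, fun h => h1 ((integralEqTop_iff f p q).1 h),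
      fun h => h2 ((integralEqBot_iff f p q).1 h)⟩
    rintro ⟨I, hI⟩
    exact h3 hI.sumsNear

theorem BOOT.evaluationPrinciple (hB : M.BOOT) (D : Dom)
    (Γ : M.Obj (FinType.one ⇾ FinType.one) → Prop) : EvaluationPrinciple D Γ := by
  intro f _ _
  obtain ⟨e, I, h⟩ := hB.exists_integrals f
  exact ⟨e, I, fun p q _ _ _ _ => h p q⟩

end Evaluation

end FinTypeStructure

namespace FinTypeStructure

noncomputable section Digits

variable {M : FinTypeStructure.{u}} [hM : Fact M.IsModelACA]
variable {C D : Type u} [Ctx C M] [Ctx D M] {σ τ : FinType}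

open RealM

/-! ### Dyadic rationals -/

/-- The fraction `(a - b) / 2ᵏ`. -/
def dyFrac (a b k : M.N) : M.Frac := ⟨a, b, M.pow2 ⬝ k⟩

@[fun_prop]
theorem Rep.dyFrac {a b k : C → M.N} (ha : Rep a) (hb : Rep b) (hk : Rep k) :
    Rep fun c => dyFrac (a c) (b c) (k c) := by
  unfold FinTypeStructure.dyFrac
  fun_prop

theorem den_dyFrac (a b k : M.N) : (dyFrac a b k).den ≠ 0 := pow2_ne_zero k

theorem toRat_dyFrac (a b k : M.N) :
    (dyFrac a b k).toRat = (RatM.ofNat a - RatM.ofNat b) * hp k := rfl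

/-- Dyadic rationals. -/
def IsDyadic (z : M.RealM) : Prop := ∃ a b k, z = ofRat M (dyFrac a b k).toRat

theorem ofNat_pow2_mul_hp (k : M.N) : RatM.ofNat (M.pow2 ⬝ k) * hp k = 1 :=
  mul_inv_cancel₀ (ofNat_pow2_pos k).ne'

theorem IsDyadic.add {y z : M.RealM} (hy : IsDyadic y) (hz : IsDyadic z) : IsDyadic (y + z) := by
  obtain ⟨a, b, k, rfl⟩ := hy
  obtain ⟨c, d, l, rfl⟩ := hz
  refine ⟨a * (M.pow2 ⬝ l) + c * (M.pow2 ⬝ k), b * (M.pow2 ⬝ l) + d * (M.pow2 ⬝ k), k + l, ?_⟩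
  rw [← map_add, ofRat_inj, toRat_dyFrac, toRat_dyFrac, toRat_dyFrac, hp_add]
  simp only [map_add, map_mul]
  have h1 := ofNat_pow2_mul_hp k
  have h2 := ofNat_pow2_mul_hp l
  linear_combination (RatM.ofNat a - RatM.ofNat b) * hp k * (-h2) +
    (RatM.ofNat c - RatM.ofNat d) * hp l * (-h1)

theorem IsDyadic.neg {y : M.RealM} (hy : IsDyadic y) : IsDyadic (-y) := by
  obtain ⟨a, b, k, rfl⟩ := hy
  refine ⟨b, a, k, ?_⟩
  rw [← map_neg, ofRat_inj, toRat_dyFrac, toRat_dyFrac]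
  ring

theorem IsDyadic.sub {y z : M.RealM} (hy : IsDyadic y) (hz : IsDyadic z) : IsDyadic (y - z) := by
  rw [sub_eq_add_neg]
  exact hy.add hz.neg

theorem isDyadic_tiny (k : M.N) : IsDyadic (tiny k) :=
  ⟨1, 0, k, by simp [toRat_dyFrac, tiny]⟩

theorem isDyadic_zero : IsDyadic (0 : M.RealM) :=
  ⟨0, 0, 0, by simp [toRat_dyFrac]⟩

theorem isDyadic_one : IsDyadic (1 : M.RealM) := by
  rw [← tiny_zero]
  exact isDyadic_tiny 0

/-- Reals are limits of dyadic rationals. -/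
theorem IsReal.exists_dyadic {x : M.Fn} (hx : IsReal x) (k : M.N) :
    ∃ a b j, |val x - ofRat M (dyFrac a b j).toRat| < tiny k := by
  have hd := den_approx x (k + 1)
  have hx' := abs_le.1 (hx.abs_val_sub (k + 1))
  set r := approx x (k + 1)
  -- The two parts of the numerator are rounded down separately to multiples of `2⁻ᵏ⁻¹`; the
  -- rounding errors lie in `[0, 2⁻ᵏ⁻¹)`, so their difference is smaller than `2⁻ᵏ⁻¹`.
  have key : ∀ p : M.N, ∃ a, RatM.ofNat a * hp (k + 1) ≤ RatM.ofNat p / RatM.ofNat r.den ∧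
      RatM.ofNat p / RatM.ofNat r.den < RatM.ofNat a * hp (k + 1) + hp (k + 1) := by
    intro p
    obtain ⟨a, h1, h2⟩ := exists_quotient (p * (M.pow2 ⬝ (k + 1))) hd
    have hd' : 0 < RatM.ofNat r.den := by
      rw [← map_zero RatM.ofNat, RatM.ofNat_lt]
      exact pos_iff_ne_zero.2 hd
    have h1 := RatM.ofNat_le.2 h1
    have h2 := RatM.ofNat_lt.2 h2
    simp only [map_mul, map_add, map_one] at h1 h2
    have h3 := ofNat_pow2_mul_hp (k + 1)
    have h4 := hp_pos (k + 1)
    refine ⟨a, ?_, ?_⟩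
    · rw [le_div_iff₀ hd']
      have := mul_le_mul_of_nonneg_right h1 h4.le
      rw [mul_assoc (RatM.ofNat p), h3] at this
      linarith
    · rw [div_lt_iff₀ hd']
      have := mul_lt_mul_of_pos_right h2 h4
      rw [mul_assoc (RatM.ofNat p), h3] at this
      linarith
  obtain ⟨a, ha, ha'⟩ := key r.pos
  obtain ⟨b, hb, hb'⟩ := key r.neg
  refine ⟨a, b, k + 1, ?_⟩
  have h1 : |r.toRat - (dyFrac a b (k + 1)).toRat| < hp (k + 1) := by
    rw [Frac.toRat_def, toRat_dyFrac, sub_div, sub_mul, abs_lt]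
    constructor <;> linarith
  have h2 := abs_lt.1 h1
  rw [← ofRat_lt, ← ofRat_lt, map_neg, map_sub] at h2
  change -tiny (k + 1) < _ ∧ _ < tiny (k + 1) at h2
  have := tiny_succ_add k
  rw [abs_lt]
  constructor <;> linarith [h2.1, h2.2, hx'.1, hx'.2]

/-! ### Binary digits -/

/-- The binary digit number `j` of `z` is `1`. -/
def DigitOne (z : M.RealM) (j : M.N) : Prop :=
  ∃ a : M.N, ofRat M (dyFrac (a + a + 1) 0 (j + 1)).toRat ≤ z ∧
    z < ofRat M (dyFrac (a + a + 1 + 1) 0 (j + 1)).toRat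

/-- The binary digit number `j` of the real `x` is `1`. -/
def HasDigit (x : M.Fn) (j : M.N) : Prop :=
  ∃ a : M.N, RLe (dyFrac (a + a + 1) 0 (j + 1)).toReal x ∧
    RLt x (dyFrac (a + a + 1 + 1) 0 (j + 1)).toReal

@[fun_prop]
theorem Dec.hasDigit {x : C → M.Fn} {j : C → M.N} (hx : Rep x) (hj : Rep j) :
    Dec fun c => HasDigit (x c) (j c) := by
  unfold HasDigit
  fun_prop

theorem hasDigit_iff {x : M.Fn} (hx : IsReal x) (j : M.N) : HasDigit x j ↔ DigitOne (val x) j := by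
  refine exists_congr fun a => ?_
  rw [rLe_iff (isReal_toReal (den_dyFrac _ _ _)) hx, rLt_iff hx (isReal_toReal (den_dyFrac _ _ _)),
    val_toReal (den_dyFrac _ _ _), val_toReal (den_dyFrac _ _ _)]

theorem add_self_ne_add_self_add_one (a b : M.N) : a + a ≠ b + b + 1 := by
  intro h
  rcases le_or_gt a b with h' | h'
  · have := add_le_add h' h'
    rw [h] at this
    exact this.not_gt (lt_add_one_iff'.2 le_rfl)
  · have h'' := lt_iff_add_one_le'.1 h'
    have := add_le_add h'' h''
    rw [h, show b + 1 + (b + 1) = b + b + 1 + 1 by ring] at this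
    exact this.not_gt (lt_add_one_iff'.2 le_rfl)

/-- The digits of a dyadic rational are eventually zero. -/
theorem IsDyadic.not_digitOne {z : M.RealM} (hz : IsDyadic z) : ∃ k, ∀ j, k ≤ j → ¬ DigitOne z j := by
  obtain ⟨a, b, k, rfl⟩ := hz
  refine ⟨k, ?_⟩
  rintro _ ⟨i, rfl⟩ ⟨c, h1, h2⟩
  rw [ofRat_le, toRat_dyFrac, toRat_dyFrac, map_zero, sub_zero] at h1
  rw [ofRat_lt, toRat_dyFrac, toRat_dyFrac, map_zero, sub_zero] at h2
  -- With `j = k + i`, the dyadic rational is the even integer `(a - b) · 2 · 2ⁱ` in units of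
  -- `2⁻ʲ⁻¹`, whereas a digit `1` would make it the odd number `2c + 1`.
  have e : hp k = RatM.ofNat (M.pow2 ⬝ i + M.pow2 ⬝ i) * hp (k + i + 1) := by
    rw [← pow2_succ, add_assoc, hp_add k, mul_left_comm, ofNat_pow2_mul_hp, mul_one]
  have hpos := hp_pos (k + i + 1)
  rw [e, ← mul_assoc] at h1 h2
  have h1 := le_of_mul_le_mul_right h1 hpos
  have h2 := lt_of_mul_lt_mul_right h2 hpos.le
  rw [sub_mul, ← map_mul, ← map_mul] at h1 h2
  have h1 : RatM.ofNat (c + c + 1 + b * (M.pow2 ⬝ i + M.pow2 ⬝ i)) ≤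
      RatM.ofNat (a * (M.pow2 ⬝ i + M.pow2 ⬝ i)) := by
    rw [map_add RatM.ofNat (c + c + 1)]
    linarith
  have h2 : RatM.ofNat (a * (M.pow2 ⬝ i + M.pow2 ⬝ i)) <
      RatM.ofNat (c + c + 1 + b * (M.pow2 ⬝ i + M.pow2 ⬝ i) + 1) := by
    rw [map_add RatM.ofNat (c + c + 1), map_one] at h2
    rw [map_add RatM.ofNat (c + c + 1 + _), map_add RatM.ofNat (c + c + 1), map_one]
    linarith
  rw [RatM.ofNat_le] at h1
  rw [RatM.ofNat_lt, lt_add_one_iff'] at h2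
  refine add_self_ne_add_self_add_one (a * (M.pow2 ⬝ i)) (c + b * (M.pow2 ⬝ i)) ?_
  have := le_antisymm h2 h1
  grind

/-! ### Coding functions by reals -/

open Classical in
/-- The digits of the graph of `g`. -/
def graphBit (g : M.Fn) (j : M.N) : M.N := if ∃ m, j = M.pair m (g ⬝ m) then 1 else 0

@[fun_prop]
theorem Rep.graphBit {g : C → M.Fn} {j : C → M.N} (hg : Rep g) (hj : Rep j) :
    Rep fun c => graphBit (g c) (j c) := by
  unfold FinTypeStructure.graphBit
  fun_prop

theorem graphBit_pair (g : M.Fn) (m v : M.N) : graphBit g (M.pair m v) = 1 ↔ v = g ⬝ m := by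
  unfold graphBit
  constructor
  · intro h
    by_cases h' : ∃ m', M.pair m v = M.pair m' (g ⬝ m')
    · obtain ⟨m', h'⟩ := h'
      obtain ⟨rfl, h2⟩ := pair_inj h'
      exact h2
    · rw [if_neg h'] at h
      exact absurd h zero_ne_one
  · rintro rfl
    exact if_pos ⟨m, rfl⟩

theorem graphBit_eq (g : M.Fn) (j : M.N) : graphBit g j = 0 ∨ graphBit g j = 1 := by
  unfold graphBit
  split_ifs
  · exact Or.inr rfl
  · exact Or.inl rfl

theorem le_pair_left (a b : M.N) : a ≤ M.pair a b := le_add_self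

/-- The pair `(n, g(n) + 1)` is not in the graph and its code is at least `n`. So there is no tail
of digits `1`. -/
theorem exists_graphBit_eq_zero (g : M.Fn) (n : M.N) : ∃ i, graphBit g (n + i) = 0 := by
  obtain ⟨i, hi⟩ := exists_eq_add_of_le' (le_pair_left n (g ⬝ n + 1))
  refine ⟨i, ?_⟩
  rw [← hi]
  rcases graphBit_eq g (M.pair n (g ⬝ n + 1)) with h | h
  · exact h
  · rw [graphBit_pair] at h
    exact absurd (left_eq_add.1 h.symm) one_ne_zero

/-- The number with the first `n` digits of the graph of `g`. -/
def graphNum (g : M.Fn) (n : M.N) : M.N := rec0 0 (fun j r => r + r + graphBit g j) n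

@[fun_prop]
theorem Rep.graphNum {g : C → M.Fn} {j : C → M.N} (hg : Rep g) (hj : Rep j) :
    Rep fun c => graphNum (g c) (j c) := by
  unfold FinTypeStructure.graphNum
  fun_prop

theorem graphNum_succ (g : M.Fn) (n : M.N) :
    graphNum g (n + 1) = graphNum g n + graphNum g n + graphBit g n :=
  rec0_succ _ (by fun_prop) n

/-- Appending `i` digits keeps the number inside the dyadic interval fixed by the first `n` digits,
rescaled by `2ⁱ`. -/
theorem graphNum_bounds (g : M.Fn) (n i : M.N) :
    graphNum g n * (M.pow2 ⬝ i) ≤ graphNum g (n + i) ∧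
      graphNum g (n + i) + 1 ≤ (graphNum g n + 1) * (M.pow2 ⬝ i) := by
  refine induction (A := fun i => graphNum g n * (M.pow2 ⬝ i) ≤ graphNum g (n + i) ∧
      graphNum g (n + i) + 1 ≤ (graphNum g n + 1) * (M.pow2 ⬝ i)) (by fun_prop) ?_ ?_ i
  · rw [pow2_zero, mul_one, mul_one, add_zero]
    exact ⟨le_rfl, le_rfl⟩
  · rintro i ⟨h1, h2⟩
    rw [← add_assoc, graphNum_succ, pow2_succ, mul_add, mul_add]
    refine ⟨(add_le_add h1 h1).trans le_self_add, le_trans ?_ (add_le_add h2 h2)⟩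
    rw [show graphNum g (n + i) + 1 + (graphNum g (n + i) + 1) =
      graphNum g (n + i) + graphNum g (n + i) + 1 + 1 by ring]
    gcongr
    rcases graphBit_eq g (n + i) with h | h <;> rw [h]
    exact zero_le' 1

/-- The real whose binary digits code the graph of `g`. -/
def graphReal (g : M.Fn) : M.Fn := lam fun n => (dyFrac (graphNum g n) 0 n).code

theorem graphReal_bounds_rat (g : M.Fn) (n i : M.N) :
    (dyFrac (graphNum g n) 0 n).toRat ≤ (dyFrac (graphNum g (n + i)) 0 (n + i)).toRat ∧
      (dyFrac (graphNum g (n + i)) 0 (n + i)).toRat + hp (n + i) ≤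
        (dyFrac (graphNum g n) 0 n).toRat + hp n := by
  obtain ⟨h1, h2⟩ := graphNum_bounds g n i
  have h1 := RatM.ofNat_le.2 h1
  have h2 := RatM.ofNat_le.2 h2
  simp only [map_mul, map_add, map_one] at h1 h2
  simp only [toRat_dyFrac, map_zero, sub_zero, hp_add]
  have e := ofNat_pow2_mul_hp i
  have hn := hp_pos n
  have hi := hp_pos i
  have hni := mul_pos hn hi
  have a1 := mul_le_mul_of_nonneg_right h1 hni.le
  have a2 := mul_le_mul_of_nonneg_right h2 hni.le
  constructor
  · calc _ = RatM.ofNat (graphNum g n) * RatM.ofNat (M.pow2 ⬝ i) * (hp n * hp i) := by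
          linear_combination RatM.ofNat (graphNum g n) * hp n * (-e)
      _ ≤ _ := a1
  · calc _ = (RatM.ofNat (graphNum g (n + i)) + 1) * (hp n * hp i) := by ring
      _ ≤ (RatM.ofNat (graphNum g n) + 1) * RatM.ofNat (M.pow2 ⬝ i) * (hp n * hp i) := a2
      _ = _ := by linear_combination (RatM.ofNat (graphNum g n) + 1) * hp n * e

theorem isReal_graphReal_and (g : M.Fn) : IsReal (graphReal g) ∧
    ∀ n, approx (graphReal g) n = dyFrac (graphNum g n) 0 n := by
  refine isReal_of_codes (fun n => lam_app (by fun_prop) n) (fun n => den_dyFrac _ _ _)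
    fun n i => ?_
  obtain ⟨h1, h2⟩ := graphReal_bounds_rat g n i
  have := hp_pos (n + i)
  rw [abs_le]
  constructor <;> linarith

theorem isReal_graphReal (g : M.Fn) : IsReal (graphReal g) := (isReal_graphReal_and g).1

theorem graphReal_ge (g : M.Fn) (n : M.N) :
    ofRat M (dyFrac (graphNum g n) 0 n).toRat ≤ val (graphReal g) := by
  rw [← lim_const, val, lim_le (isCauchySeqM_const _) (isReal_graphReal g).isCauchy]
  intro k
  refine ⟨n, ?_⟩
  rintro _ ⟨i, rfl⟩
  rw [(isReal_graphReal_and g).2]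
  linarith [(graphReal_bounds_rat g n i).1, hp_pos k]

theorem graphReal_le (g : M.Fn) (n : M.N) :
    val (graphReal g) ≤ ofRat M ((dyFrac (graphNum g n) 0 n).toRat + hp n) := by
  rw [← lim_const, val, lim_le (isReal_graphReal g).isCauchy (isCauchySeqM_const _)]
  intro k
  refine ⟨n, ?_⟩
  rintro _ ⟨i, rfl⟩
  rw [(isReal_graphReal_and g).2]
  linarith [(graphReal_bounds_rat g n i).2, hp_pos k, hp_pos (n + i)]

/-- Some digit from position `n` on is `0`, so the right end of the dyadic interval is not reached.
Strictness ensures that the digits of the real are the prescribed ones. -/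
theorem graphReal_lt (g : M.Fn) (n : M.N) :
    val (graphReal g) < ofRat M ((dyFrac (graphNum g n) 0 n).toRat + hp n) := by
  obtain ⟨i, hi⟩ := exists_graphBit_eq_zero g n
  refine (graphReal_le g (n + i + 1)).trans_lt (ofRat_lt.2 ?_)
  have h1 := (graphReal_bounds_rat g n i).2
  have e := hp_succ_add (n + i)
  have h2 : (dyFrac (graphNum g (n + i + 1)) 0 (n + i + 1)).toRat =
      (dyFrac (graphNum g (n + i)) 0 (n + i)).toRat := by
    rw [toRat_dyFrac, toRat_dyFrac, graphNum_succ, hi, add_zero, map_add, map_zero, ← e]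
    ring
  rw [h2]
  linarith [hp_pos (n + i + 1)]

/-- A number `a` with `a ≤ 2ʲ⁺¹ x < a + 1` is unique, so it is `graphNum g (j + 1)`, whose parity is
the bit number `j`. -/
theorem hasDigit_graphReal (g : M.Fn) (j : M.N) :
    HasDigit (graphReal g) j ↔ graphBit g j = 1 := by
  rw [hasDigit_iff (isReal_graphReal g)]
  have h1 := graphReal_ge g (j + 1)
  have h2 := graphReal_lt g (j + 1)
  have e : ∀ a : M.N, (dyFrac (a + 1) 0 (j + 1)).toRat = (dyFrac a 0 (j + 1)).toRat + hp (j + 1) := by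
    intro a
    rw [toRat_dyFrac, toRat_dyFrac, map_add, map_one]
    ring
  have mono : ∀ {a b : M.N}, (dyFrac a 0 (j + 1)).toRat < (dyFrac b 0 (j + 1)).toRat → a < b := by
    intro a b h
    rw [toRat_dyFrac, toRat_dyFrac, map_zero, sub_zero, sub_zero] at h
    exact RatM.ofNat_lt.1 (lt_of_mul_lt_mul_right h (hp_pos _).le)
  rw [← e] at h2
  constructor
  · rintro ⟨a, h3, h4⟩
    have h5 := lt_add_one_iff'.1 (mono (ofRat_lt.1 (h3.trans_lt h2)))
    have h6 := lt_add_one_iff'.1 (mono (ofRat_lt.1 (h1.trans_lt h4)))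
    have h7 := le_antisymm h6 h5
    rw [graphNum_succ] at h7
    rcases graphBit_eq g j with h | h
    · rw [h, add_zero] at h7
      exact absurd h7 (add_self_ne_add_self_add_one _ _)
    · exact h
  · intro h
    rw [graphNum_succ, h] at h1 h2
    exact ⟨_, h1, h2⟩

/-- The function whose graph is coded by the digits of `x`. -/
def decode (x : M.Fn) : M.Fn := lam fun m => mu fun v => HasDigit x (M.pair m v)

@[fun_prop]
theorem Rep.decode {x : C → M.Fn} (hx : Rep x) : Rep fun c => decode (x c) := by
  unfold FinTypeStructure.decode
  fun_prop

theorem decode_graphReal (g : M.Fn) : decode (graphReal g) = g := by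
  refine lam_eq fun m => ?_
  have h := mu_spec (A := fun v => HasDigit (graphReal g) (M.pair m v)) (by fun_prop)
    ⟨g ⬝ m, (hasDigit_graphReal g _).2 ((graphBit_pair g m _).2 rfl)⟩
  exact ((graphBit_pair g m _).1 ((hasDigit_graphReal g _).1 h)).symm

/-- The function whose graph is coded by the digits of `z`. -/
def decodeVal (z : M.RealM) : M.Fn := lam fun m => mu fun v => DigitOne z (M.pair m v)

theorem decode_eq {x : M.Fn} (hx : IsReal x) : decode x = decodeVal (val x) := by
  unfold decode decodeVal
  simp only [hasDigit_iff hx]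

end Digits

end FinTypeStructure

namespace FinTypeStructure

noncomputable section Witness

variable {M : FinTypeStructure.{u}} [hM : Fact M.IsModelACA]
variable {C : Type u} [Ctx C M] {σ τ : FinType}

open RealM

/-! ### The function that codes a functional -/

variable (Y : M.Obj (FinType.one ⇾ FinType.zero ⇾ FinType.zero))

/-- Some dyadic translate of `x ∈ (2⁻ⁿ⁻¹, 2⁻ⁿ)` codes some `g` with `Y(g, n) = 0`. -/
def Codes (x : M.Fn) : Prop :=
  ∃ n : M.N, (RLt (Frac.invPow2 (n + 1)).toReal x ∧ RLt x (Frac.invPow2 n).toReal) ∧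
    -- Totality of the decoded graph; this clause is what excludes dyadic rationals. It is phrased
    -- with `∃` and `¬`, which `fun_prop` can handle for `Dec`.
    ∃ a b k, (¬ ∃ m, ¬ ∃ v, HasDigit (shift x (dyFrac a b k)) (M.pair m v)) ∧
      Y ⬝ decode (shift x (dyFrac a b k)) ⬝ n = (0 : M.N)

/-- The property `Codes` of the value of a real. -/
def CodesVal (z : M.RealM) : Prop :=
  ∃ n : M.N, (tiny (n + 1) < z ∧ z < tiny n) ∧
    ∃ d, IsDyadic d ∧ (∀ m, ∃ v, DigitOne (z + d) (M.pair m v)) ∧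
      Y ⬝ decodeVal (z + d) ⬝ n = (0 : M.N)

@[fun_prop]
theorem Dec.codes {x : C → M.Fn} (hx : Rep x) : Dec fun c => Codes Y (x c) := by
  unfold Codes
  fun_prop

theorem val_invPow2 (n : M.N) : val (Frac.invPow2 n).toReal = tiny n := by
  rw [val_toReal (den_invPow2 n), toRat_invPow2, tiny]

theorem codes_iff {x : M.Fn} (hx : IsReal x) : Codes Y x ↔ CodesVal Y (val x) := by
  refine exists_congr fun n => and_congr ?_ ?_
  · rw [rLt_iff (isReal_toReal (den_invPow2 _)) hx, rLt_iff hx (isReal_toReal (den_invPow2 _)),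
      val_invPow2, val_invPow2]
  · have key : ∀ a b k, ((¬ ∃ m, ¬ ∃ v, HasDigit (shift x (dyFrac a b k)) (M.pair m v)) ∧
        Y ⬝ decode (shift x (dyFrac a b k)) ⬝ n = (0 : M.N)) ↔
        ((∀ m, ∃ v, DigitOne (val x + ofRat M (dyFrac a b k).toRat) (M.pair m v)) ∧
          Y ⬝ decodeVal (val x + ofRat M (dyFrac a b k).toRat) ⬝ n = (0 : M.N)) := by
      intro a b k
      have hs := isReal_shift hx (den_dyFrac a b k)
      simp only [hasDigit_iff hs, decode_eq hs, val_shift hx (den_dyFrac a b k), not_exists_not]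
    simp only [key]
    constructor
    · rintro ⟨a, b, k, h⟩
      exact ⟨_, ⟨a, b, k, rfl⟩, h⟩
    · rintro ⟨_, ⟨a, b, k, rfl⟩, h⟩
      exact ⟨a, b, k, h⟩

variable {Y}

theorem index_unique {z : M.RealM} {m n : M.N} (h1 : tiny (m + 1) < z ∧ z < tiny m)
    (h2 : tiny (n + 1) < z ∧ z < tiny n) : m = n := by
  have key : ∀ {m n : M.N}, tiny (m + 1) < z → z < tiny n → n ≤ m := by
    intro m n h1 h2
    by_contra h
    exact (tiny_anti (lt_iff_add_one_le'.1 (not_le.1 h))).not_gt (h1.trans h2)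
  exact le_antisymm (key h2.1 h1.2) (key h1.1 h2.2)

/-- The translate is again dyadic, so its digits vanish from some `k` on; totality at `m = k` would
need a digit `1` at a position `pair k v ≥ k`. -/
theorem IsDyadic.not_codesVal {z : M.RealM} (hz : IsDyadic z) : ¬ CodesVal Y z := by
  rintro ⟨n, -, d, hd, h, -⟩
  obtain ⟨k, hk⟩ := (hz.add hd).not_digitOne
  obtain ⟨v, hv⟩ := h k
  exact hk _ (le_pair_left k v) hv

/-- Since `z + c = (z + d) + (c - d)`, the existential quantifier over dyadic translations absorbs
`d`, provided the interval and hence `n` stay the same. -/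
theorem CodesVal.translate {z d : M.RealM} (h : CodesVal Y z) (hd : IsDyadic d) {n : M.N}
    (h1 : tiny (n + 1) < z ∧ z < tiny n) (h2 : tiny (n + 1) < z + d ∧ z + d < tiny n) :
    CodesVal Y (z + d) := by
  obtain ⟨m, hm, c, hc, h3, h4⟩ := h
  obtain rfl := index_unique h1 hm
  have e : z + d + (c - d) = z + c := by ring
  exact ⟨n, h2, c - d, hc.sub hd, by rwa [e], by rwa [e]⟩

/-- A positive real below `1` is in some interval `(2⁻ⁿ⁻¹, 2⁻ⁿ]`. -/
theorem exists_index {x : M.Fn} (hx : IsReal x) (h0 : 0 < val x) (h1 : val x < 1) :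
    ∃ n : M.N, tiny (n + 1) < val x ∧ val x ≤ tiny n := by
  have hd : Dec fun n => RLt (Frac.invPow2 n).toReal x := by fun_prop
  have key : ∀ n, RLt (Frac.invPow2 n).toReal x ↔ tiny n < val x := fun n => by
    rw [rLt_iff (isReal_toReal (den_invPow2 _)) hx, val_invPow2]
  obtain ⟨n, hn, hn'⟩ := exists_least hd (by
    obtain ⟨k, hk⟩ := exists_tiny_lt h0
    exact ⟨k, (key k).2 hk⟩)
  rcases eq_zero_or_add_one n with rfl | ⟨m, rfl⟩
  · rw [key, tiny_zero] at hn
    exact absurd hn h1.not_gt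
  · refine ⟨m, (key _).1 hn, not_lt.1 fun h => hn' m ?_ ((key m).2 h)⟩
    exact lt_add_one_iff'.2 le_rfl

/-- Membership in the coded set does not change under small dyadic translations. -/
theorem exists_codesVal_locally_invariant {x : M.Fn} (hx : IsReal x) :
    ∃ j : M.N, ∀ d, IsDyadic d → |d| < tiny j → (CodesVal Y (val x + d) ↔ CodesVal Y (val x)) := by
  by_cases hdy : IsDyadic (val x)
  · exact ⟨0, fun d hd _ => iff_of_false (hdy.add hd).not_codesVal hdy.not_codesVal⟩
  have ne : ∀ {z}, IsDyadic z → val x ≠ z := fun h h' => hdy (h' ▸ h)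
  rcases (ne isDyadic_zero).lt_or_gt with h0 | h0
  · obtain ⟨j, hj⟩ := exists_add_tiny_lt h0
    refine ⟨j, fun d _ hd' => iff_of_false ?_ ?_⟩
    · rintro ⟨n, ⟨h, -⟩, -⟩
      linarith [tiny_pos (n + 1), (abs_lt.1 hd').2]
    · rintro ⟨n, ⟨h, -⟩, -⟩
      linarith [tiny_pos (n + 1)]
  rcases (ne isDyadic_one).lt_or_gt with h1 | h1
  · obtain ⟨n, hn, hn'⟩ := exists_index hx h0 h1
    have hn' := lt_of_le_of_ne hn' (ne (isDyadic_tiny n))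
    obtain ⟨i, hi⟩ := exists_add_tiny_lt hn
    obtain ⟨j, hj⟩ := exists_add_tiny_lt hn'
    refine ⟨max i j, fun d hd hd' => ?_⟩
    have a1 := (abs_lt.1 hd').1
    have a2 := (abs_lt.1 hd').2
    have b1 := tiny_anti (le_max_left i j)
    have b2 := tiny_anti (le_max_right i j)
    have hxd : tiny (n + 1) < val x + d ∧ val x + d < tiny n := by
      constructor <;> linarith
    refine ⟨fun h => ?_, fun h => h.translate hd ⟨hn, hn'⟩ hxd⟩
    have := h.translate hd.neg hxd (by rw [add_neg_cancel_right]; exact ⟨hn, hn'⟩)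
    rwa [add_neg_cancel_right] at this
  · obtain ⟨j, hj⟩ := exists_add_tiny_lt h1
    have key : ∀ n : M.N, tiny n ≤ 1 := fun n => by
      rw [← tiny_zero]
      exact tiny_anti (zero_le' n)
    refine ⟨j, fun d _ hd' => iff_of_false ?_ ?_⟩
    · rintro ⟨n, ⟨-, h⟩, -⟩
      linarith [key n, (abs_lt.1 hd').1]
    · rintro ⟨n, ⟨-, h⟩, -⟩
      linarith [key n]

/-- Dyadic translates of a real are dense. -/
theorem exists_translate_near {x y : M.Fn} (hx : IsReal x) (hy : IsReal y) (k : M.N) :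
    ∃ r : M.Frac, r.den ≠ 0 ∧ IsDyadic (ofRat M r.toRat) ∧
      |val x + ofRat M r.toRat - val y| < tiny k := by
  obtain ⟨a, b, i, h1⟩ := hx.exists_dyadic (k + 1)
  obtain ⟨c, d, j, h2⟩ := hy.exists_dyadic (k + 1)
  have da := den_dyFrac a b i
  have dc := den_dyFrac c d j
  refine ⟨dyFrac c d j - dyFrac a b i, den_sub dc da, ?_, ?_⟩
  · rw [toRat_sub dc da, map_sub]
    exact IsDyadic.sub ⟨_, _, _, rfl⟩ ⟨_, _, _, rfl⟩
  · rw [toRat_sub dc da, map_sub]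
    have h1 := abs_lt.1 h1
    have h2 := abs_lt.1 h2
    have e := tiny_succ_add k
    rw [abs_lt]
    constructor <;> linarith [h1.1, h1.2, h2.1, h2.2]

theorem CodesVal.exists_eq_zero {z : M.RealM} (h : CodesVal Y z) {n : M.N}
    (hz : tiny (n + 1) < z ∧ z < tiny n) : ∃ g : M.Fn, Y ⬝ g ⬝ n = (0 : M.N) := by
  obtain ⟨m, hm, d, -, -, h⟩ := h
  obtain rfl := index_unique hz hm
  exact ⟨_, h⟩

/-- If `Y(g, n) = 0`, then the coded set is dense in `(2⁻ⁿ⁻¹, 2⁻ⁿ)`. -/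
theorem exists_codesVal_near {g : M.Fn} {n : M.N} (hg : Y ⬝ g ⬝ n = (0 : M.N)) {y : M.Fn}
    (hy : IsReal y) (hyn : tiny (n + 1) < val y ∧ val y < tiny n) (k : M.N) :
    ∃ y', IsReal y' ∧ (tiny (n + 1) < val y' ∧ val y' < tiny n) ∧ |val y - val y'| < tiny k ∧
      CodesVal Y (val y') := by
  obtain ⟨i, hi⟩ := exists_add_tiny_lt hyn.1
  obtain ⟨j, hj⟩ := exists_add_tiny_lt hyn.2
  have hr := isReal_graphReal g
  -- A dyadic translate of `graphReal g` is moved close to `y`; translating back by `-r` recovers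
  -- `g`. The precision also keeps it in the interval.
  obtain ⟨r, hr1, hr2, hr3⟩ := exists_translate_near hr hy (max k (max i j))
  have b0 := tiny_anti (le_max_left k (max i j))
  have b1 := tiny_anti ((le_max_left i j).trans (le_max_right k _))
  have b2 := tiny_anti ((le_max_right i j).trans (le_max_right k _))
  have a1 := (abs_lt.1 hr3).1
  have a2 := (abs_lt.1 hr3).2
  refine ⟨shift (graphReal g) r, isReal_shift hr hr1, ?_, ?_, ?_⟩
  · rw [val_shift hr hr1]
    constructor <;> linarith
  · rw [val_shift hr hr1, abs_lt]
    constructor <;> linarith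
  · rw [val_shift hr hr1]
    refine ⟨n, ⟨by linarith, by linarith⟩, - ofRat M r.toRat, hr2.neg, ?_, ?_⟩
    · intro m
      rw [add_neg_cancel_right]
      exact ⟨g ⬝ m, (hasDigit_iff hr _).1
        ((hasDigit_graphReal g _).2 ((graphBit_pair g m _).2 rfl))⟩
    · rw [add_neg_cancel_right, ← decode_eq hr, decode_graphReal]
      exact hg

variable (Y)

open Classical in
/-- The characteristic function of the set of reals with the property `Codes`, as a function with
real values. -/
def codeFun : M.Obj (FinType.one ⇾ FinType.one) :=
  lam fun x => if Codes Y x then (1 : M.Frac).toReal else (0 : M.Frac).toReal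

variable {Y}

open Classical in
theorem codeFun_app (x : M.Fn) :
    codeFun Y ⬝ x = if Codes Y x then (1 : M.Frac).toReal else (0 : M.Frac).toReal :=
  lam_app (by fun_prop) x

theorem codeFun_eq_one {x : M.Fn} (hx : IsReal x) (h : CodesVal Y (val x)) :
    codeFun Y ⬝ x = (1 : M.Frac).toReal := by
  rw [codeFun_app, if_pos ((codes_iff Y hx).2 h)]

theorem codeFun_eq_zero {x : M.Fn} (hx : IsReal x) (h : ¬ CodesVal Y (val x)) :
    codeFun Y ⬝ x = (0 : M.Frac).toReal := by
  rw [codeFun_app, if_neg fun h' => h ((codes_iff Y hx).1 h')]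

theorem codeFun_congr {x y : M.Fn} (hx : IsReal x) (hy : IsReal y)
    (h : CodesVal Y (val x) ↔ CodesVal Y (val y)) : codeFun Y ⬝ x = codeFun Y ⬝ y := by
  by_cases h' : CodesVal Y (val x)
  · rw [codeFun_eq_one hx h', codeFun_eq_one hy (h.1 h')]
  · rw [codeFun_eq_zero hx h', codeFun_eq_zero hy (fun h'' => h' (h.2 h''))]

theorem codeFun_zero_or_one (x : M.Fn) :
    codeFun Y ⬝ x = (0 : M.Frac).toReal ∨ codeFun Y ⬝ x = (1 : M.Frac).toReal := by
  rw [codeFun_app]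
  split_ifs
  · exact Or.inr rfl
  · exact Or.inl rfl

theorem isReal_codeFun (x : M.Fn) : IsReal (codeFun Y ⬝ x) := by
  rcases codeFun_zero_or_one (Y := Y) x with h | h <;> rw [h]
  · exact isReal_toReal den_zero
  · exact isReal_toReal den_one

theorem val_zero : val (0 : M.Frac).toReal = 0 := by
  rw [val_toReal den_zero, toRat_zero, map_zero]

theorem val_one : val (1 : M.Frac).toReal = 1 := by
  rw [val_toReal den_one, toRat_one, map_one]

theorem isFun_codeFun (D : Dom) : IsFun D (codeFun Y) := by
  refine ⟨fun x _ => isReal_codeFun x, fun x y hx hy h => ?_⟩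
  rw [rEq_iff hx.isReal hy.isReal] at h
  rw [codeFun_congr hx.isReal hy.isReal (by rw [h]), rEq_iff (isReal_codeFun y) (isReal_codeFun y)]

theorem mapsToUnit_codeFun : MapsToUnit (codeFun Y) := by
  intro x _
  rw [mem_unit_iff]
  refine ⟨isReal_codeFun x, ?_⟩
  rcases codeFun_zero_or_one (Y := Y) x with h | h <;> rw [h]
  · rw [val_zero]
    exact ⟨le_rfl, zero_le_one⟩
  · rw [val_one]
    exact ⟨zero_le_one, le_rfl⟩

theorem mem_of_between {D : Dom} {x y z : M.Fn} (hx : D.Mem x) (hz : D.Mem z) (hy : IsReal y)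
    (h1 : val x ≤ val y) (h2 : val y ≤ val z) : D.Mem y := by
  cases D
  · exact hy
  · rw [mem_unit_iff] at *
    exact ⟨hy, hx.2.1.trans h1, h2.trans hz.2.2⟩

theorem mem_of_unit {D : Dom} {x : M.Fn} (hx : IsReal x) (h0 : 0 ≤ val x) (h1 : val x ≤ 1) :
    D.Mem x := by
  cases D
  · exact hx
  · exact mem_unit_iff.2 ⟨hx, h0, h1⟩

theorem mem_of_index {D : Dom} {x : M.Fn} (hx : IsReal x) {n : M.N}
    (h : tiny (n + 1) < val x ∧ val x < tiny n) : D.Mem x := by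
  refine mem_of_unit hx ((tiny_pos _).trans h.1).le (h.2.le.trans ?_)
  rw [← tiny_zero]
  exact tiny_anti (zero_le' n)

/-- Dyadic rationals are dense in the domain. -/
theorem exists_dyadic_mem_near {D : Dom} {y : M.Fn} (hy : D.Mem y) (k : M.N) :
    ∃ y', D.Mem y' ∧ IsDyadic (val y') ∧ |val y - val y'| < tiny k := by
  by_cases hdy : IsDyadic (val y)
  · exact ⟨y, hy, hdy, by simpa using tiny_pos k⟩
  have key : ∀ i, ∃ y', IsReal y' ∧ IsDyadic (val y') ∧ |val y - val y'| < tiny i := by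
    intro i
    obtain ⟨a, b, j, h⟩ := hy.isReal.exists_dyadic i
    have h' := den_dyFrac a b j
    refine ⟨(dyFrac a b j).toReal, isReal_toReal h', ?_, ?_⟩
    · rw [val_toReal h']
      exact ⟨_, _, _, rfl⟩
    · rwa [val_toReal h']
  cases D
  · exact key k
  · rw [mem_unit_iff] at hy
    have ne : ∀ {z}, IsDyadic z → val y ≠ z := fun h h' => hdy (h' ▸ h)
    obtain ⟨i, hi⟩ := exists_add_tiny_lt (lt_of_le_of_ne hy.2.1 (ne isDyadic_zero).symm)
    obtain ⟨j, hj⟩ := exists_add_tiny_lt (lt_of_le_of_ne hy.2.2 (ne isDyadic_one))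
    obtain ⟨y', h1, h2, h3⟩ := key (max k (max i j))
    have b0 := tiny_anti (le_max_left k (max i j))
    have b1 := tiny_anti ((le_max_left i j).trans (le_max_right k _))
    have b2 := tiny_anti ((le_max_right i j).trans (le_max_right k _))
    have a1 := (abs_lt.1 h3).1
    have a2 := (abs_lt.1 h3).2
    refine ⟨y', mem_unit_iff.2 ⟨h1, by linarith, by linarith⟩, h2, h3.trans_le b0⟩

theorem exists_codeFun_zero_near {D : Dom} {y : M.Fn} (hy : D.Mem y) (k : M.N) :
    ∃ y', D.Mem y' ∧ codeFun Y ⬝ y' = (0 : M.Frac).toReal ∧ |val y - val y'| < tiny k := by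
  obtain ⟨y', h1, h2, h3⟩ := exists_dyadic_mem_near hy k
  exact ⟨y', h1, codeFun_eq_zero h1.isReal h2.not_codesVal, h3⟩

/-- The fibres of `codeFun` are dense in a neighbourhood of each of their points. -/
theorem exists_codeFun_fiber_dense {D : Dom} {x : M.Fn} (hx : D.Mem x) :
    ∃ k : M.N, ∀ y, D.Mem y → |val x - val y| < tiny k → ∀ l : M.N,
      ∃ y', D.Mem y' ∧ codeFun Y ⬝ y' = codeFun Y ⬝ x ∧ |val y - val y'| < tiny l := by
  by_cases h : CodesVal Y (val x)
  · obtain ⟨n, hn, -⟩ := id h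
    obtain ⟨g, hg⟩ := h.exists_eq_zero hn
    obtain ⟨i, hi⟩ := exists_add_tiny_lt hn.1
    obtain ⟨j, hj⟩ := exists_add_tiny_lt hn.2
    refine ⟨max i j, fun y hy hxy l => ?_⟩
    have a1 := (abs_lt.1 hxy).1
    have a2 := (abs_lt.1 hxy).2
    have b1 := tiny_anti (le_max_left i j)
    have b2 := tiny_anti (le_max_right i j)
    obtain ⟨y', h1, h2, h3, h4⟩ := exists_codesVal_near hg hy.isReal
      ⟨by linarith, by linarith⟩ l
    refine ⟨y', mem_of_index h1 h2, ?_, h3⟩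
    rw [codeFun_eq_one h1 h4, codeFun_eq_one hx.isReal h]
  · rw [codeFun_eq_zero hx.isReal h]
    exact ⟨0, fun y hy _ l => exists_codeFun_zero_near hy l⟩

/-- `codeFun` is invariant under small dyadic translations. -/
theorem exists_codeFun_locally_invariant (Y : M.Obj (FinType.one ⇾ FinType.zero ⇾ FinType.zero))
    {x : M.Fn} (hx : IsReal x) :
    ∃ j : M.N, ∀ y, IsReal y → IsDyadic (val y - val x) → |val y - val x| < tiny j →
      codeFun Y ⬝ y = codeFun Y ⬝ x := by
  obtain ⟨j, hj⟩ := exists_codesVal_locally_invariant (Y := Y) hx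
  refine ⟨j, fun y hy h1 h2 => codeFun_congr hy hx ?_⟩
  have := hj _ h1 h2
  rwa [add_sub_cancel] at this

end Witness

end FinTypeStructure

namespace FinTypeStructure

noncomputable section WeakContinuity

variable {M : FinTypeStructure.{u}} [hM : Fact M.IsModelACA]
variable {Y : M.Obj (FinType.one ⇾ FinType.zero ⇾ FinType.zero)} {D : Dom}

open RealM

/-! ### Weak continuity of the coding function -/

/-- The zeros are dense, so the closure of the graph contains the graph of the zero function. -/
theorem graphContinuous_codeFun : GraphContinuous D (codeFun Y) := by
  let g : M.Obj (FinType.one ⇾ FinType.one) := lam fun _ : M.Fn => (0 : M.Frac).toReal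
  have hg : ∀ x, g ⬝ x = (0 : M.Frac).toReal := fun x => lam_app (by fun_prop) x
  have h0 : IsReal (0 : M.Frac).toReal := isReal_toReal den_zero
  refine ⟨g, ⟨fun x _ => by rwa [hg], fun x y _ _ _ => ?_⟩, fun x _ k => ⟨0, fun y _ _ => ?_⟩,
    fun x hx k => ?_⟩
  · rw [hg, hg, rEq_iff h0 h0]
  · rw [hg, hg, near_iff h0 h0, sub_self, abs_zero]
    exact tiny_pos k
  · obtain ⟨y, h1, h2, h3⟩ := exists_codeFun_zero_near (Y := Y) hx k
    refine ⟨y, h1, (near_iff hx.isReal h1.isReal).2 h3, ?_⟩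
    rw [hg, h2, near_iff h0 h0, sub_self, abs_zero]
    exact tiny_pos k

/-- The fibre through `x` is dense near `x` and lies in the preimage of every `G` containing the
value at `x`. Husain, pre- and `𝒞`-continuity all come from this. -/
theorem interior_closure_preimage {x : M.Fn} (hx : D.Mem x)
    {G : M.Obj (FinType.one ⇾ FinType.zero)} (hG : carrier Dom.line G (codeFun Y ⬝ x)) :
    interior D (closure D (preimage D (codeFun Y) G)) x := by
  obtain ⟨k, hk⟩ := exists_codeFun_fiber_dense (Y := Y) hx
  refine ⟨hx, k, fun y hy hxy => ⟨hy, fun l => ?_⟩⟩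
  obtain ⟨y', h1, h2, h3⟩ := hk y hy ((near_iff hx.isReal hy.isReal).1 hxy) l
  exact ⟨y', h1, ⟨h1, by rwa [h2]⟩, (near_iff hy.isReal h1.isReal).2 h3⟩

theorem almostContinuousHusain_codeFun : AlmostContinuousHusain D (codeFun Y) :=
  fun _ hx _ _ hG => interior_closure_preimage hx hG

theorem preContinuous_codeFun : PreContinuous D (codeFun Y) :=
  fun _ _ _ hx => interior_closure_preimage hx.1 hx.2

theorem isOpenSet_univ : IsOpenSet D (lam fun _ : M.Fn => (1 : M.N)) := by
  have h : ∀ x : M.Fn, (lam fun _ : M.Fn => (1 : M.N)) ⬝ x = (1 : M.N) :=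
    fun x => lam_app (by fun_prop) x
  refine ⟨⟨fun x _ => Or.inr (h x), fun x y _ _ _ => by rw [h, h]⟩, fun x hx => ?_⟩
  exact ⟨hx.1, 0, fun y hy _ => ⟨hy, h y⟩⟩

/-- The preimage is itself pre-open and has a characteristic function in the structure, namely that
of `G` composed with `codeFun Y`; the open factor is all of `D`. -/
theorem cContinuous_codeFun : CContinuous D (codeFun Y) := by
  intro G hG
  let A : M.Obj (FinType.one ⇾ FinType.zero) := lam fun x : M.Fn => G ⬝ (codeFun Y ⬝ x)
  have hA : ∀ x, A ⬝ x = G ⬝ (codeFun Y ⬝ x) := fun x => lam_app (by fun_prop) x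
  have hO : ∀ x : M.Fn, (lam fun _ : M.Fn => (1 : M.N)) ⬝ x = (1 : M.N) :=
    fun x => lam_app (by fun_prop) x
  have hpre : ∀ x, carrier D A x ↔ preimage D (codeFun Y) G x := fun x => by
    rw [carrier, hA]
    exact ⟨fun h => ⟨h.1, isReal_codeFun x, h.2⟩, fun h => ⟨h.1, h.2.2⟩⟩
  have hpre' : carrier D A = preimage D (codeFun Y) G := funext fun x => propext (hpre x)
  refine ⟨_, A, isOpenSet_univ, ⟨fun x _ => ?_, fun x y hx hy h => ?_⟩, ?_, fun x => ?_⟩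
  · rw [hA]
    exact hG.1.1 _ (isReal_codeFun x)
  · rw [hA, hA]
    exact hG.1.2 _ _ (isReal_codeFun x) (isReal_codeFun y) ((isFun_codeFun D).2 x y hx hy h)
  · rw [hpre']
    exact preContinuous_codeFun G hG
  · rw [hpre]
    exact ⟨fun h => ⟨⟨h.1, hO x⟩, h⟩, fun h => h.2⟩

theorem exists_translate {x : M.Fn} (hx : IsReal x) (k : M.N) :
    ∃ y, IsReal y ∧ val y = val x + tiny k :=
  ⟨shift x (Frac.invPow2 k), isReal_shift hx (den_invPow2 k), by
    rw [val_shift hx (den_invPow2 k), toRat_invPow2, tiny]⟩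

/-- Only `0` and `1` have non-empty fibres, and a non-empty open `V` contains some other point. -/
theorem not_cesaroType_codeFun : ¬ CesaroType D (codeFun Y) := by
  rintro ⟨U, V, -, hV, ⟨x, hx⟩, ⟨y, hy⟩, h⟩
  have key : ∀ y, carrier Dom.line V y → val y ≠ 0 → val y ≠ 1 → False := by
    intro y hy h0 h1
    obtain ⟨-, hcl⟩ := h y hy x hx
    obtain ⟨z, -, ⟨-, hz⟩, -⟩ := hcl 0
    rw [rEq_iff (isReal_codeFun z) hy.1] at hz
    rcases codeFun_zero_or_one (Y := Y) z with h | h <;> rw [h] at hz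
    · exact h0 (hz.symm.trans val_zero)
    · exact h1 (hz.symm.trans val_one)
  obtain ⟨-, k, hk⟩ := hV.2 y hy
  have hyr : IsReal y := hy.1
  have mem : ∀ i, k < i → ∃ z, carrier Dom.line V z ∧ val z = val y + tiny i := by
    intro i hi
    obtain ⟨z, hz, hz'⟩ := exists_translate hyr i
    refine ⟨z, hk z hz ((near_iff hyr hz).2 ?_), hz'⟩
    rw [hz', sub_add_cancel_left, abs_neg, abs_of_pos (tiny_pos i)]
    exact tiny_lt hi
  have lt_succ : ∀ n : M.N, n < n + 1 := fun n => lt_add_one_iff'.2 le_rfl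
  obtain ⟨z, hz, hz'⟩ := mem (k + 1) (lt_succ k)
  obtain ⟨w, hw, hw'⟩ := mem (k + 1 + 1) ((lt_succ k).trans (lt_succ _))
  have t1 := tiny_pos (k + 1 + 1)
  have t2 := tiny_lt (lt_succ (k + 1))
  -- Among the points `y < w < z` of `V`, if `y` and `w` are both in `{0, 1}`, then `y = 0` and `w =
  -- 1`, so `z > 1`.
  by_cases y0 : val y = 0 ∨ val y = 1
  · by_cases w0 : val w = 0 ∨ val w = 1
    · refine key z hz (fun h => ?_) fun h => ?_ <;> rcases y0 with y0 | y0 <;>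
        rcases w0 with w0 | w0 <;> linarith
    · push Not at w0
      exact key w hw w0.1 w0.2
  · push Not at y0
    exact key y hy y0.1 y0.2

theorem seqTendsto_of_abs_le {u : M.Obj (FinType.zero ⇾ FinType.one)} {x : M.Fn} (hx : IsReal x)
    (hu : ∀ n : M.N, IsReal (u ⬝ n)) (h : ∀ n : M.N, |val (u ⬝ n) - val x| ≤ tiny n) :
    SeqTendsto u x := by
  intro k
  refine ⟨k + 1, fun n hn => (near_iff (hu n) hx).2 ((h n).trans_lt (tiny_lt ?_))⟩
  exact lt_iff_add_one_le'.2 hn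

theorem seqTendsto_const {u : M.Obj (FinType.zero ⇾ FinType.one)} {x : M.Fn} (hx : IsReal x)
    (h : ∀ n : M.N, u ⬝ n = x) : SeqTendsto u x :=
  seqTendsto_of_abs_le hx (fun n => by rwa [h]) fun n => by simpa [h] using (tiny_pos n).le

/-- Approach `x` by dyadic translates `x ∓ 2⁻ʳ`: by local dyadic invariance the function is constant
along these sequences. -/
theorem youngCondition_codeFun : YoungCondition D (codeFun Y) := by
  intro x hx
  have hxr := hx.isReal
  obtain ⟨j, hj⟩ := exists_codeFun_locally_invariant Y hxr
  have key : ∀ (s : M.N → M.Frac), Rep s → (∀ n, (s n).den ≠ 0) →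
      (∀ n, IsDyadic (ofRat M (s n).toRat)) → (∀ n, |ofRat M (s n).toRat| < tiny j) →
      (∀ n, |ofRat M (s n).toRat| ≤ tiny n) → ∃ u v : M.Obj (FinType.zero ⇾ FinType.one),
        (∀ n : M.N, u ⬝ n = shift x (s n) ∧ v ⬝ n = codeFun Y ⬝ (u ⬝ n)) ∧
          SeqTendsto u x ∧ SeqTendsto v (codeFun Y ⬝ x) := by
    intro s hs hd h1 h2 h3
    have hu : ∀ n, (lam fun n : M.N => shift x (s n)) ⬝ n = shift x (s n) :=
      fun n => lam_app (by fun_prop) n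
    have hv : ∀ n, (lam fun n : M.N => codeFun Y ⬝ shift x (s n)) ⬝ n =
      codeFun Y ⬝ shift x (s n) := fun n => lam_app (by fun_prop) n
    refine ⟨lam fun n => shift x (s n), lam fun n => codeFun Y ⬝ shift x (s n),
      fun n => ⟨hu n, by rw [hu, hv]⟩, seqTendsto_of_abs_le hxr (fun n => ?_) (fun n => ?_),
      seqTendsto_const (isReal_codeFun x) fun n => ?_⟩
    · rw [hu]
      exact isReal_shift hxr (hd n)
    · rw [hu, val_shift hxr (hd n), add_sub_cancel_left]
      exact h3 n
    · rw [hv]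
      refine hj _ (isReal_shift hxr (hd n)) ?_ ?_ <;> rw [val_shift hxr (hd n), add_sub_cancel_left]
      · exact h1 n
      · exact h2 n
  have small : ∀ i n : M.N, tiny (i + n + 1) < tiny i ∧ tiny (i + n + 1) ≤ tiny n := fun i n =>
    ⟨tiny_lt (lt_add_one_iff'.2 le_self_add), tiny_anti (by
      rw [add_right_comm]
      exact le_add_self)⟩
  have tl : ∀ n : M.N, ofRat M (Frac.invPow2 n).toRat = tiny n := fun n => by
    rw [toRat_invPow2, tiny]
  have tr : ∀ n : M.N, ofRat M (-Frac.invPow2 n).toRat = -tiny n := fun n => by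
    rw [toRat_neg (den_invPow2 n), map_neg, tl]
  constructor
  · rintro ⟨y, hy, hyx⟩
    obtain ⟨i, hi⟩ := exists_add_tiny_lt ((rLt_iff hy.isReal hxr).1 hyx)
    -- In the exponent, `i` keeps the points inside `D`, `j` keeps them in the range of invariance,
    -- and `n` gives convergence.
    obtain ⟨u, v, h, h1, h2⟩ := key (fun n => -Frac.invPow2 (max i j + n + 1)) (by fun_prop)
      (fun n => den_neg (den_invPow2 _)) (fun n => by
        rw [tr]
        exact (isDyadic_tiny _).neg) (fun n => by
        rw [tr, abs_neg, abs_of_pos (tiny_pos _)]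
        exact (small _ n).1.trans_le (tiny_anti (le_max_right i j))) (fun n => by
        rw [tr, abs_neg, abs_of_pos (tiny_pos _)]
        exact (small _ n).2)
    refine ⟨u, v, fun n => ?_, h1, h2⟩
    have hs := isReal_shift hxr (den_neg (den_invPow2 (max i j + n + 1)))
    have hval := val_shift hxr (den_neg (den_invPow2 (max i j + n + 1)))
    rw [tr] at hval
    have a1 := (small (max i j) n).1.trans_le (tiny_anti (le_max_left i j))
    have a2 := tiny_pos (max i j + n + 1)
    refine ⟨?_, ?_, (h n).2⟩ <;> rw [(h n).1]
    · exact mem_of_between hy hx hs (by linarith) (by linarith)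
    · rw [rLt_iff hs hxr]
      linarith
  · rintro ⟨y, hy, hyx⟩
    obtain ⟨i, hi⟩ := exists_add_tiny_lt ((rLt_iff hxr hy.isReal).1 hyx)
    obtain ⟨u, v, h, h1, h2⟩ := key (fun n => Frac.invPow2 (max i j + n + 1)) (by fun_prop)
      (fun n => den_invPow2 _) (fun n => by
        rw [tl]
        exact isDyadic_tiny _) (fun n => by
        rw [tl, abs_of_pos (tiny_pos _)]
        exact (small _ n).1.trans_le (tiny_anti (le_max_right i j))) (fun n => by
        rw [tl, abs_of_pos (tiny_pos _)]
        exact (small _ n).2)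
    refine ⟨u, v, fun n => ?_, h1, h2⟩
    have hs := isReal_shift hxr (den_invPow2 (max i j + n + 1))
    have hval := val_shift hxr (den_invPow2 (max i j + n + 1))
    rw [tl] at hval
    have a1 := (small (max i j) n).1.trans_le (tiny_anti (le_max_left i j))
    have a2 := tiny_pos (max i j + n + 1)
    refine ⟨?_, ?_, (h n).2⟩ <;> rw [(h n).1]
    · exact mem_of_between hx hy hs (by linarith) (by linarith)
    · rw [rLt_iff hxr hs]
      linarith

open Classical in
/-- Open intervals are open sets. -/
theorem exists_interval (D : Dom) {a b : M.Fn} (ha : IsReal a) (hb : IsReal b) :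
    ∃ W : M.Obj (FinType.one ⇾ FinType.zero), IsOpenSet D W ∧
      ∀ y, carrier D W y ↔ D.Mem y ∧ val a < val y ∧ val y < val b := by
  let W : M.Obj (FinType.one ⇾ FinType.zero) :=
    lam fun y : M.Fn => if RLt a y ∧ RLt y b then (1 : M.N) else 0
  have hW : ∀ y, W ⬝ y = if RLt a y ∧ RLt y b then (1 : M.N) else 0 :=
    fun y => lam_app (by fun_prop) y
  have key : ∀ y, D.Mem y → (W ⬝ y = if val a < val y ∧ val y < val b then (1 : M.N) else 0) := by
    intro y hy
    exact (hW y).trans (if_congr (and_congr (rLt_iff ha hy.isReal) (rLt_iff hy.isReal hb)) rfl rfl)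
  have hc : ∀ y, carrier D W y ↔ D.Mem y ∧ val a < val y ∧ val y < val b := by
    refine fun y => and_congr_right fun hy => ?_
    rw [key y hy]
    split_ifs with h
    · exact iff_of_true rfl h
    · exact iff_of_false zero_ne_one h
  refine ⟨W, ⟨⟨fun x hx => ?_, fun x y hx hy h => ?_⟩, fun x hx => ?_⟩, hc⟩
  · rw [key x hx]
    split_ifs
    · exact Or.inr rfl
    · exact Or.inl rfl
  · rw [rEq_iff hx.isReal hy.isReal] at h
    rw [key x hx, key y hy, h]
  · obtain ⟨hx, h1, h2⟩ := (hc x).1 hx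
    obtain ⟨i, hi⟩ := exists_add_tiny_lt h1
    obtain ⟨j, hj⟩ := exists_add_tiny_lt h2
    refine ⟨hx, max i j, fun y hy hxy => (hc y).2 ⟨hy, ?_⟩⟩
    have h := abs_lt.1 ((near_iff hx.isReal hy.isReal).1 hxy)
    have b1 := tiny_anti (le_max_left i j)
    have b2 := tiny_anti (le_max_right i j)
    constructor <;> linarith [h.1, h.2]

/-- For `W = (x - 2⁻ⁿ, x + 2⁻ⁿ)` in `D`, boundary points can only be `x ± 2⁻ⁿ`. These are small
dyadic translates of `x`, so the function has the same value there as at `x`. -/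
theorem peripherallyContinuous_codeFun : PeripherallyContinuous D (codeFun Y) := by
  intro x hx a b c d ha hb _ _ hax hxb hc hd
  have hxr := hx.isReal
  rw [rLt_iff ha hxr] at hax
  rw [rLt_iff hxr hb] at hxb
  obtain ⟨i, hi⟩ := exists_codeFun_locally_invariant Y hxr
  obtain ⟨j, hj⟩ := exists_add_tiny_lt hax
  obtain ⟨k, hk⟩ := exists_add_tiny_lt hxb
  obtain ⟨n, hn, b1, b2⟩ : ∃ n : M.N, tiny n < tiny i ∧ tiny n ≤ tiny j ∧ tiny n ≤ tiny k :=
    ⟨max (i + 1) (max j k),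
      (tiny_anti (le_max_left _ _)).trans_lt (tiny_lt (lt_add_one_iff'.2 le_rfl)),
      tiny_anti ((le_max_left j k).trans (le_max_right _ _)),
      tiny_anti ((le_max_right j k).trans (le_max_right _ _))⟩
  have t := tiny_pos n
  have dl := den_neg (den_invPow2 (M := M) n)
  have dr := den_invPow2 (M := M) n
  have vl := val_shift hxr dl
  have vr := val_shift hxr dr
  rw [toRat_neg dr, map_neg, toRat_invPow2] at vl
  rw [toRat_invPow2] at vr
  change _ = _ + -tiny n at vl
  change _ = _ + tiny n at vr
  obtain ⟨W, hW, hW'⟩ := exists_interval D (isReal_shift hxr dl) (isReal_shift hxr dr)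
  rw [vl, vr] at hW'
  refine ⟨W, hW, (hW' x).2 ⟨hx, by linarith, by linarith⟩, fun y hy => ?_, fun y hy => ?_⟩
  · obtain ⟨hy, h1, h2⟩ := (hW' y).1 hy
    rw [rLt_iff ha hy.isReal, rLt_iff hy.isReal hb]
    constructor <;> linarith
  · obtain ⟨⟨hyD, hcl⟩, hint⟩ := hy
    have hy' : ¬ carrier D W y := fun h => hint (hW.2 y h)
    have bound : |val y - val x| ≤ tiny n := by
      refine le_of_forall_tiny fun l => ?_
      obtain ⟨z, hz, hzW, hyz⟩ := hcl l
      obtain ⟨-, h1, h2⟩ := (hW' z).1 hzW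
      have h3 := abs_lt.1 ((near_iff hyD.isReal hz.isReal).1 hyz)
      rw [abs_le]
      constructor <;> linarith [h3.1, h3.2]
    have hdy : IsDyadic (val y - val x) := by
      have bound' := abs_le.1 bound
      rcases bound'.1.lt_or_eq with h | h
      · rcases bound'.2.lt_or_eq with h' | h'
        · exact absurd ((hW' y).2 ⟨hyD, by linarith, by linarith⟩) hy'
        · rw [h']
          exact isDyadic_tiny n
      · rw [← h]
        exact (isDyadic_tiny n).neg
    rw [hi y hyD.isReal hdy (bound.trans_lt hn)]
    exact ⟨hc, hd⟩

theorem holds_codeFun (Γ : WeakNotion) : Γ.Holds D (codeFun Y) := by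
  cases Γ
  · exact youngCondition_codeFun
  · exact almostContinuousHusain_codeFun
  · exact graphContinuous_codeFun
  · exact not_cesaroType_codeFun
  · exact peripherallyContinuous_codeFun
  · exact preContinuous_codeFun
  · exact cContinuous_codeFun

end WeakContinuity

end FinTypeStructure

namespace FinTypeStructure

noncomputable section Integrals

variable {M : FinTypeStructure.{u}} [hM : Fact M.IsModelACA]
variable {Y : M.Obj (FinType.one ⇾ FinType.zero ⇾ FinType.zero)}

open RealM

/-! ### Riemann sums of the coding function -/

/-- The values of `codeFun` are literally the constant sequences `0` and `1`, so a step of a Riemann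
sum is computed without a general product of reals. -/
theorem isLimit_step_zero {s z a b : M.Fn} (hs : IsReal s) (hz : IsReal z) :
    IsLimit (fun m => approx s m + approx (0 : M.Frac).toReal m * (approx a m - approx b m)) z ↔
      val z = val s := by
  have hd : ∀ m, (approx s m + approx (0 : M.Frac).toReal m * (approx a m - approx b m)).den ≠ 0 :=
    fun m => den_add (den_approx _ _)
      (den_mul (den_approx _ _) (den_sub (den_approx _ _) (den_approx _ _)))
  have e : (fun m => (approx s m + approx (0 : M.Frac).toReal m *
      (approx a m - approx b m)).toRat) = fun m => (approx s m).toRat := by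
    funext m
    rw [toRat_add (den_approx _ _)
      (den_mul (den_approx _ _) (den_sub (den_approx _ _) (den_approx _ _))),
      toRat_mul (den_approx _ _) (den_sub (den_approx _ _) (den_approx _ _)),
      approx_toReal den_zero, toRat_zero, zero_mul, add_zero]
  rw [isLimit_iff hz hd (by rw [e]; exact hs.isCauchy), e, val, val]

theorem isLimit_step_one {s z a b : M.Fn} (hs : IsReal s) (hz : IsReal z) (ha : IsReal a)
    (hb : IsReal b) :
    IsLimit (fun m => approx s m + approx (1 : M.Frac).toReal m * (approx a m - approx b m)) z ↔
      val z = val s + (val a - val b) := by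
  have hd : ∀ m, (approx s m + approx (1 : M.Frac).toReal m * (approx a m - approx b m)).den ≠ 0 :=
    fun m => den_add (den_approx _ _)
      (den_mul (den_approx _ _) (den_sub (den_approx _ _) (den_approx _ _)))
  have e : (fun m => (approx s m + approx (1 : M.Frac).toReal m *
      (approx a m - approx b m)).toRat) =
      fun m => (approx s m).toRat + ((approx a m).toRat + -(approx b m).toRat) := by
    funext m
    rw [toRat_add (den_approx _ _)
      (den_mul (den_approx _ _) (den_sub (den_approx _ _) (den_approx _ _))),
      toRat_mul (den_approx _ _) (den_sub (den_approx _ _) (den_approx _ _)),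
      toRat_sub (den_approx _ _) (den_approx _ _),
      approx_toReal den_one, toRat_one, one_mul, sub_eq_add_neg]
  have hab := ha.isCauchy.add hb.isCauchy.neg
  rw [isLimit_iff hz hd (by rw [e]; exact hs.isCauchy.add hab), e, lim_add hs.isCauchy hab,
    lim_add ha.isCauchy hb.isCauchy.neg, lim_neg hb.isCauchy, sub_eq_add_neg]
  rfl

/-- The number of division points may be nonstandard, so the induction is internal: it runs on the
decidable relation `RLe`, not on the external `val`. -/
theorem rLe_of_steps {n : M.N} {x : M.Obj (FinType.zero ⇾ FinType.one)}
    (hx : ∀ i : M.N, i ≤ n → IsReal (x ⬝ i))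
    (h : ∀ i : M.N, i < n → val (x ⬝ i) ≤ val (x ⬝ (i + 1))) {i j : M.N} (hij : i ≤ j)
    (hj : j ≤ n) : val (x ⬝ i) ≤ val (x ⬝ j) := by
  have hd : Dec fun j : M.N => i ≤ j → j ≤ n → RLe (x ⬝ i) (x ⬝ j) :=
    Dec.imp (by fun_prop) (Dec.imp (by fun_prop) (by fun_prop))
  rw [← rLe_iff (hx i (hij.trans hj)) (hx j hj)]
  refine induction hd ?_ ?_ j hij hj
  · intro hi hn
    rw [le_antisymm hi (zero_le' i), rLe_iff (hx 0 hn) (hx 0 hn)]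
  · intro j ih hi hn
    have hjn : j < n := lt_iff_add_one_le'.2 hn
    rcases hi.lt_or_eq with hi | rfl
    · have hi := lt_add_one_iff'.1 hi
      rw [rLe_iff (hx i (hi.trans hjn.le)) (hx _ hn)]
      have := (rLe_iff (hx i (hi.trans hjn.le)) (hx _ hjn.le)).1 (ih hi hjn.le)
      exact this.trans (h j hjn)
    · rw [rLe_iff (hx _ hn) (hx _ hn)]

theorem rGe_of_steps {n : M.N} {x : M.Obj (FinType.zero ⇾ FinType.one)}
    (hx : ∀ i : M.N, i ≤ n → IsReal (x ⬝ i))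
    (h : ∀ i : M.N, i < n → val (x ⬝ (i + 1)) ≤ val (x ⬝ i)) : val (x ⬝ n) ≤ val (x ⬝ (0 : M.N)) := by
  have hd : Dec fun j : M.N => j ≤ n → RLe (x ⬝ j) (x ⬝ (0 : M.N)) :=
    Dec.imp (by fun_prop) (by fun_prop)
  have h0 := hx 0 (zero_le' n)
  rw [← rLe_iff (hx n le_rfl) h0]
  refine induction hd ?_ ?_ n le_rfl
  · intro _
    rw [rLe_iff h0 h0]
  · intro j ih hn
    have hjn : j < n := lt_iff_add_one_le'.2 hn
    rw [rLe_iff (hx _ hn) h0]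
    exact (h j hjn).trans ((rLe_iff (hx _ hjn.le) h0).1 (ih hjn.le))

/-- The tags of a partition of `[p, q]` lie in `[p, q]`. -/
theorem IsPartition.tag_mem {p q : M.Fn} (hp : IsReal p) (hq : IsReal q) (hpq : val p < val q)
    {n : M.N} {x t : M.Obj (FinType.zero ⇾ FinType.one)} (h : IsPartition p q n x t) {i : M.N}
    (hi : i < n) : val p ≤ val (t ⬝ i) ∧ val (t ⬝ i) ≤ val q := by
  obtain ⟨hx, ht, h0, hn, h⟩ := h
  rw [rEq_iff (hx _ (zero_le' n)) hp] at h0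
  rw [rEq_iff (hx _ le_rfl) hq] at hn
  have hi' := lt_iff_add_one_le'.1 hi
  rcases h with h | h
  · have h' : ∀ i : M.N, i < n → val (x ⬝ i) ≤ val (t ⬝ i) ∧ val (t ⬝ i) ≤ val (x ⬝ (i + 1)) := by
      intro i hi
      have hi' := lt_iff_add_one_le'.1 hi
      rw [← rLe_iff (hx i hi.le) (ht i hi), ← rLe_iff (ht i hi) (hx _ hi')]
      exact h i hi
    have mono : ∀ i : M.N, i < n → val (x ⬝ i) ≤ val (x ⬝ (i + 1)) :=
      fun i hi => (h' i hi).1.trans (h' i hi).2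
    rw [← h0, ← hn]
    exact ⟨(rLe_of_steps hx mono (zero_le' i) hi.le).trans (h' i hi).1,
      (h' i hi).2.trans (rLe_of_steps hx mono hi' le_rfl)⟩
  -- A decreasing partition would give `q ≤ p`.
  · refine absurd (rGe_of_steps hx fun i hi => ?_) (not_le.2 (by rwa [h0, hn]))
    have hi' := lt_iff_add_one_le'.1 hi
    have := h i hi
    rw [rLe_iff (ht i hi) (hx i hi.le), rLe_iff (hx _ hi') (ht i hi)] at this
    exact this.1.trans this.2

theorem IsRiemannSum.val_eq_zero {f : M.Obj (FinType.one ⇾ FinType.one)} {n : M.N}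
    {x t : M.Obj (FinType.zero ⇾ FinType.one)} {v : M.Fn} (h : IsRiemannSum f n x t v)
    (hf : ∀ i : M.N, i < n → f ⬝ (t ⬝ i) = (0 : M.Frac).toReal) : IsReal v ∧ val v = 0 := by
  obtain ⟨s, hs, h0, hstep, hv, hvs⟩ := h
  refine ⟨hv, ?_⟩
  rw [rEq_iff hv (hs n le_rfl)] at hvs
  have hz : IsReal (0 : M.Frac).toReal := isReal_toReal den_zero
  have hd : Dec fun i : M.N => i ≤ n → REq (s ⬝ i) (0 : M.Frac).toReal :=
    Dec.imp (by fun_prop) (by fun_prop)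
  have key := induction hd (fun _ => h0) (fun i ih hi => by
    have hi' : i < n := lt_iff_add_one_le'.2 hi
    have hst := hstep i hi'
    rw [hf i hi', isLimit_step_zero (hs i hi'.le) (hs _ hi)] at hst
    rw [rEq_iff (hs _ hi) hz, hst, ← rEq_iff (hs i hi'.le) hz]
    exact ih hi'.le) n le_rfl
  rw [rEq_iff (hs n le_rfl) hz, val_zero] at key
  rw [hvs, key]

/-- The division points `2⁻ⁿ⁻¹ + i 2⁻ⁿ⁻¹⁻ᵐ`. -/
def gridFrac (n m i : M.N) : M.Frac := dyFrac (M.pow2 ⬝ m + i) 0 (n + 1 + m)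

theorem val_dyFrac_zero (a k : M.N) :
    val (dyFrac a 0 k).toReal = ofRat M (RatM.ofNat a) * tiny k := by
  rw [val_toReal (den_dyFrac _ _ _), toRat_dyFrac, map_zero, sub_zero, map_mul, tiny]

theorem ofRat_pow2_mul_tiny (k m : M.N) :
    ofRat M (RatM.ofNat (M.pow2 ⬝ m)) * tiny (k + m) = tiny k := by
  rw [tiny, hp_add, ← map_mul, mul_left_comm, ofNat_pow2_mul_hp, mul_one, tiny]

theorem val_gridFrac (n m i : M.N) : val (gridFrac n m i).toReal =
    tiny (n + 1) + ofRat M (RatM.ofNat i) * tiny (n + 1 + m) := by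
  rw [gridFrac, val_dyFrac_zero, map_add, map_add, add_mul, ofRat_pow2_mul_tiny]

theorem isReal_gridFrac (n m i : M.N) : IsReal (gridFrac n m i).toReal :=
  isReal_toReal (den_dyFrac _ _ _)

theorem val_gridFrac_succ (n m i : M.N) : val (gridFrac n m (i + 1)).toReal =
    val (gridFrac n m i).toReal + tiny (n + 1 + m) := by
  rw [val_gridFrac, val_gridFrac, map_add, map_add, map_one, map_one]
  ring

/-- The indices `0` and `2ᵐ` give the end-points, and the cells have length `2⁻ⁿ⁻¹⁻ᵐ < 2⁻ᵐ`. -/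
theorem isPartition_grid {n m : M.N} {t : M.Obj (FinType.zero ⇾ FinType.one)}
    (ht : ∀ i, IsReal (t ⬝ i)) (h : ∀ i, val (gridFrac n m i).toReal ≤ val (t ⬝ i) ∧
      val (t ⬝ i) ≤ val (gridFrac n m i).toReal + tiny (n + 1 + m)) :
    IsPartition (Frac.invPow2 (n + 1)).toReal (Frac.invPow2 n).toReal (M.pow2 ⬝ m)
        (lam fun i => (gridFrac n m i).toReal) t ∧
      MeshLt m (M.pow2 ⬝ m) (lam fun i => (gridFrac n m i).toReal) := by
  have hx : ∀ i, (lam fun i => (gridFrac n m i).toReal) ⬝ i = (gridFrac n m i).toReal := by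
    intro i
    refine lam_app ?_ i
    unfold gridFrac
    fun_prop
  have hr := isReal_gridFrac n m
  refine ⟨⟨fun i _ => ?_, fun i _ => ht i, ?_, ?_, Or.inl fun i _ => ?_⟩, fun i _ => ?_⟩
  · rw [hx]
    exact hr i
  · rw [hx, rEq_iff (hr 0) (isReal_toReal (den_invPow2 _)), val_invPow2, val_gridFrac, map_zero,
      map_zero, zero_mul, add_zero]
  · rw [hx, rEq_iff (hr _) (isReal_toReal (den_invPow2 _)), val_invPow2, val_gridFrac,
      ofRat_pow2_mul_tiny, tiny_succ_add]
  · rw [hx, hx, rLe_iff (hr i) (ht i), rLe_iff (ht i) (hr _), val_gridFrac_succ]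
    exact h i
  · rw [hx, hx, near_iff (hr _) (hr _), val_gridFrac_succ, sub_add_cancel_left, abs_neg,
      abs_of_pos (tiny_pos _)]
    refine tiny_lt ?_
    rw [add_right_comm]
    exact lt_add_one_iff'.2 le_add_self

/-- There are arbitrarily fine partitions with Riemann sum `0`. -/
theorem exists_sum_zero (Y : M.Obj (FinType.one ⇾ FinType.zero ⇾ FinType.zero)) (n m : M.N) :
    ∃ (N : M.N) (x t : M.Obj (FinType.zero ⇾ FinType.one)),
      IsPartition (Frac.invPow2 (n + 1)).toReal (Frac.invPow2 n).toReal N x t ∧ MeshLt m N x ∧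
        IsRiemannSum (codeFun Y) N x t (0 : M.Frac).toReal := by
  have hx : ∀ i, (lam fun i => (gridFrac n m i).toReal) ⬝ i = (gridFrac n m i).toReal := by
    intro i
    refine lam_app ?_ i
    unfold gridFrac
    fun_prop
  have hr := isReal_gridFrac n m
  -- The left end-points of the cells serve as tags. They are dyadic, so the function is `0` there
  -- and all partial sums are `0`.
  obtain ⟨h1, h2⟩ := isPartition_grid (n := n) (m := m) (t := lam fun i => (gridFrac n m i).toReal)
    (fun i => by rw [hx]; exact hr i) fun i => by
      rw [hx]
      exact ⟨le_rfl, by linarith [tiny_pos (n + 1 + m)]⟩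
  have hz : IsReal (0 : M.Frac).toReal := isReal_toReal den_zero
  have hs : ∀ i : M.N, (lam fun _ : M.N => (0 : M.Frac).toReal) ⬝ i = (0 : M.Frac).toReal :=
    fun i => lam_app (by fun_prop) i
  refine ⟨_, _, _, h1, h2, lam fun _ => (0 : M.Frac).toReal, fun i _ => ?_, ?_, fun i _ => ?_, hz, ?_⟩
  · rwa [hs]
  · rw [hs, rEq_iff hz hz]
  · rw [hs, hs, hx, codeFun_eq_zero (hr i), isLimit_step_zero hz hz]
    rw [gridFrac, val_toReal (den_dyFrac _ _ _)]
    exact IsDyadic.not_codesVal ⟨_, _, _, rfl⟩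
  · rw [hs, rEq_iff hz hz]

/-- If `Y(g, n) = 0`, then there are arbitrarily fine partitions of `[2⁻ⁿ⁻¹, 2⁻ⁿ]` with Riemann sum
`2⁻ⁿ⁻¹`. -/
theorem exists_sum_tiny {n : M.N} {g : M.Fn} (hg : Y ⬝ g ⬝ n = (0 : M.N)) (m : M.N) :
    ∃ (N : M.N) (x t : M.Obj (FinType.zero ⇾ FinType.one)) (v : M.Fn),
      IsPartition (Frac.invPow2 (n + 1)).toReal (Frac.invPow2 n).toReal N x t ∧ MeshLt m N x ∧
        IsRiemannSum (codeFun Y) N x t v ∧ IsReal v ∧ val v = tiny (n + 1) := by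
  have hx : ∀ i, (lam fun i => (gridFrac n m i).toReal) ⬝ i = (gridFrac n m i).toReal := by
    intro i
    refine lam_app ?_ i
    unfold gridFrac
    fun_prop
  have hr := isReal_gridFrac n m
  have hd : ∀ i : M.N, (dyFrac i 0 (n + 1 + m)).den ≠ 0 := fun i => den_dyFrac _ _ _
  have δpos := tiny_pos (n + 1 + m)
  have ofRat_nonneg : ∀ i : M.N, 0 ≤ ofRat M (RatM.ofNat i) := fun i => by
    rw [← map_zero (ofRat M), ofRat_le]
    exact RatM.ofNat_nonneg i
  have xend : val (gridFrac n m (M.pow2 ⬝ m)).toReal = tiny n := by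
    rw [val_gridFrac, ofRat_pow2_mul_tiny, tiny_succ_add]
  have xge : ∀ i : M.N, tiny (n + 1) ≤ val (gridFrac n m i).toReal := fun i => by
    rw [val_gridFrac]
    exact le_add_of_nonneg_right (mul_nonneg (ofRat_nonneg i) δpos.le)
  have xle : ∀ {i j : M.N}, i ≤ j → val (gridFrac n m i).toReal ≤ val (gridFrac n m j).toReal := by
    intro i j h
    rw [val_gridFrac, val_gridFrac]
    gcongr
    exact ofRat_le.2 (RatM.ofNat_le.2 h)
  -- The midpoint of the first cell. A coded point `r` less than half a cell away lies inside this
  -- cell, and its translates by multiples of the cell length lie in the other cells and are coded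
  -- as well.
  obtain ⟨y, hy, hy'⟩ := exists_translate (hr 0) (n + 1 + m + 1)
  have x0 : val (gridFrac n m 0).toReal = tiny (n + 1) := by
    rw [val_gridFrac, map_zero, map_zero, zero_mul, add_zero]
  rw [x0] at hy'
  have half := tiny_succ_add (n + 1 + m)
  have half' := tiny_pos (n + 1 + m + 1)
  have last : tiny (n + 1) + tiny (n + 1 + m) ≤ tiny n := by
    rw [← x0, ← val_gridFrac_succ, ← xend]
    exact xle (lt_iff_add_one_le'.1 (pow2_pos m))
  obtain ⟨r, hr1, hr2, hr3, hr4⟩ := exists_codesVal_near hg hy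
    ⟨by linarith, by linarith⟩ (n + 1 + m + 1)
  have hr3 := abs_lt.1 hr3
  have vs : ∀ i, val (shift r (dyFrac i 0 (n + 1 + m))) =
      val r + ofRat M (RatM.ofNat i) * tiny (n + 1 + m) := fun i => by
    rw [val_shift hr1 (hd i), ← val_toReal (hd i), val_dyFrac_zero]
  have rs := fun i => isReal_shift hr1 (hd i)
  have ht : ∀ i, (lam fun i => shift r (dyFrac i 0 (n + 1 + m))) ⬝ i =
    shift r (dyFrac i 0 (n + 1 + m)) := fun i => lam_app (by fun_prop) i
  have tlt : ∀ i, val (gridFrac n m i).toReal < val (shift r (dyFrac i 0 (n + 1 + m))) ∧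
      val (shift r (dyFrac i 0 (n + 1 + m))) <
        val (gridFrac n m i).toReal + tiny (n + 1 + m) := fun i => by
    rw [vs, val_gridFrac]
    constructor <;> linarith [hr3.1, hr3.2]
  have hs : ∀ i, (lam fun i : M.N => (dyFrac i 0 (n + 1 + m)).toReal) ⬝ i =
    (dyFrac i 0 (n + 1 + m)).toReal := fun i => lam_app (by fun_prop) i
  obtain ⟨h1, h2⟩ := isPartition_grid (n := n) (m := m)
    (t := lam fun i => shift r (dyFrac i 0 (n + 1 + m)))
    (fun i => by rw [ht]; exact rs i) fun i => by
      rw [ht]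
      exact ⟨(tlt i).1.le, (tlt i).2.le⟩
  have sr : ∀ i : M.N, IsReal (dyFrac i 0 (n + 1 + m)).toReal := fun i => isReal_toReal (hd i)
  -- All tags have value `1`, so the partial sum after `i` cells is `i · 2⁻ⁿ⁻¹⁻ᵐ`, which is `2⁻ⁿ⁻¹`
  -- for `i = 2ᵐ`.
  refine ⟨_, _, _, _, h1, h2, ⟨lam fun i : M.N => (dyFrac i 0 (n + 1 + m)).toReal, fun i _ => ?_,
    ?_, fun i hi => ?_, sr (M.pow2 ⬝ m), ?_⟩, sr _, ?_⟩
  · rw [hs]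
    exact sr i
  · rw [hs, rEq_iff (sr 0) (isReal_toReal den_zero), val_zero, val_dyFrac_zero, map_zero, map_zero,
      zero_mul]
  · have hc : CodesVal Y (val (shift r (dyFrac i 0 (n + 1 + m)))) := by
      have hlt := (tlt i).2
      rw [← val_gridFrac_succ] at hlt
      have hle := xle (lt_iff_add_one_le'.1 hi)
      rw [xend] at hle
      have mem := And.intro ((xge i).trans_lt (tlt i).1) (hlt.trans_le hle)
      rw [val_shift hr1 (hd i)] at mem ⊢
      exact hr4.translate ⟨_, _, _, rfl⟩ hr2 mem
    rw [hs, hs, hx, hx, ht, codeFun_eq_one (rs i) hc,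
      isLimit_step_one (sr i) (sr _) (hr _) (hr _), val_gridFrac_succ, val_dyFrac_zero,
      val_dyFrac_zero, map_add, map_add, map_one, map_one]
    ring
  · rw [hs, rEq_iff (sr _) (sr _)]
  · rw [val_dyFrac_zero, ofRat_pow2_mul_tiny]

/-! ### Integrals over `[2⁻ⁿ⁻¹, 2⁻ⁿ]` and the recovery of `BOOT`. -/

theorem isReal_invPow2 (n : M.N) : IsReal (Frac.invPow2 n).toReal := isReal_toReal (den_invPow2 n)

/-- A coded tag would lie in the open interval, the end-points being dyadic, and would yield some
`g`. So every Riemann sum is `0`, for any mesh bound. -/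
theorem integralEqReal_zero {n : M.N} (hg : ¬ ∃ g : M.Fn, Y ⬝ g ⬝ n = (0 : M.N)) :
    IntegralEqReal (codeFun Y) (Frac.invPow2 (n + 1)).toReal (Frac.invPow2 n).toReal
      (0 : M.Frac).toReal := by
  have hz : IsReal (0 : M.Frac).toReal := isReal_toReal den_zero
  have hlt : tiny (n + 1) < tiny n := tiny_lt (lt_add_one_iff'.2 le_rfl)
  refine ⟨hz, fun k => ⟨0, fun N x t v h _ hs => ?_⟩⟩
  obtain ⟨hv, hv'⟩ := hs.val_eq_zero fun i hi => by
    have ht := h.2.1 i hi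
    refine codeFun_eq_zero ht fun hc => hg ?_
    have hb := h.tag_mem (isReal_invPow2 _) (isReal_invPow2 _)
      (by rwa [val_invPow2, val_invPow2]) hi
    rw [val_invPow2, val_invPow2] at hb
    have ne : ∀ {z}, IsDyadic z → val (t ⬝ i) ≠ z := fun h h' => (h' ▸ h).not_codesVal hc
    exact hc.exists_eq_zero ⟨lt_of_le_of_ne hb.1 (ne (isDyadic_tiny _)).symm,
      lt_of_le_of_ne hb.2 (ne (isDyadic_tiny _))⟩
  rw [near_iff hv hz, hv', val_zero, sub_zero, abs_zero]
  exact tiny_pos k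

/-- Arbitrarily fine sums equal `0` and `2⁻ⁿ⁻¹`; both cannot be closer than `2⁻ⁿ⁻²` to `I`. -/
theorem not_integralEqReal {n : M.N} {g : M.Fn} (hg : Y ⬝ g ⬝ n = (0 : M.N)) (I : M.Fn) :
    ¬ IntegralEqReal (codeFun Y) (Frac.invPow2 (n + 1)).toReal (Frac.invPow2 n).toReal I := by
  rintro ⟨hI, h⟩
  obtain ⟨m, hm⟩ := h (n + 1 + 1)
  have hz : IsReal (0 : M.Frac).toReal := isReal_toReal den_zero
  obtain ⟨N, x, t, h1, h2, h3⟩ := exists_sum_zero Y n m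
  obtain ⟨N', x', t', v, h1', h2', h3', hv, hv'⟩ := exists_sum_tiny hg m
  have a := abs_lt.1 ((near_iff hz hI).1 (hm _ _ _ _ h1 h2 h3))
  have b := abs_lt.1 ((near_iff hv hI).1 (hm _ _ _ _ h1' h2' h3'))
  rw [val_zero] at a
  rw [hv'] at b
  have := tiny_succ_add (n + 1)
  linarith [a.1, a.2, b.1, b.2]

/-- Arbitrarily fine sums equal to `0` rule out `±∞`, so the tag only distinguishes a real value
from `↑`. -/
theorem integral_tag_eq_zero_iff {n e : M.N} {I : M.Fn}
    (h : IntegralEq (codeFun Y) (Frac.invPow2 (n + 1)).toReal (Frac.invPow2 n).toReal e I) :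
    e = 0 ↔ ¬ ∃ g : M.Fn, Y ⬝ g ⬝ n = (0 : M.N) := by
  have hz : IsReal (0 : M.Frac).toReal := isReal_toReal den_zero
  rcases h with ⟨rfl, h⟩ | ⟨rfl, h⟩ | ⟨rfl, h⟩ | ⟨rfl, h⟩
  · refine iff_of_true rfl ?_
    rintro ⟨g, hg⟩
    exact not_integralEqReal hg I h
  · obtain ⟨m, hm⟩ := h 0
    obtain ⟨N, x, t, h1, h2, h3⟩ := exists_sum_zero Y n m
    have := hm _ _ _ _ h1 h2 h3
    beta_reduce at this
    rw [rLt_iff (isReal_toReal (den_ofN _)) hz, val_toReal (den_ofN _), toRat_ofN, map_zero,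
      map_zero, val_zero] at this
    exact absurd this (lt_irrefl _)
  · obtain ⟨m, hm⟩ := h 0
    obtain ⟨N, x, t, h1, h2, h3⟩ := exists_sum_zero Y n m
    have := hm _ _ _ _ h1 h2 h3
    beta_reduce at this
    rw [rLt_iff hz (isReal_toReal (den_neg (den_ofN _))), val_toReal (den_neg (den_ofN _)),
      toRat_neg (den_ofN _), toRat_ofN, map_zero, neg_zero, map_zero, val_zero] at this
    exact absurd this (lt_irrefl _)
  · refine iff_of_false (add_one_ne_zero' _) fun hg => h.1 ⟨_, integralEqReal_zero hg⟩

open Classical in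
/-- An evaluation principle that applies to the coding functions implies `BOOT`. -/
theorem boot_of_evaluationPrinciple {D : Dom} {Γ : M.Obj (FinType.one ⇾ FinType.one) → Prop}
    (hΓ : ∀ Y : M.Obj (FinType.one ⇾ FinType.zero ⇾ FinType.zero), Γ (codeFun Y))
    (h : EvaluationPrinciple D Γ) : M.BOOT := by
  intro Y
  obtain ⟨e, I, h⟩ := h (codeFun Y) (isFun_codeFun D) (hΓ Y)
  -- Tag `0` means that no `g` exists, so membership in the set is a nonzero tag.
  let F : M.N → M.N := fun n =>
    if e ⬝ (Frac.invPow2 (n + 1)).code ⬝ (Frac.invPow2 n).code = (0 : M.N) then 0 else 1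
  have hF : ∀ n, (lam F) ⬝ n = F n := fun n => lam_app (by fun_prop) n
  have mem : ∀ n : M.N, D.Mem (Frac.invPow2 n).toReal := fun n => by
    refine mem_of_unit (isReal_invPow2 n) ?_ ?_ <;> rw [val_invPow2]
    · exact (tiny_pos n).le
    · rw [← tiny_zero]
      exact tiny_anti (zero_le' n)
  refine ⟨lam F, fun n => ?_, fun n => ?_⟩
  · rw [hF]
    simp only [F]
    split_ifs
    · exact Or.inl rfl
    · exact Or.inr rfl
  · have key := integral_tag_eq_zero_iff (h _ _ (den_invPow2 _) (den_invPow2 _) (mem (n + 1)) (mem n))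
    rw [hF]
    simp only [F]
    split_ifs with h'
    · exact iff_of_false zero_ne_one (key.1 h')
    · exact iff_of_true rfl (not_not.1 fun h'' => h' (key.2 h''))

end Integrals

end FinTypeStructure

theorem theorem2p12 (M : FinTypeStructure.{u}) (hM : M.IsModelACA) :
    List.TFAE
      [M.BOOT,
        FinTypeStructure.EvaluationPrinciple (M := M) FinTypeStructure.Dom.line
          (fun f => FinTypeStructure.GraphContinuous FinTypeStructure.Dom.line f),
        FinTypeStructure.EvaluationPrinciple (M := M) FinTypeStructure.Dom.unit
          (fun f => FinTypeStructure.GraphContinuous FinTypeStructure.Dom.unit f ∧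
            FinTypeStructure.MapsToUnit f)] ∧
    ∀ (Γ : FinTypeStructure.WeakNotion) (D : FinTypeStructure.Dom),
      M.BOOT ↔ FinTypeStructure.EvaluationPrinciple (M := M) D (fun f => Γ.Holds D f) := by
  have : Fact M.IsModelACA := ⟨hM⟩
  refine ⟨?_, fun Γ D => ⟨fun h => h.evaluationPrinciple D _,
    FinTypeStructure.boot_of_evaluationPrinciple fun _ =>
      FinTypeStructure.holds_codeFun Γ⟩⟩
  tfae_have 1 → 2 := fun h => h.evaluationPrinciple _ _
  tfae_have 1 → 3 := fun h => h.evaluationPrinciple _ _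
  tfae_have 2 → 1 := FinTypeStructure.boot_of_evaluationPrinciple fun _ =>
    FinTypeStructure.graphContinuous_codeFun
  tfae_have 3 → 1 := FinTypeStructure.boot_of_evaluationPrinciple fun _ =>
    ⟨FinTypeStructure.graphContinuous_codeFun, FinTypeStructure.mapsToUnit_codeFun⟩
  tfae_finish
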